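/- Let $L>0$, let $q\in L_2[0,L]$ be complex valued and $h\in\mathbb{C}$. For $\rho\in\mathbb{C}$ let $S(\rho,\cdot)$ and $\phi(\rho,\cdot)$ be the solutions on $[0,L]$ of $-y''+q(x)y=\rho^2y$ with $S(\rho,0)=0$, $S'(\rho,0)=1$ and $\phi(\rho,0)=1$, $\phi'(\rho,0)=h$, where $'$ is the derivative in $x$ (so $y,y'$ are absolutely continuous and the equation holds almost everywhere). Put $\operatorname{sinc}(z)=\frac{\sin \pi z}{\pi z}$, $\operatorname{sinc}(0)=1$; $j_1(z)=\frac{\sin z}{z^2}-\frac{\cos z}{z}$, $j_1(0)=0$; $\omega(x)=\frac12\int_0^x q(s)\,ds$; $\rho_n=\frac{(2n+1)\pi}{2x}$; and $$a_n(\rho,x)=\operatorname{sinc}\Big(\frac{2\rho x}{\pi}-2n-1\Big)+\operatorname{sinc}\Big(\frac{2\rho x}{\pi}+2n+1\Big),\qquad c_n(\rho,x)=\operatorname{sinc}\Big(\frac{\rho x}{\pi}-n\Big)+\operatorname{sinc}\Big(\frac{\rho x}{\pi}+n\Big).$$ For $x\in(0,L]$ and $N\in\mathbb{N}\cup\{0\}$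 define $$S_N(\rho,x)=\frac{\sin\rho x}{\rho}+\frac{1}{2\rho\sin\rho x}\sum_{n=0}^{N-1}s_n(x)\,a_n(\rho,x),\qquad s_n(x)=(-1)^n\frac{(2n+1)\pi}{x}S(\rho_n,x)-2,$$ $$\mathring S_N(\rho,x)=\cos\rho x+\frac{\omega(x)}{\rho}\sin\rho x+\frac{1}{2\rho\sin\rho x}\sum_{n=0}^{N-1}\mathring s_n(x)\,a_n(\rho,x),\qquad \mathring s_n(x)=(-1)^n\frac{(2n+1)\pi}{x}S'(\rho_n,x)-2\omega(x),$$ $$\varphi_N(\rho,x)=-\rho x\,j_1(\rho x)+\sum_{n=0}^{N-1}\phi_n(x)\,c_n(\rho,x),\qquad \phi_0(x)=\tfrac12\phi(0,x),\quad \phi_n(x)=\phi\big(\tfrac{n\pi}{x},x\big)-(-1)^n\ (n\ge1),$$ $$\mathring\varphi_N(\rho,x)=-\rho\sin\rho x-(h+\omega(x))\rho x\,j_1(\rho x)+\sum_{n=0}^{N-1}\mathring\phi_n(x)\,c_n(\rho,x),$$ with $\mathring\phi_0(x)=\tfrac12\phi'(0,x)$ and $\mathring\phi_n(x)=\phi'\big(\tfrac{n\pi}{x},x\big)-(-1)^n(h+\omega(x))$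 for $n\ge1$. Expressions containing $1/\sin\rho x$ are extended by continuity to their removable singularities. For $C=0$ the factor $\sqrt{\sinh(2Cx)/C}$ is read as its limit $\sqrt{2x}$. (a) There are functions $\varepsilon_N(x)>0$, independent of $\rho$ and $C$, with $\varepsilon_N(x)\to0$ as $N\to\infty$ for every $x\in(0,L]$, such that for all $x\in(0,L]$ and all $N$: $$|S-S_N|\le\frac{\varepsilon_N(x)}{|\rho|},\quad |\phi-\varphi_N|\le\varepsilon_N(x),\quad |S'-\mathring S_N|\le\frac{\varepsilon_N(x)}{|\rho|},\quad |\phi'-\mathring\varphi_N|\le\varepsilon_N(x)$$ at $(\rho,x)$ for all real $\rho\neq0$, and, for every $C\ge0$ and all $\rho\in\mathbb{C}\setminus\{0\}$ with $|\operatorname{Im}\rho|\le C$, the same four estimates hold with each right-hand side multiplied by $\sqrt{\sinh(2Cx)/C}$. (b) For all $x\in(0,L]$ and $C\ge0$, $S_N(\cdot,x)\to S(\cdot,x)$ and $\varphi_N(\cdot,x)\to\phi(\cdot,x)$ uniformly in the strip $|\operatorname{Im}\rho|\le C$. (c) Suppose moreover that $q\in W_2^1[0,L]$ (that is, $q$ is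 absolutely continuous and $q'\in L_2[0,L]$), and put $q^+(x)=\frac{q(x)+q(0)}4-\frac{\omega^2(x)}2$, $q^h(x)=\frac{q(x)-q(0)}4-\frac{\omega^2(x)}2-h\,\omega(x)$, $$\mathtt{s}_N(\rho,x)=\frac{\sin\rho x}{\rho}-\frac{\cos\rho x}{\rho^2}\omega(x)+\frac{\sin\rho x}{\rho^3}q^+(x)-\frac{1}{2\rho^3\sin\rho x}\sum_{n=0}^{N-1}\mathfrak{s}_n(x)\,a_n(\rho,x),$$ $$\Phi_N(\rho,x)=\cos\rho x+\frac{\sin\rho x}{\rho}(h+\omega(x))-\frac{x}{\rho}j_1(\rho x)\,q^h(x)-\frac1{\rho^2}\sum_{n=1}^{N}\Phi_n^{*}(x)\,c_n(\rho,x),$$ where $\mathfrak{s}_n(x)=(-1)^{n+1}\frac{((2n+1)\pi)^3}{4x^3}S(\rho_n,x)+2\rho_n^2+2q^+(x)$ and $\Phi_n^{*}(x)=\big((-1)^n-\phi(\tfrac{n\pi}x,x)\big)\big(\tfrac{n\pi}x\big)^2+(-1)^nq^h(x)$. Then there are $\varepsilon_N(x)>0$, independent of $\rho$ and $C$, tending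 to $0$ as $N\to\infty$ for every $x\in(0,L]$, such that for all $x\in(0,L]$ and all $N$ $$|S(\rho,x)-\mathtt{s}_N(\rho,x)|\le\frac{\varepsilon_N(x)}{|\rho|^3},\qquad |\phi(\rho,x)-\Phi_N(\rho,x)|\le\frac{\varepsilon_N(x)}{|\rho|^2}$$ for all real $\rho\ne0$, and, for every $C\ge0$ and all $\rho\in\mathbb{C}\setminus\{0\}$ with $|\operatorname{Im}\rho|\le C$, both estimates hold with each right-hand side multiplied by $\sqrt{\sinh(2Cx)/C}$. -/

import Mathlib

open Set Filter Topology MeasureTheory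

noncomputable section

namespace SincSL

/-- The potential `q` belongs to `L₂[0, L]` (complex valued). -/
def IsL2 (q : ℝ → ℂ) (L : ℝ) : Prop :=
  MemLp q 2 (volume.restrict (Icc 0 L))

/-- The potential `q` belongs to the Sobolev space `W₂¹[0, L]`; as point values of `q` are used,
`q` is its absolutely continuous representative, and `q' ∈ L₂[0, L]`. -/
def IsW21 (q : ℝ → ℂ) (L : ℝ) : Prop :=
  AbsolutelyContinuousOnInterval q 0 L ∧ MemLp (deriv q) 2 (volume.restrict (Icc 0 L))

/-- The derivative of `y` on the segment `[0, L]` (one-sided at the end points). -/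
def dx (L : ℝ) (y : ℝ → ℂ) : ℝ → ℂ := derivWithin y (Icc 0 L)

/-- `y` is the (Carathéodory) solution on `[0, L]` of `-y'' + q y = ρ² y` with initial values
`y 0 = a`, `y' 0 = b`: `y` is differentiable on `[0, L]`, `y'` is absolutely continuous, and
`y'' = q y - ρ² y` almost everywhere. -/
structure IsSolution (q : ℝ → ℂ) (L : ℝ) (ρ a b : ℂ) (y : ℝ → ℂ) : Prop where
  differentiableOn : DifferentiableOn ℝ y (Icc 0 L)
  absolutelyContinuous : AbsolutelyContinuousOnInterval (dx L y) 0 L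
  equation : ∀ᵐ x ∂(volume.restrict (Ioo 0 L)),
    HasDerivAt (dx L y) (q x * y x - ρ ^ 2 * y x) x
  initial_value : y 0 = a
  initial_deriv : dx L y 0 = b

/-- The normalized sinc function `sin (π z) / (π z)` on `ℂ`, with value `1` at `0`. -/
def csinc (z : ℂ) : ℂ :=
  if z = 0 then 1 else Complex.sin (Real.pi * z) / (Real.pi * z)

/-- The spherical Bessel function of order one, `j₁ z = sin z / z² - cos z / z`, `j₁ 0 = 0`. -/
def sphJ1 (z : ℂ) : ℂ :=
  if z = 0 then 0 else Complex.sin z / z ^ 2 - Complex.cos z / z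

/-- The value at `ρ` of `f`, extended by continuity to its removable singularities. -/
def byLimit (f : ℂ → ℂ) (ρ : ℂ) : ℂ := limUnder (𝓝[≠] ρ) f

/-- At the points of continuity nothing changes. -/
theorem byLimit_eq {f : ℂ → ℂ} {ρ : ℂ} (hf : ContinuousAt f ρ) : byLimit f ρ = f ρ :=
  (hf.tendsto.mono_left nhdsWithin_le_nhds).limUnder_eq

/-- `ω(x) = ½ ∫₀ˣ q`. -/
def omega (q : ℝ → ℂ) (x : ℝ) : ℂ := (1 / 2) * ∫ s in (0 : ℝ)..x, q s

/-- `q⁺(x) = (q(x) + q(0))/4 - ω(x)²/2`. -/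
def qPlus (q : ℝ → ℂ) (x : ℝ) : ℂ := (q x + q 0) / 4 - omega q x ^ 2 / 2

/-- `qʰ(x) = (q(x) - q(0))/4 - ω(x)²/2 - h ω(x)`. -/
def qh (q : ℝ → ℂ) (h : ℂ) (x : ℝ) : ℂ :=
  (q x - q 0) / 4 - omega q x ^ 2 / 2 - h * omega q x

/-- The node `(2n+1)π/(2x)`. -/
def oddNode (n : ℕ) (x : ℝ) : ℂ := (2 * n + 1) * Real.pi / (2 * x)

/-- The node `nπ/x`. -/
def intNode (n : ℕ) (x : ℝ) : ℂ := n * Real.pi / x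

/-- `sinc(2ρx/π - 2n - 1) + sinc(2ρx/π + 2n + 1)`. -/
def oddSincSum (n : ℕ) (ρ : ℂ) (x : ℝ) : ℂ :=
  csinc (2 * ρ * x / Real.pi - 2 * n - 1) + csinc (2 * ρ * x / Real.pi + 2 * n + 1)

/-- `sinc(ρx/π - n) + sinc(ρx/π + n)`. -/
def intSincSum (n : ℕ) (ρ : ℂ) (x : ℝ) : ℂ :=
  csinc (ρ * x / Real.pi - n) + csinc (ρ * x / Real.pi + n)

/-! Coefficients of the cardinal series. The solutions are passed as functions `S ρ x`, `φ ρ x`. -/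

/-- `sₙ(x)`. -/
def coeffS (S : ℂ → ℝ → ℂ) (n : ℕ) (x : ℝ) : ℂ :=
  (-1) ^ n * (2 * n + 1) * Real.pi / x * S (oddNode n x) x - 2

/-- The coefficients in the series of `S'`. -/
def coeffDS (L : ℝ) (q : ℝ → ℂ) (S : ℂ → ℝ → ℂ) (n : ℕ) (x : ℝ) : ℂ :=
  (-1) ^ n * (2 * n + 1) * Real.pi / x * dx L (S (oddNode n x)) x - 2 * omega q x

/-- `φₙ(x)`. -/
def coeffPhi (φ : ℂ → ℝ → ℂ) (n : ℕ) (x : ℝ) : ℂ :=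
  if n = 0 then φ 0 x / 2 else φ (intNode n x) x - (-1) ^ n

/-- The coefficients in the series of `φ'`. -/
def coeffDPhi (L : ℝ) (q : ℝ → ℂ) (h : ℂ) (φ : ℂ → ℝ → ℂ) (n : ℕ) (x : ℝ) : ℂ :=
  if n = 0 then dx L (φ 0) x / 2
  else dx L (φ (intNode n x)) x - (-1) ^ n * (h + omega q x)

/-- The coefficients in the series of `S` for `q ∈ W₂¹`. -/
def coeffSNew (q : ℝ → ℂ) (S : ℂ → ℝ → ℂ) (n : ℕ) (x : ℝ) : ℂ :=
  (-1) ^ (n + 1) * S (oddNode n x) x * (((2 * n + 1) * Real.pi) ^ 3 / (4 * x ^ 3))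
    + 2 * oddNode n x ^ 2 + 2 * qPlus q x

/-- The coefficients in the series of `φ` for `q ∈ W₂¹` (for `n ≥ 1`). -/
def coeffPhiNew (q : ℝ → ℂ) (h : ℂ) (φ : ℂ → ℝ → ℂ) (n : ℕ) (x : ℝ) : ℂ :=
  ((-1) ^ n - φ (intNode n x) x) * intNode n x ^ 2 + (-1) ^ n * qh q h x

/-! Partial sums. The expressions which carry the factor `1 / sin(ρx)` have removable
singularities at the zeros `ρ ≠ 0` of `sin(ρx)` and are extended by continuity. -/

/-- `S_N(ρ, x)`. -/
def partialS (S : ℂ → ℝ → ℂ) (N : ℕ) (ρ : ℂ) (x : ℝ) : ℂ :=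
  byLimit (fun ρ => Complex.sin (ρ * x) / ρ
    + 1 / (2 * ρ * Complex.sin (ρ * x))
      * ∑ n ∈ Finset.range N, coeffS S n x * oddSincSum n ρ x) ρ

/-- The partial sums for `S'`. -/
def partialDS (L : ℝ) (q : ℝ → ℂ) (S : ℂ → ℝ → ℂ) (N : ℕ) (ρ : ℂ) (x : ℝ) : ℂ :=
  byLimit (fun ρ => Complex.cos (ρ * x) + omega q x / ρ * Complex.sin (ρ * x)
    + 1 / (2 * ρ * Complex.sin (ρ * x))
      * ∑ n ∈ Finset.range N, coeffDS L q S n x * oddSincSum n ρ x) ρ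

/-- `φ_N(ρ, x)`. -/
def partialPhi (φ : ℂ → ℝ → ℂ) (N : ℕ) (ρ : ℂ) (x : ℝ) : ℂ :=
  -(ρ * x * sphJ1 (ρ * x)) + ∑ n ∈ Finset.range N, coeffPhi φ n x * intSincSum n ρ x

/-- The partial sums for `φ'`. -/
def partialDPhi (L : ℝ) (q : ℝ → ℂ) (h : ℂ) (φ : ℂ → ℝ → ℂ) (N : ℕ) (ρ : ℂ) (x : ℝ) : ℂ :=
  -(ρ * Complex.sin (ρ * x)) - (h + omega q x) * (ρ * x * sphJ1 (ρ * x))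
    + ∑ n ∈ Finset.range N, coeffDPhi L q h φ n x * intSincSum n ρ x

/-- The partial sums for `S` when `q ∈ W₂¹`. -/
def partialSNew (q : ℝ → ℂ) (S : ℂ → ℝ → ℂ) (N : ℕ) (ρ : ℂ) (x : ℝ) : ℂ :=
  byLimit (fun ρ => Complex.sin (ρ * x) / ρ - Complex.cos (ρ * x) / ρ ^ 2 * omega q x
    + Complex.sin (ρ * x) / ρ ^ 3 * qPlus q x
    - 1 / (2 * ρ ^ 3 * Complex.sin (ρ * x))
      * ∑ n ∈ Finset.range N, coeffSNew q S n x * oddSincSum n ρ x) ρ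

/-- The partial sums for `φ` when `q ∈ W₂¹` (summation over `n = 1, …, N`). -/
def partialPhiNew (q : ℝ → ℂ) (h : ℂ) (φ : ℂ → ℝ → ℂ) (N : ℕ) (ρ : ℂ) (x : ℝ) : ℂ :=
  Complex.cos (ρ * x) + Complex.sin (ρ * x) / ρ * (h + omega q x)
    - x / ρ * sphJ1 (ρ * x) * qh q h x
    - 1 / ρ ^ 2 * ∑ n ∈ Finset.Icc 1 N, coeffPhiNew q h φ n x * intSincSum n ρ x

/-- The factor `√(sinh(2Cx)/C)` for `C ≥ 0`, with its limit `√(2x)` as the value at `C = 0`. -/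
def stripFactor (C x : ℝ) : ℝ :=
  if C = 0 then Real.sqrt (2 * x) else Real.sqrt (Real.sinh (2 * C * x) / C)

/-- `ε N x` is positive and tends to zero as `N → ∞`, for every `x ∈ (0, L]`. -/
def IsRemainderBound (L : ℝ) (ε : ℕ → ℝ → ℝ) : Prop :=
  ∀ x ∈ Ioc 0 L, (∀ N, 0 < ε N x) ∧ Tendsto (fun N => ε N x) atTop (𝓝 0)

end SincSL

end

/-! For fixed `x`, subtract the explicit trigonometric terms from a solution (or its derivative) and
multiply by the right power of `ρ`: what is left is the Fourier transform of a density in L₂(-x, x).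
Its cardinal series is the Fourier series of that density, so the tails of the series are again
transforms, of densities whose norms tend to zero. Cauchy–Schwarz against `t ↦ exp (iρt)` bounds a
tail by this norm times the L₂(-x, x) norm of the exponential, which is at most √(sinh(2Cx)/C) in
the strip. Hence ε depends neither on `ρ` nor on `C`.

No transmutation kernel is constructed. The class is used in its dual form `PW`, an inequality for
finite combinations of values, which passes at once to pointwise limits, superpositions and products
with exponentials. Its stability under the Volterra equation is `PWF.of_volterra`: the kernel
sin(ρ(x-s))/ρ adds exponential type x-s to type s, and in the weight `exp (κx)` the operator is a
contraction, uniformly in `ρ`. The leading terms cos ρx and sin ρx are transforms of point masses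
and lie outside the class, but the Volterra operator maps them into it (`PWF.sub_of_volterra`).
Multiplying by `ρ` and turning products of trigonometric functions into sums splits off the next
explicit term; for `q` in W₂¹ an integration by parts gives one order more (`PWF.phi_third`,
`PWF.S_third`).

The sampling step is `PW.sampling`. By Parseval the functional is represented by a vector of ℓ²,
whose coordinates are, up to conjugation, the samples, and truncating the series truncates the
vector. Even functions are sampled at nπ/x, odd ones at (2n+1)π/(2x). By `oddSincSum_eq` each sum of
sincs attached to the odd nodes contains the factor sin ρx, so the singularities there are
removable. Uniform convergence of S_N up to ρ = 0 rests on the oddness of its remainder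
(`PW.norm_div_le`). -/

namespace SincSL

/-! ### The kernel sin(ρa)/ρ. -/

/-- `sin (ρ a) / ρ`, with the value `a` at `ρ = 0`. -/
noncomputable def sn (ρ : ℂ) (a : ℝ) : ℂ := if ρ = 0 then (a : ℂ) else Complex.sin (ρ * a) / ρ

theorem mul_sn (ρ : ℂ) (a : ℝ) : ρ * sn ρ a = Complex.sin (ρ * a) := by
  by_cases h : ρ = 0
  · simp [sn, h]
  · simp only [sn, h, if_false]
    field_simp

@[simp] theorem sn_zero_right (ρ : ℂ) : sn ρ 0 = 0 := by
  by_cases h : ρ = 0 <;> simp [sn, h]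

theorem sn_neg_left (ρ : ℂ) (a : ℝ) : sn (-ρ) a = sn ρ a := by
  by_cases h : ρ = 0 <;> simp [sn, h]

theorem hasDerivAt_sn (ρ : ℂ) (a : ℝ) :
    HasDerivAt (fun t : ℝ => sn ρ t) (Complex.cos (ρ * a)) a := by
  by_cases h : ρ = 0
  · simp only [sn, h, if_true, zero_mul, Complex.cos_zero]
    exact (hasDerivAt_id a).ofReal_comp
  · simp only [sn, h, if_false]
    have h1 : HasDerivAt (fun z : ℂ => ρ * z) ρ (a : ℂ) := by
      simpa using (hasDerivAt_id (a : ℂ)).const_mul ρ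
    have h2 := ((h1.csin).div_const ρ).comp_ofReal
    rwa [mul_div_assoc, div_self h, mul_one] at h2

@[fun_prop]
theorem continuous_sn (ρ : ℂ) : Continuous (fun t : ℝ => sn ρ t) :=
  continuous_iff_continuousAt.2 fun a => (hasDerivAt_sn ρ a).continuousAt

theorem integral_cos_eq_sn (ρ : ℂ) (a : ℝ) : ∫ τ in (0 : ℝ)..a, Complex.cos (ρ * τ) = sn ρ a := by
  rw [intervalIntegral.integral_eq_sub_of_hasDerivAt (fun t _ => hasDerivAt_sn ρ t)
    ((by fun_prop : Continuous fun τ : ℝ => Complex.cos (ρ * τ)).intervalIntegrable _ _)]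
  simp

theorem sn_sub (ρ : ℂ) (a b : ℝ) :
    sn ρ (a - b) = sn ρ a * Complex.cos (ρ * b) - Complex.cos (ρ * a) * sn ρ b := by
  by_cases h : ρ = 0
  · simp [sn, h]
  · simp only [sn, h, if_false]
    rw [Complex.ofReal_sub, mul_sub, Complex.sin_sub]
    ring

/-! ### The Paley–Wiener class in dual form. -/

/-- The Cauchy–Schwarz inequality on an interval. -/
theorem integral_norm_mul_norm_le {a b : ℝ} (hab : a ≤ b) {f g : ℝ → ℂ}
    (hf : MemLp f 2 (volume.restrict (Ioc a b))) (hg : MemLp g 2 (volume.restrict (Ioc a b))) :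
    ∫ t in a..b, ‖f t‖ * ‖g t‖ ≤ √(∫ t in a..b, ‖f t‖ ^ 2) * √(∫ t in a..b, ‖g t‖ ^ 2) := by
  have h := integral_mul_norm_le_Lp_mul_Lq (p := 2) (q := 2) (μ := volume.restrict (Ioc a b))
    (f := f) (g := g) Real.HolderConjugate.two_two (by simpa using hf) (by simpa using hg)
  simp only [intervalIntegral.integral_of_le hab, Real.sqrt_eq_rpow]
  simpa using h

theorem Continuous.memLp_two_Ioc {f : ℝ → ℂ} (hf : Continuous f) (a b : ℝ) :
    MemLp f 2 (volume.restrict (Ioc a b)) := by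
  obtain ⟨C, hC⟩ := (isCompact_Icc (a := a) (b := b)).exists_bound_of_continuousOn hf.continuousOn
  refine MemLp.of_bound hf.aestronglyMeasurable C ?_
  filter_upwards [ae_restrict_mem measurableSet_Ioc] with t ht
  exact hC t (Ioc_subset_Icc_self ht)

/-- An exponential polynomial. -/
noncomputable def expSum (s : Finset ℂ) (c : ℂ → ℂ) (t : ℝ) : ℂ :=
  ∑ ρ ∈ s, c ρ * Complex.exp (Complex.I * ρ * t)

@[fun_prop]
theorem continuous_expSum (s : Finset ℂ) (c : ℂ → ℂ) : Continuous (expSum s c) := by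
  unfold expSum; fun_prop

/-- The norm in `L₂(-x, x)`. -/
noncomputable def l2norm (x : ℝ) (g : ℝ → ℂ) : ℝ := √(∫ t in (-x)..x, ‖g t‖ ^ 2)

theorem l2norm_nonneg (x : ℝ) (g : ℝ → ℂ) : 0 ≤ l2norm x g := Real.sqrt_nonneg _

/-- Dual description of the Paley–Wiener class: `f` is the Fourier transform of a function in
`L₂(-x, x)` of norm at most `M`. -/
def PW (x M : ℝ) (f : ℂ → ℂ) : Prop :=
  ∀ (s : Finset ℂ) (c : ℂ → ℂ), ‖∑ ρ ∈ s, c ρ * f ρ‖ ≤ M * l2norm x (expSum s c)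

theorem PW.mono {x M M' : ℝ} {f : ℂ → ℂ} (h : PW x M f) (hM : M ≤ M') : PW x M' f :=
  fun s c => (h s c).trans (mul_le_mul_of_nonneg_right hM (l2norm_nonneg _ _))

theorem PW.add {x M M' : ℝ} {f g : ℂ → ℂ} (hf : PW x M f) (hg : PW x M' g) :
    PW x (M + M') (fun ρ => f ρ + g ρ) := fun s c => by
  simp only [mul_add, Finset.sum_add_distrib, add_mul]
  exact (norm_add_le _ _).trans (add_le_add (hf s c) (hg s c))

theorem PW.const_mul {x M : ℝ} {f : ℂ → ℂ} (a : ℂ) (hf : PW x M f) :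
    PW x (‖a‖ * M) (fun ρ => a * f ρ) := fun s c => by
  have : ∑ ρ ∈ s, c ρ * (a * f ρ) = a * ∑ ρ ∈ s, c ρ * f ρ := by
    rw [Finset.mul_sum]; exact Finset.sum_congr rfl fun _ _ => by ring
  rw [this, norm_mul, mul_assoc]
  exact mul_le_mul_of_nonneg_left (hf s c) (norm_nonneg _)

theorem PW.zero (x : ℝ) : PW x 0 (fun _ => 0) := fun s c => by simp

theorem PW.congr {x M : ℝ} {f g : ℂ → ℂ} (hf : PW x M f) (h : ∀ ρ, g ρ = f ρ) : PW x M g := by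
  rwa [funext h]

/-- Only finitely many values of `f` enter each inequality, so pointwise convergence with a common
bound is enough; nothing has to be known about convergence of the densities. -/
theorem PW.of_tendsto {x M : ℝ} {u : ℕ → ℂ → ℂ} {f : ℂ → ℂ} (hu : ∀ n, PW x M (u n))
    (h : ∀ ρ, Tendsto (fun n => u n ρ) atTop (𝓝 (f ρ))) : PW x M f := fun s c =>
  le_of_tendsto (tendsto_finsetSum s fun ρ _ => (h ρ).const_mul (c ρ)).norm
    (Eventually.of_forall fun n => hu n s c)

/-- Minkowski's inequality in dual form: the finite sum moves under the integral. Integrability in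
`s` is needed for each `ρ` separately, never jointly. -/
theorem PW.integral {x a b : ℝ} (hab : a ≤ b) {M : ℝ → ℝ} {F : ℂ → ℝ → ℂ}
    (hM : IntervalIntegrable M volume a b) (hF : ∀ ρ, IntervalIntegrable (F ρ) volume a b)
    (h : ∀ᵐ s ∂(volume.restrict (Ioc a b)), PW x (M s) (fun ρ => F ρ s)) :
    PW x (∫ s in a..b, M s) (fun ρ => ∫ s in a..b, F ρ s) := fun S c => by
  have h1 : ∑ ρ ∈ S, c ρ * ∫ s in a..b, F ρ s = ∫ s in a..b, ∑ ρ ∈ S, c ρ * F ρ s := by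
    rw [intervalIntegral.integral_finsetSum fun ρ _ => (hF ρ).const_mul _]
    simp only [intervalIntegral.integral_const_mul]
  rw [h1, ← intervalIntegral.integral_mul_const]
  refine intervalIntegral.norm_integral_le_of_norm_le hab ?_ (hM.mul_const _)
  filter_upwards [(ae_restrict_iff' measurableSet_Ioc).1 h] with s hs hs'
  exact hs hs' S c

theorem intervalIntegrable_norm_sq_expSum (s : Finset ℂ) (c : ℂ → ℂ) (a b : ℝ) :
    IntervalIntegrable (fun t => ‖expSum s c t‖ ^ 2) volume a b :=
  (by fun_prop : Continuous fun t => ‖expSum s c t‖ ^ 2).intervalIntegrable _ _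

/-- The exponential factor translates the density by `a`. Dually, absorbing it into the coefficients
replaces t by t + a in the test sum, and the shifted interval still lies in (-x, x). -/
theorem PW.exp_mul {x y M : ℝ} {f : ℂ → ℂ} (hM : 0 ≤ M) (hf : PW y M f) (hy : 0 ≤ y) {a : ℝ}
    (ha : |a| + y ≤ x) : PW x M (fun ρ => Complex.exp (Complex.I * ρ * a) * f ρ) := fun s c => by
  have h := hf s (fun ρ => c ρ * Complex.exp (Complex.I * ρ * a))
  have h1 : ∀ t, expSum s (fun ρ => c ρ * Complex.exp (Complex.I * ρ * a)) t
      = expSum s c (t + a) := fun t => by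
    refine Finset.sum_congr rfl fun ρ _ => ?_
    rw [mul_assoc, ← Complex.exp_add]
    congr 2
    push_cast; ring
  simp only [mul_assoc] at h ⊢
  refine h.trans (mul_le_mul_of_nonneg_left (Real.sqrt_le_sqrt ?_) hM)
  simp only [mul_assoc] at h1
  simp only [h1]
  rw [intervalIntegral.integral_comp_add_right (fun t => ‖expSum s c t‖ ^ 2)]
  have := neg_abs_le a
  have := le_abs_self a
  exact intervalIntegral.integral_mono_interval (by linarith) (by linarith) (by linarith)
    (Eventually.of_forall fun t => by positivity) (intervalIntegrable_norm_sq_expSum s c _ _)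

theorem cos_eq_exp (ρ : ℂ) (a : ℝ) : Complex.cos (ρ * a) = 1 / 2 *
    Complex.exp (Complex.I * ρ * a) + 1 / 2 * Complex.exp (Complex.I * ρ * (-a : ℝ)) := by
  rw [Complex.cos, show ρ * a * Complex.I = Complex.I * ρ * a by ring,
    show -(ρ * a) * Complex.I = Complex.I * ρ * (-a : ℝ) by push_cast; ring]
  ring

theorem sin_eq_exp (ρ : ℂ) (a : ℝ) : Complex.sin (ρ * a) = (-Complex.I / 2) *
    Complex.exp (Complex.I * ρ * a) + Complex.I / 2 * Complex.exp (Complex.I * ρ * (-a : ℝ)) := by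
  rw [Complex.sin, show ρ * a * Complex.I = Complex.I * ρ * a by ring,
    show -(ρ * a) * Complex.I = Complex.I * ρ * (-a : ℝ) by push_cast; ring]
  ring

theorem PW.cos_mul {x y M : ℝ} {f : ℂ → ℂ} (hM : 0 ≤ M) (hf : PW y M f) (hy : 0 ≤ y) {a : ℝ}
    (ha : |a| + y ≤ x) : PW x M (fun ρ => Complex.cos (ρ * a) * f ρ) := by
  refine ((((hf.exp_mul hM hy ha).const_mul (1 / 2)).add
    ((hf.exp_mul (a := -a) hM hy (by rwa [abs_neg])).const_mul (1 / 2))).congr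
      fun ρ => ?_).mono ?_
  · rw [cos_eq_exp]; ring
  · norm_num; linarith

theorem PW.sin_mul {x y M : ℝ} {f : ℂ → ℂ} (hM : 0 ≤ M) (hf : PW y M f) (hy : 0 ≤ y) {a : ℝ}
    (ha : |a| + y ≤ x) : PW x M (fun ρ => Complex.sin (ρ * a) * f ρ) := by
  refine ((((hf.exp_mul hM hy ha).const_mul (-Complex.I / 2)).add
    ((hf.exp_mul (a := -a) hM hy (by rwa [abs_neg])).const_mul (Complex.I / 2))).congr
      fun ρ => ?_).mono ?_
  · rw [sin_eq_exp]; ring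
  · norm_num; linarith

/-- sin(ρa)/ρ is the integral of cos ρτ over (0, a), and each cosine factor costs nothing in norm.
-/
theorem PW.sn_mul {x y M : ℝ} {f : ℂ → ℂ} (hM : 0 ≤ M) (hf : PW y M f) (hy : 0 ≤ y) {a : ℝ}
    (ha0 : 0 ≤ a) (ha : a + y ≤ x) : PW x (a * M) (fun ρ => sn ρ a * f ρ) := by
  have h := PW.integral (x := x) (M := fun _ => M) (F := fun ρ τ => Complex.cos (ρ * τ) * f ρ) ha0
    (by simp) (fun ρ => (by fun_prop : Continuous fun τ : ℝ => Complex.cos (ρ * τ) * f ρ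
      ).intervalIntegrable _ _) ?_
  · refine (h.congr fun ρ => ?_).mono (by simp)
    rw [intervalIntegral.integral_mul_const, integral_cos_eq_sn]
  · filter_upwards [ae_restrict_mem measurableSet_Ioc] with τ hτ
    exact hf.cos_mul hM hy (by rw [abs_of_pos hτ.1]; linarith [hτ.2])

/-- As s runs over (0, x), x - 2s runs over (-x, x), so `w` is in essence the density itself. The
substitution yields a factor 1/2, which is given away. -/
theorem PW.integral_exp {x : ℝ} (hx : 0 ≤ x) {w : ℝ → ℂ}
    (hw : MemLp w 2 (volume.restrict (Ioc 0 x))) :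
    PW x (√(∫ s in (0 : ℝ)..x, ‖w s‖ ^ 2))
      (fun ρ => ∫ s in (0 : ℝ)..x, w s * Complex.exp (Complex.I * ρ * (x - 2 * s : ℝ))) :=
    fun S c => by
  have hwi : IntervalIntegrable w volume 0 x :=
    (intervalIntegrable_iff_integrableOn_Ioc_of_le hx).2 (hw.integrable (by norm_num))
  have h1 : ∑ ρ ∈ S, c ρ * ∫ s in (0 : ℝ)..x, w s * Complex.exp (Complex.I * ρ * (x - 2 * s : ℝ))
      = ∫ s in (0 : ℝ)..x, w s * expSum S c (x - 2 * s) := by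
    simp only [expSum, Finset.mul_sum]
    rw [intervalIntegral.integral_finsetSum]
    · refine Finset.sum_congr rfl fun ρ _ => ?_
      rw [← intervalIntegral.integral_const_mul]
      refine intervalIntegral.integral_congr fun s _ => ?_
      ring
    · intro ρ _
      exact hwi.mul_continuousOn (Continuous.continuousOn (by fun_prop))
  rw [h1]
  refine (intervalIntegral.norm_integral_le_integral_norm hx).trans ?_
  simp only [norm_mul]
  refine (integral_norm_mul_norm_le hx hw (Continuous.memLp_two_Ioc
    (by fun_prop : Continuous fun s : ℝ => expSum S c (x - 2 * s)) _ _)).trans ?_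
  refine mul_le_mul_of_nonneg_left (Real.sqrt_le_sqrt ?_) (Real.sqrt_nonneg _)
  rw [intervalIntegral.integral_comp_sub_mul (fun t => ‖expSum S c t‖ ^ 2) two_ne_zero]
  have : x - 2 * x = -x := by ring
  simp only [this, mul_zero, sub_zero, smul_eq_mul]
  have h0 : 0 ≤ ∫ t in (-x)..x, ‖expSum S c t‖ ^ 2 :=
    intervalIntegral.integral_nonneg (by linarith) fun t _ => by positivity
  linarith

theorem PW.integral_exp_neg {x : ℝ} (hx : 0 ≤ x) {w : ℝ → ℂ}
    (hw : MemLp w 2 (volume.restrict (Ioc 0 x))) :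
    PW x (√(∫ s in (0 : ℝ)..x, ‖w s‖ ^ 2))
      (fun ρ => ∫ s in (0 : ℝ)..x, w s * Complex.exp (Complex.I * ρ * (-(x - 2 * s) : ℝ))) :=
    fun S c => by
  have hwi : IntervalIntegrable w volume 0 x :=
    (intervalIntegrable_iff_integrableOn_Ioc_of_le hx).2 (hw.integrable (by norm_num))
  have h1 : ∑ ρ ∈ S, c ρ * ∫ s in (0 : ℝ)..x,
        w s * Complex.exp (Complex.I * ρ * (-(x - 2 * s) : ℝ))
      = ∫ s in (0 : ℝ)..x, w s * expSum S c (2 * s - x) := by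
    simp only [expSum, Finset.mul_sum]
    rw [intervalIntegral.integral_finsetSum]
    · refine Finset.sum_congr rfl fun ρ _ => ?_
      rw [← intervalIntegral.integral_const_mul]
      refine intervalIntegral.integral_congr fun s _ => ?_
      simp only [neg_sub]
      ring
    · intro ρ _
      exact hwi.mul_continuousOn (Continuous.continuousOn (by fun_prop))
  rw [h1]
  refine (intervalIntegral.norm_integral_le_integral_norm hx).trans ?_
  simp only [norm_mul]
  refine (integral_norm_mul_norm_le hx hw (Continuous.memLp_two_Ioc
    (by fun_prop : Continuous fun s : ℝ => expSum S c (2 * s - x)) _ _)).trans ?_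
  refine mul_le_mul_of_nonneg_left (Real.sqrt_le_sqrt ?_) (Real.sqrt_nonneg _)
  rw [intervalIntegral.integral_comp_mul_sub (fun t => ‖expSum S c t‖ ^ 2) two_ne_zero]
  have : 2 * x - x = x := by ring
  simp only [this, mul_zero, zero_sub, smul_eq_mul]
  have h0 : 0 ≤ ∫ t in (-x)..x, ‖expSum S c t‖ ^ 2 :=
    intervalIntegral.integral_nonneg (by linarith) fun t _ => by positivity
  linarith

theorem sn_eq_integral_exp (ρ : ℂ) (a : ℝ) :
    sn ρ a = 1 / 2 * ∫ t in (-a)..a, Complex.exp (Complex.I * ρ * t) := by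
  have hc : Continuous fun t : ℝ => Complex.exp (Complex.I * ρ * t) := by fun_prop
  have hc' : Continuous fun t : ℝ => Complex.exp (Complex.I * ρ * (-t : ℝ)) := by fun_prop
  rw [← intervalIntegral.integral_add_adjacent_intervals (b := 0)
    (hc.intervalIntegrable _ _) (hc.intervalIntegrable _ _), ← integral_cos_eq_sn]
  have h2 := intervalIntegral.integral_comp_neg (a := 0) (b := a)
    (fun t : ℝ => Complex.exp (Complex.I * ρ * t))
  rw [neg_zero] at h2
  rw [← h2, ← intervalIntegral.integral_add (hc'.intervalIntegrable _ _)
    (hc.intervalIntegrable _ _), ← intervalIntegral.integral_const_mul]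
  refine intervalIntegral.integral_congr fun t _ => ?_
  simp only [cos_eq_exp]
  ring

/-- The product is the transform of half the indicator of (b - a, b + a), a subinterval of (-x, x).
The factor √(2x) is Cauchy–Schwarz against the constant 1. -/
theorem PW.sn_mul_exp {x a b : ℝ} (hx : 0 ≤ x) (ha : 0 ≤ a) (hab : a + |b| ≤ x) :
    PW x √(2 * x) (fun ρ => sn ρ a * Complex.exp (Complex.I * ρ * b)) := fun S c => by
  have h1 : ∑ ρ ∈ S, c ρ * (sn ρ a * Complex.exp (Complex.I * ρ * b))
      = 1 / 2 * ∫ t in (-a)..a, expSum S c (t + b) := by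
    simp only [expSum]
    rw [intervalIntegral.integral_finsetSum, Finset.mul_sum]
    · refine Finset.sum_congr rfl fun ρ _ => ?_
      rw [sn_eq_integral_exp, intervalIntegral.integral_const_mul]
      have : ∀ t : ℝ, Complex.exp (Complex.I * ρ * (t + b : ℝ)) =
          Complex.exp (Complex.I * ρ * t) * Complex.exp (Complex.I * ρ * b) := fun t => by
        rw [← Complex.exp_add]; congr 1; push_cast; ring
      simp only [this]
      rw [intervalIntegral.integral_mul_const]
      ring
    · intro ρ _
      exact Continuous.intervalIntegrable (by fun_prop) _ _
  rw [h1, intervalIntegral.integral_comp_add_right (expSum S c)]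
  have := neg_abs_le b
  have := le_abs_self b
  have hP : Continuous fun t => ‖expSum S c t‖ := by fun_prop
  have h2 : ‖∫ t in (-a + b)..(a + b), expSum S c t‖ ≤ ∫ t in (-x)..x, ‖expSum S c t‖ :=
    (intervalIntegral.norm_integral_le_integral_norm (by linarith)).trans
      (intervalIntegral.integral_mono_interval (by linarith) (by linarith) (by linarith)
        (Eventually.of_forall fun t => norm_nonneg _) (hP.intervalIntegrable _ _))
  have h3 : ∫ t in (-x)..x, ‖expSum S c t‖ ≤ √(2 * x) * l2norm x (expSum S c) := by
    have := integral_norm_mul_norm_le (a := -x) (b := x) (by linarith) (f := fun _ => 1)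
      (g := expSum S c) (Continuous.memLp_two_Ioc continuous_const _ _)
      (Continuous.memLp_two_Ioc (by fun_prop) _ _)
    simp only [norm_one, one_mul, one_pow, intervalIntegral.integral_const, smul_eq_mul,
      mul_one] at this
    rwa [show x - -x = 2 * x by ring] at this
  rw [norm_mul]
  have h4 : (0 : ℝ) ≤ ‖∫ t in (-a + b)..(a + b), expSum S c t‖ := norm_nonneg _
  have h5 : ‖(1 / 2 : ℂ)‖ = 1 / 2 := by norm_num
  rw [h5]
  linarith

/-! ### Families that are Paley–Wiener uniformly on [0, L]. -/

/-- The family `f ρ x` is, for `x ∈ [0, L]`, uniformly in the Paley–Wiener class of `(-x, x)`. -/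
def PWF (L : ℝ) (f : ℂ → ℝ → ℂ) : Prop :=
  ∃ M, 0 ≤ M ∧ ∀ x ∈ Icc 0 L, PW x M (fun ρ => f ρ x)

theorem PWF.add {L : ℝ} {f g : ℂ → ℝ → ℂ} (hf : PWF L f) (hg : PWF L g) :
    PWF L (fun ρ x => f ρ x + g ρ x) := by
  obtain ⟨M, hM, h⟩ := hf
  obtain ⟨M', hM', h'⟩ := hg
  exact ⟨M + M', add_nonneg hM hM', fun x hx => (h x hx).add (h' x hx)⟩

theorem PWF.mul_bounded {L : ℝ} {f : ℂ → ℝ → ℂ} (hf : PWF L f) {w : ℝ → ℂ}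
    (hw : ContinuousOn w (Icc 0 L)) : PWF L (fun ρ x => w x * f ρ x) := by
  obtain ⟨M, hM, h⟩ := hf
  obtain ⟨C, hC⟩ := isCompact_Icc.exists_bound_of_continuousOn hw
  refine ⟨|C| * M, by positivity, fun x hx => ((h x hx).const_mul (w x)).mono ?_⟩
  exact mul_le_mul_of_nonneg_right ((hC x hx).trans (le_abs_self C)) hM

theorem PWF.const_mul {L : ℝ} {f : ℂ → ℝ → ℂ} (hf : PWF L f) (a : ℂ) :
    PWF L (fun ρ x => a * f ρ x) := hf.mul_bounded (w := fun _ => a) continuousOn_const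

theorem PWF.congr {L : ℝ} {f g : ℂ → ℝ → ℂ} (hf : PWF L f)
    (h : ∀ ρ, ∀ x ∈ Icc 0 L, g ρ x = f ρ x) : PWF L g := by
  obtain ⟨M, hM, h'⟩ := hf
  exact ⟨M, hM, fun x hx => (h' x hx).congr fun ρ => h ρ x hx⟩

theorem PWF.sub {L : ℝ} {f g : ℂ → ℝ → ℂ} (hf : PWF L f) (hg : PWF L g) :
    PWF L (fun ρ x => f ρ x - g ρ x) :=
  (hf.add (hg.const_mul (-1))).congr fun ρ x _ => by ring

theorem PWF.sn (L : ℝ) : PWF L sn := by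
  refine ⟨√(2 * L), by positivity, fun x hx => ((PW.sn_mul_exp (b := 0) hx.1 hx.1 ?_).congr
    fun ρ => ?_).mono (Real.sqrt_le_sqrt (by linarith [hx.2]))⟩
  · simp
  · simp

theorem IntervalIntegrable.mono_Icc {L x : ℝ} {w : ℝ → ℂ} (hw : IntervalIntegrable w volume 0 L)
    (hx : x ∈ Icc 0 L) : IntervalIntegrable w volume 0 x := by
  refine hw.mono_set ?_
  rw [uIcc_of_le hx.1, uIcc_of_le (hx.1.trans hx.2)]
  exact Icc_subset_Icc_right hx.2

theorem IntervalIntegrable.mul_continuousOn_Icc {x : ℝ} {w v : ℝ → ℂ} (hx : 0 ≤ x)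
    (hw : IntervalIntegrable w volume 0 x) (hv : ContinuousOn v (Icc 0 x)) :
    IntervalIntegrable (fun s => w s * v s) volume 0 x :=
  hw.mul_continuousOn (by rwa [uIcc_of_le hx])

theorem PWF.integral {L K : ℝ} (hK : 0 ≤ K) {w : ℝ → ℂ} (hw : IntervalIntegrable w volume 0 L)
    {G : ℂ → ℝ → ℝ → ℂ} (hG : ∀ ρ, ∀ x ∈ Icc 0 L, ContinuousOn (G ρ x) (Icc 0 x))
    (h : ∀ x ∈ Icc 0 L, ∀ s ∈ Icc 0 x, PW x K (fun ρ => G ρ x s)) :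
    PWF L (fun ρ x => ∫ s in (0 : ℝ)..x, w s * G ρ x s) := by
  by_cases hL : 0 ≤ L
  swap
  · exact ⟨0, le_rfl, fun x hx => absurd (hx.1.trans hx.2) hL⟩
  have h0 : 0 ≤ ∫ s in (0 : ℝ)..L, ‖w s‖ :=
    intervalIntegral.integral_nonneg hL fun s _ => norm_nonneg _
  refine ⟨(∫ s in (0 : ℝ)..L, ‖w s‖) * K, by positivity, fun x hx => ?_⟩
  have hwx := IntervalIntegrable.mono_Icc hw hx
  refine (PW.integral (M := fun s => ‖w s‖ * K) hx.1 (hwx.norm.mul_const _)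
    (fun ρ => IntervalIntegrable.mul_continuousOn_Icc hx.1 hwx (hG ρ x hx)) ?_).mono ?_
  · filter_upwards [ae_restrict_mem measurableSet_Ioc] with s hs
    exact (h x hx s (Ioc_subset_Icc_self hs)).const_mul (w s)
  · rw [intervalIntegral.integral_mul_const]
    refine mul_le_mul_of_nonneg_right ?_ hK
    exact intervalIntegral.integral_mono_interval le_rfl hx.1 hx.2
      (Eventually.of_forall fun t => norm_nonneg _) hw.norm

/-- The exponential alone corresponds to a point mass at ±s; the factor sin(ρ(x-s))/ρ smears it to a
multiple of an indicator of half-length x - s, which stays inside (-x, x). An integrable weight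
suffices. -/
theorem PWF.integral_sn_mul_exp {L : ℝ} {w : ℝ → ℂ} (hw : IntervalIntegrable w volume 0 L)
    {σ : ℝ} (hσ : |σ| = 1) : PWF L (fun ρ x => ∫ s in (0 : ℝ)..x,
      w s * (SincSL.sn ρ (x - s) * Complex.exp (Complex.I * ρ * (σ * s : ℝ)))) := by
  refine PWF.integral (K := √(2 * L)) (by positivity) hw (fun ρ x _ =>
    Continuous.continuousOn ((continuous_sn ρ).comp (by fun_prop : Continuous fun s => x - s)
      |>.mul (by fun_prop))) fun x hx s hs => ?_
  refine (PW.sn_mul_exp hx.1 (by linarith [hs.2]) ?_).mono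
    (Real.sqrt_le_sqrt (by linarith [hx.2]))
  rw [abs_mul, hσ, abs_of_nonneg hs.1]
  linarith

theorem continuous_sn_sub (ρ : ℂ) (x : ℝ) : Continuous fun s => SincSL.sn ρ (x - s) :=
  (continuous_sn ρ).comp (by fun_prop)

theorem PWF.integral_sn_mul_cos {L : ℝ} {w : ℝ → ℂ} (hw : IntervalIntegrable w volume 0 L) :
    PWF L (fun ρ x => ∫ s in (0 : ℝ)..x,
      w s * (SincSL.sn ρ (x - s) * Complex.cos (ρ * s))) := by
  refine (((PWF.integral_sn_mul_exp hw (σ := 1) (by simp)).const_mul (1 / 2)).add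
    ((PWF.integral_sn_mul_exp hw (σ := -1) (by simp)).const_mul (1 / 2))).congr fun ρ x hx => ?_
  have hwx := IntervalIntegrable.mono_Icc hw hx
  have hc := continuous_sn_sub ρ x
  rw [← intervalIntegral.integral_const_mul, ← intervalIntegral.integral_const_mul,
    ← intervalIntegral.integral_add]
  · refine intervalIntegral.integral_congr fun s _ => ?_
    simp only [cos_eq_exp, one_mul, neg_one_mul]
    ring
  all_goals exact (IntervalIntegrable.mul_continuousOn_Icc hx.1 hwx
    (hc.mul (by fun_prop)).continuousOn).const_mul _

theorem PWF.integral_sn_mul_sin {L : ℝ} {w : ℝ → ℂ} (hw : IntervalIntegrable w volume 0 L) :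
    PWF L (fun ρ x => ∫ s in (0 : ℝ)..x,
      w s * (SincSL.sn ρ (x - s) * Complex.sin (ρ * s))) := by
  refine (((PWF.integral_sn_mul_exp hw (σ := 1) (by simp)).const_mul (-Complex.I / 2)).add
    ((PWF.integral_sn_mul_exp hw (σ := -1) (by simp)).const_mul (Complex.I / 2))).congr
      fun ρ x hx => ?_
  have hwx := IntervalIntegrable.mono_Icc hw hx
  have hc := continuous_sn_sub ρ x
  rw [← intervalIntegral.integral_const_mul, ← intervalIntegral.integral_const_mul,
    ← intervalIntegral.integral_add]
  · refine intervalIntegral.integral_congr fun s _ => ?_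
    simp only [sin_eq_exp, one_mul, neg_one_mul]
    ring
  all_goals exact (IntervalIntegrable.mul_continuousOn_Icc hx.1 hwx
    (hc.mul (by fun_prop)).continuousOn).const_mul _

/-- Types add up: x - s from the cosine and s from `v ρ s` give x. -/
theorem PWF.integral_cos_mul {L : ℝ} {w : ℝ → ℂ} (hw : IntervalIntegrable w volume 0 L)
    {v : ℂ → ℝ → ℂ} (hv : PWF L v) (hc : ∀ ρ, ContinuousOn (v ρ) (Icc 0 L)) :
    PWF L (fun ρ x => ∫ s in (0 : ℝ)..x, w s * (Complex.cos (ρ * (x - s : ℝ)) * v ρ s)) := by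
  obtain ⟨M, hM, h⟩ := hv
  refine PWF.integral hM hw (fun ρ x hx => ContinuousOn.mul (by fun_prop)
    ((hc ρ).mono (Icc_subset_Icc_right hx.2))) fun x hx s hs => ?_
  refine (h s ⟨hs.1, hs.2.trans hx.2⟩).cos_mul hM hs.1 ?_
  rw [abs_of_nonneg (by linarith [hs.2])]
  linarith

theorem PWF.integral_sin_mul {L : ℝ} {w : ℝ → ℂ} (hw : IntervalIntegrable w volume 0 L)
    {v : ℂ → ℝ → ℂ} (hv : PWF L v) (hc : ∀ ρ, ContinuousOn (v ρ) (Icc 0 L)) :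
    PWF L (fun ρ x => ∫ s in (0 : ℝ)..x, w s * (Complex.sin (ρ * (x - s : ℝ)) * v ρ s)) := by
  obtain ⟨M, hM, h⟩ := hv
  refine PWF.integral hM hw (fun ρ x hx => ContinuousOn.mul (by fun_prop)
    ((hc ρ).mono (Icc_subset_Icc_right hx.2))) fun x hx s hs => ?_
  refine (h s ⟨hs.1, hs.2.trans hx.2⟩).sin_mul hM hs.1 ?_
  rw [abs_of_nonneg (by linarith [hs.2])]
  linarith

theorem intervalIntegrable_of_memLp {L : ℝ} (hL : 0 ≤ L) {w : ℝ → ℂ}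
    (hw : MemLp w 2 (volume.restrict (Ioc 0 L))) : IntervalIntegrable w volume 0 L :=
  (intervalIntegrable_iff_integrableOn_Ioc_of_le hL).2 (hw.integrable (by norm_num))

theorem memLp_Ioc_mono {L x : ℝ} {w : ℝ → ℂ}
    (hw : MemLp w 2 (volume.restrict (Ioc 0 L))) (hx : x ≤ L) :
    MemLp w 2 (volume.restrict (Ioc 0 x)) :=
  hw.mono_measure (Measure.restrict_mono (Ioc_subset_Ioc_right hx) le_rfl)

theorem intervalIntegrable_norm_sq {L : ℝ} (hL : 0 ≤ L) {w : ℝ → ℂ}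
    (hw : MemLp w 2 (volume.restrict (Ioc 0 L))) :
    IntervalIntegrable (fun s => ‖w s‖ ^ 2) volume 0 L :=
  (intervalIntegrable_iff_integrableOn_Ioc_of_le hL).2
    (by simpa [IntegrableOn] using hw.integrable_norm_pow two_ne_zero)

theorem sqrt_integral_mono {L x : ℝ} {w : ℝ → ℂ}
    (hw : MemLp w 2 (volume.restrict (Ioc 0 L))) (hx : x ∈ Icc 0 L) :
    √(∫ s in (0 : ℝ)..x, ‖w s‖ ^ 2) ≤ √(∫ s in (0 : ℝ)..L, ‖w s‖ ^ 2) :=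
  Real.sqrt_le_sqrt (intervalIntegral.integral_mono_interval le_rfl hx.1 hx.2
    (Eventually.of_forall fun t => by positivity)
    (intervalIntegrable_norm_sq (hx.1.trans hx.2) hw))

theorem PWF.integral_exp {L : ℝ} {w : ℝ → ℂ} (hw : MemLp w 2 (volume.restrict (Ioc 0 L))) :
    PWF L (fun ρ x => ∫ s in (0 : ℝ)..x, w s * Complex.exp (Complex.I * ρ * (x - 2 * s : ℝ))) :=
  ⟨√(∫ s in (0 : ℝ)..L, ‖w s‖ ^ 2), by positivity, fun _ hx =>
    (PW.integral_exp hx.1 (memLp_Ioc_mono hw hx.2)).mono (sqrt_integral_mono hw hx)⟩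

theorem PWF.integral_exp_neg {L : ℝ} {w : ℝ → ℂ} (hw : MemLp w 2 (volume.restrict (Ioc 0 L))) :
    PWF L (fun ρ x => ∫ s in (0 : ℝ)..x,
      w s * Complex.exp (Complex.I * ρ * (-(x - 2 * s) : ℝ))) :=
  ⟨√(∫ s in (0 : ℝ)..L, ‖w s‖ ^ 2), by positivity, fun _ hx =>
    (PW.integral_exp_neg hx.1 (memLp_Ioc_mono hw hx.2)).mono (sqrt_integral_mono hw hx)⟩

theorem PWF.integral_cos {L : ℝ} {w : ℝ → ℂ} (hw : MemLp w 2 (volume.restrict (Ioc 0 L))) :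
    PWF L (fun ρ x => ∫ s in (0 : ℝ)..x, w s * Complex.cos (ρ * (x - 2 * s : ℝ))) := by
  refine (((PWF.integral_exp hw).const_mul (1 / 2)).add
    ((PWF.integral_exp_neg hw).const_mul (1 / 2))).congr fun ρ x hx => ?_
  have hwx := intervalIntegrable_of_memLp hx.1 (memLp_Ioc_mono hw hx.2)
  rw [← intervalIntegral.integral_const_mul, ← intervalIntegral.integral_const_mul,
    ← intervalIntegral.integral_add]
  · refine intervalIntegral.integral_congr fun s _ => ?_
    simp only [cos_eq_exp]
    ring
  all_goals exact (IntervalIntegrable.mul_continuousOn_Icc hx.1 hwx (by fun_prop)).const_mul _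

theorem PWF.integral_sin {L : ℝ} {w : ℝ → ℂ} (hw : MemLp w 2 (volume.restrict (Ioc 0 L))) :
    PWF L (fun ρ x => ∫ s in (0 : ℝ)..x, w s * Complex.sin (ρ * (x - 2 * s : ℝ))) := by
  refine (((PWF.integral_exp hw).const_mul (-Complex.I / 2)).add
    ((PWF.integral_exp_neg hw).const_mul (Complex.I / 2))).congr fun ρ x hx => ?_
  have hwx := intervalIntegrable_of_memLp hx.1 (memLp_Ioc_mono hw hx.2)
  rw [← intervalIntegral.integral_const_mul, ← intervalIntegral.integral_const_mul,
    ← intervalIntegral.integral_add]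
  · refine intervalIntegral.integral_congr fun s _ => ?_
    simp only [sin_eq_exp]
    ring
  all_goals exact (IntervalIntegrable.mul_continuousOn_Icc hx.1 hwx (by fun_prop)).const_mul _

/-! ### The Volterra operator and its Neumann series. -/

/-- In the norm with weight `exp (-κ s)` the Volterra operator is a contraction for large `κ`. -/
theorem exists_weight {L : ℝ} {q : ℝ → ℂ} (hq : MemLp q 2 (volume.restrict (Ioc 0 L))) {K : ℝ}
    (hK : 0 ≤ K) : ∃ κ : ℝ, 0 ≤ κ ∧ ∀ x ∈ Icc 0 L,
      ∫ s in (0 : ℝ)..x, ‖q s‖ * (K * Real.exp (κ * s)) ≤ 1 / 2 * Real.exp (κ * x) := by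
  set A := √(∫ s in (0 : ℝ)..L, ‖q s‖ ^ 2) with hA
  have hA0 : 0 ≤ A := Real.sqrt_nonneg _
  -- The L₂(0, x) norm of exp(κs) is at most exp(κx)/√(2κ). The choice of κ makes √(2κ) ≥ 2KA, which
  -- produces the factor 1/2; the summand 1 keeps κ positive.
  have hκ : 0 < 2 * (K * A) ^ 2 + 1 := by positivity
  refine ⟨2 * (K * A) ^ 2 + 1, hκ.le, fun x hx => ?_⟩
  set κ := 2 * (K * A) ^ 2 + 1 with hκdef
  have h1 := integral_norm_mul_norm_le hx.1 (memLp_Ioc_mono hq hx.2)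
    (Continuous.memLp_two_Ioc (by fun_prop : Continuous fun s : ℝ => (Real.exp (κ * s) : ℂ)) 0 x)
  simp only [Complex.norm_real, Real.norm_eq_abs, Real.abs_exp] at h1
  have h2 : ∫ s in (0 : ℝ)..x, Real.exp (κ * s) ^ 2 ≤ (Real.exp (κ * x)) ^ 2 / (2 * κ) := by
    have h3 : ∀ s ∈ uIcc 0 x, HasDerivAt (fun s => Real.exp (κ * s) ^ 2 / (2 * κ))
        (Real.exp (κ * s) ^ 2) s := fun s _ => by
      have h4 : HasDerivAt (fun s => κ * s) κ s := by simpa using (hasDerivAt_id s).const_mul κ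
      convert! (h4.exp.pow 2).div_const (2 * κ) using 1
      field_simp
      simp [mul_comm]
    rw [intervalIntegral.integral_eq_sub_of_hasDerivAt h3
      ((by fun_prop : Continuous fun s => Real.exp (κ * s) ^ 2).intervalIntegrable _ _)]
    have : (0 : ℝ) ≤ Real.exp (κ * 0) ^ 2 / (2 * κ) := by positivity
    linarith
  have h5 : √(∫ s in (0 : ℝ)..x, Real.exp (κ * s) ^ 2) ≤ Real.exp (κ * x) / √(2 * κ) := by
    refine (Real.sqrt_le_sqrt h2).trans_eq ?_
    rw [Real.sqrt_div (by positivity), Real.sqrt_sq (Real.exp_pos _).le]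
  have h6 : 2 * (K * A) ≤ √(2 * κ) := Real.le_sqrt_of_sq_le (by rw [hκdef]; nlinarith)
  have h7 : 0 < √(2 * κ) := by positivity
  calc ∫ s in (0 : ℝ)..x, ‖q s‖ * (K * Real.exp (κ * s))
      = K * ∫ s in (0 : ℝ)..x, ‖q s‖ * Real.exp (κ * s) := by
        rw [← intervalIntegral.integral_const_mul]
        exact intervalIntegral.integral_congr fun s _ => by ring
    _ ≤ K * (A * (Real.exp (κ * x) / √(2 * κ))) := by
        refine mul_le_mul_of_nonneg_left (h1.trans ?_) hK
        exact mul_le_mul (sqrt_integral_mono hq hx) h5 (Real.sqrt_nonneg _) hA0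
    _ = K * A / √(2 * κ) * Real.exp (κ * x) := by ring
    _ ≤ 1 / 2 * Real.exp (κ * x) := by
        refine mul_le_mul_of_nonneg_right ?_ (Real.exp_pos _).le
        rw [div_le_iff₀ h7]
        linarith

/-- The Volterra operator of the equation `-y'' + q y = ρ² y`. -/
noncomputable def volterra (q : ℝ → ℂ) (ρ : ℂ) (v : ℝ → ℂ) (x : ℝ) : ℂ :=
  ∫ s in (0 : ℝ)..x, q s * (sn ρ (x - s) * v s)

/-- The addition formula separates `x` from `s` in the kernel, so the integral is a combination of
two primitives with continuous coefficients. -/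
theorem continuousOn_volterra {L : ℝ} (hL : 0 ≤ L) {q : ℝ → ℂ}
    (hq : IntervalIntegrable q volume 0 L) (ρ : ℂ) {v : ℝ → ℂ} (hv : ContinuousOn v (Icc 0 L)) :
    ContinuousOn (volterra q ρ v) (Icc 0 L) := by
  have h1 : IntervalIntegrable (fun s => q s * (Complex.cos (ρ * s) * v s)) volume 0 L :=
    IntervalIntegrable.mul_continuousOn_Icc hL hq (ContinuousOn.mul (by fun_prop) hv)
  have h2 : IntervalIntegrable (fun s => q s * (sn ρ s * v s)) volume 0 L :=
    IntervalIntegrable.mul_continuousOn_Icc hL hq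
      (ContinuousOn.mul (continuous_sn ρ).continuousOn hv)
  have c1 := intervalIntegral.continuousOn_primitive_interval' h1 left_mem_uIcc
  have c2 := intervalIntegral.continuousOn_primitive_interval' h2 left_mem_uIcc
  rw [uIcc_of_le hL] at c1 c2
  refine (((continuous_sn ρ).continuousOn.mul c1).sub
    ((by fun_prop : Continuous fun x : ℝ => Complex.cos (ρ * x)).continuousOn.mul c2)).congr
      fun x hx => ?_
  simp only [volterra, Pi.sub_apply, Pi.mul_apply]
  rw [← intervalIntegral.integral_const_mul, ← intervalIntegral.integral_const_mul,
    ← intervalIntegral.integral_sub ((IntervalIntegrable.mono_Icc h1 hx).const_mul _)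
      ((IntervalIntegrable.mono_Icc h2 hx).const_mul _)]
  refine intervalIntegral.integral_congr fun s _ => ?_
  simp only [sn_sub]
  ring

/-- For fixed `ρ` the weighted sup norm is halved at every step. The weight depends on `ρ` through
the bound on the kernel, which is harmless: only pointwise convergence is used. -/
theorem iterate_volterra {L : ℝ} (hL : 0 ≤ L) {q : ℝ → ℂ}
    (hq : MemLp q 2 (volume.restrict (Ioc 0 L))) (ρ : ℂ) {v : ℝ → ℂ}
    (hv : ContinuousOn v (Icc 0 L)) :
    (∀ n, ContinuousOn ((volterra q ρ)^[n] v) (Icc 0 L)) ∧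
      ∀ x ∈ Icc 0 L, Tendsto (fun n => (volterra q ρ)^[n] v x) atTop (𝓝 0) := by
  have hqi := intervalIntegrable_of_memLp hL hq
  have hc : ∀ n, ContinuousOn ((volterra q ρ)^[n] v) (Icc 0 L) := by
    intro n
    induction n with
    | zero => simpa using hv
    | succ n ih =>
      rw [Function.iterate_succ_apply']
      exact continuousOn_volterra hL hqi ρ ih
  refine ⟨hc, fun x hx => ?_⟩
  obtain ⟨K, hK⟩ := (isCompact_Icc (a := 0) (b := L)).exists_bound_of_continuousOn
    (continuous_sn ρ).continuousOn
  have hK0 : 0 ≤ K := (norm_nonneg _).trans (hK 0 ⟨le_rfl, hL⟩)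
  obtain ⟨A, hA⟩ := (isCompact_Icc (a := 0) (b := L)).exists_bound_of_continuousOn hv
  have hA0 : 0 ≤ A := (norm_nonneg _).trans (hA 0 ⟨le_rfl, hL⟩)
  obtain ⟨κ, hκ, hw⟩ := exists_weight hq hK0
  have hb : ∀ n, ∀ x ∈ Icc 0 L,
      ‖(volterra q ρ)^[n] v x‖ ≤ A * (1 / 2) ^ n * Real.exp (κ * x) := by
    intro n
    induction n with
    | zero =>
      intro x hx
      have : 1 ≤ Real.exp (κ * x) := Real.one_le_exp (mul_nonneg hκ hx.1)
      simp only [Function.iterate_zero, id, pow_zero, mul_one]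
      nlinarith [hA x hx]
    | succ n ih =>
      intro x hx
      rw [Function.iterate_succ_apply', volterra]
      have hqx := IntervalIntegrable.mono_Icc hqi hx
      have h1 : ‖∫ s in (0 : ℝ)..x, q s * (sn ρ (x - s) * (volterra q ρ)^[n] v s)‖ ≤
          ∫ s in (0 : ℝ)..x, A * (1 / 2) ^ n * (‖q s‖ * (K * Real.exp (κ * s))) := by
        refine intervalIntegral.norm_integral_le_of_norm_le hx.1 (Eventually.of_forall ?_) ?_
        · intro s hs
          have hs' : s ∈ Icc 0 L := ⟨hs.1.le, hs.2.trans hx.2⟩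
          have h2 : ‖sn ρ (x - s)‖ ≤ K :=
            hK _ ⟨by linarith [hs.2], by linarith [hs.1, hx.2]⟩
          rw [norm_mul, norm_mul]
          calc ‖q s‖ * (‖sn ρ (x - s)‖ * ‖(volterra q ρ)^[n] v s‖)
              ≤ ‖q s‖ * (K * (A * (1 / 2) ^ n * Real.exp (κ * s))) := by
                gcongr
                exact ih s hs'
            _ = _ := by ring
        · exact ((hqx.norm.mul_continuousOn (Continuous.continuousOn (by fun_prop))).const_mul _)
      refine h1.trans ?_
      rw [intervalIntegral.integral_const_mul]
      calc A * (1 / 2) ^ n * ∫ s in (0 : ℝ)..x, ‖q s‖ * (K * Real.exp (κ * s))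
          ≤ A * (1 / 2) ^ n * (1 / 2 * Real.exp (κ * x)) := by
            gcongr
            exact hw x hx
        _ = _ := by ring
  refine squeeze_zero_norm (fun n => hb n x hx) ?_
  have := ((tendsto_pow_atTop_nhds_zero_of_lt_one (r := (1 / 2 : ℝ)) (by norm_num)
    (by norm_num)).const_mul A).mul_const (Real.exp (κ * x))
  simpa using this

/-- A fixed point equals all its iterates, and these tend to zero. -/
theorem eq_zero_of_eq_volterra {L : ℝ} (hL : 0 ≤ L) {q : ℝ → ℂ}
    (hq : MemLp q 2 (volume.restrict (Ioc 0 L))) (ρ : ℂ) {v : ℝ → ℂ}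
    (hv : ContinuousOn v (Icc 0 L)) (h : ∀ x ∈ Icc 0 L, v x = volterra q ρ v x) :
    ∀ x ∈ Icc 0 L, v x = 0 := by
  have hn : ∀ n, ∀ x ∈ Icc 0 L, (volterra q ρ)^[n] v x = v x := by
    intro n
    induction n with
    | zero => simp
    | succ n ih =>
      intro x hx
      rw [Function.iterate_succ_apply', h x hx, volterra, volterra]
      refine intervalIntegral.integral_congr fun s hs => ?_
      rw [uIcc_of_le hx.1] at hs
      simp only [ih s ⟨hs.1, hs.2.trans hx.2⟩]
  intro x hx
  have := (iterate_volterra hL hq ρ hv).2 x hx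
  simp only [hn _ x hx] at this
  exact tendsto_nhds_unique tendsto_const_nhds this

theorem volterra_sub {x : ℝ} (hx : 0 ≤ x) {q : ℝ → ℂ} (hq : IntervalIntegrable q volume 0 x)
    (ρ : ℂ) {u v : ℝ → ℂ} (hu : ContinuousOn u (Icc 0 x)) (hv : ContinuousOn v (Icc 0 x)) :
    volterra q ρ (fun s => u s - v s) x = volterra q ρ u x - volterra q ρ v x := by
  simp only [volterra]
  rw [← intervalIntegral.integral_sub]
  · exact intervalIntegral.integral_congr fun s _ => by ring
  · exact IntervalIntegrable.mul_continuousOn_Icc hx hq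
      ((continuous_sn_sub ρ x).continuousOn.mul hu)
  · exact IntervalIntegrable.mul_continuousOn_Icc hx hq
      ((continuous_sn_sub ρ x).continuousOn.mul hv)

/-- Solutions of the Volterra equation with Paley–Wiener right-hand side are Paley–Wiener. -/
theorem PWF.of_volterra {L : ℝ} (hL : 0 ≤ L) {q : ℝ → ℂ}
    (hq : MemLp q 2 (volume.restrict (Ioc 0 L))) {b v : ℂ → ℝ → ℂ} (hb : PWF L b)
    (hv : ∀ ρ, ContinuousOn (v ρ) (Icc 0 L))
    (h : ∀ ρ, ∀ x ∈ Icc 0 L, v ρ x = b ρ x + volterra q ρ (v ρ) x) : PWF L v := by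
  obtain ⟨B, hB, hb⟩ := hb
  -- In the Paley–Wiener norm, multiplication by sin(ρ(x-s))/ρ costs x - s ≤ L, whatever `ρ` is;
  -- hence the weight is taken for the constant `L`.
  obtain ⟨κ, hκ, hw⟩ := exists_weight hq hL
  have hqi := intervalIntegrable_of_memLp hL hq
  have hit := fun ρ => iterate_volterra hL hq ρ (hv ρ)
  -- With V the Volterra operator, v - Vⁿv is the n-th partial Neumann sum, and v - Vⁿ⁺¹v = b + V(v
  -- - Vⁿv). The bound reproduces itself, since B + B exp(κx) ≤ 2B exp(κx).
  have key : ∀ n, ∀ x ∈ Icc 0 L, PW x (2 * B * Real.exp (κ * x))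
      (fun ρ => v ρ x - (volterra q ρ)^[n] (v ρ) x) := by
    intro n
    induction n with
    | zero =>
      intro x _
      refine ((PW.zero x).congr fun ρ => ?_).mono (by positivity)
      simp
    | succ n ih =>
      intro x hx
      have hqx := IntervalIntegrable.mono_Icc hqi hx
      have hsub : Icc 0 x ⊆ Icc 0 L := Icc_subset_Icc_right hx.2
      have h1 : PW x (∫ s in (0 : ℝ)..x, 2 * B * (‖q s‖ * (L * Real.exp (κ * s))))
          (fun ρ => volterra q ρ (fun s => v ρ s - (volterra q ρ)^[n] (v ρ) s) x) := by
        refine PW.integral hx.1 ((hqx.norm.mul_continuousOn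
          (Continuous.continuousOn (by fun_prop))).const_mul _) (fun ρ => ?_) ?_
        · exact IntervalIntegrable.mul_continuousOn_Icc hx.1 hqx
            ((continuous_sn_sub ρ x).continuousOn.mul
              (((hv ρ).mono hsub).sub (((hit ρ).1 n).mono hsub)))
        · filter_upwards [ae_restrict_mem measurableSet_Ioc] with s hs
          have hs' : s ∈ Icc 0 L := ⟨hs.1.le, hs.2.trans hx.2⟩
          refine (((ih s hs').sn_mul (x := x) (a := x - s) (by positivity) hs.1.le
            (by linarith [hs.2]) (by linarith)).const_mul (q s)).mono ?_
          have : x - s ≤ L := by linarith [hs.1, hx.2]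
          calc ‖q s‖ * ((x - s) * (2 * B * Real.exp (κ * s)))
              ≤ ‖q s‖ * (L * (2 * B * Real.exp (κ * s))) := by gcongr
            _ = _ := by ring
      refine (((hb x hx).add h1).congr fun ρ => ?_).mono ?_
      · rw [Function.iterate_succ_apply', volterra_sub hx.1 hqx ρ ((hv ρ).mono hsub)
          (((hit ρ).1 n).mono hsub), h ρ x hx]
        ring
      · rw [intervalIntegral.integral_const_mul]
        have h2 : 1 ≤ Real.exp (κ * x) := Real.one_le_exp (mul_nonneg hκ hx.1)
        nlinarith [mul_le_mul_of_nonneg_left (hw x hx) (by positivity : 0 ≤ 2 * B),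
          mul_le_mul_of_nonneg_left h2 hB]
  refine ⟨2 * B * Real.exp (κ * L), by positivity, fun x hx => ?_⟩
  refine (PW.of_tendsto (fun n => key n x hx) fun ρ => ?_).mono ?_
  · simpa using ((hit ρ).2 x hx).const_sub (v ρ x)
  · gcongr
    exact hx.2

/-! ### Absolute continuity and derivatives of the kernels. -/

theorem AbsolutelyContinuousOnInterval.lipschitz_comp {X Y : Type*} [PseudoMetricSpace X]
    [PseudoMetricSpace Y] {f : ℝ → X} {a b : ℝ} (hf : AbsolutelyContinuousOnInterval f a b)
    {g : X → Y} (hg : ∀ u v, dist (g u) (g v) ≤ dist u v) :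
    AbsolutelyContinuousOnInterval (fun t => g (f t)) a b :=
  squeeze_zero (fun _ => Finset.sum_nonneg fun _ _ => dist_nonneg)
    (fun _ => Finset.sum_le_sum fun _ _ => hg _ _) hf

/-- The fundamental theorem of calculus for complex valued absolutely continuous functions. -/
theorem AbsolutelyContinuousOnInterval.ftc {f f' : ℝ → ℂ} {a b : ℝ}
    (hf : AbsolutelyContinuousOnInterval f a b)
    (h : ∀ᵐ x, x ∈ uIoc a b → HasDerivAt f (f' x) x) :
    IntervalIntegrable f' volume a b ∧ ∫ x in a..b, f' x = f b - f a := by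
  have hre : AbsolutelyContinuousOnInterval (fun t => (f t).re) a b :=
    AbsolutelyContinuousOnInterval.lipschitz_comp hf fun u v => by
      rw [Real.dist_eq, Complex.dist_eq, ← Complex.sub_re]
      exact Complex.abs_re_le_norm _
  have him : AbsolutelyContinuousOnInterval (fun t => (f t).im) a b :=
    AbsolutelyContinuousOnInterval.lipschitz_comp hf fun u v => by
      rw [Real.dist_eq, Complex.dist_eq, ← Complex.sub_im]
      exact Complex.abs_im_le_norm _
  have dre : ∀ᵐ x, x ∈ uIoc a b → deriv (fun t => (f t).re) x = (f' x).re := by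
    filter_upwards [h] with x hx hx'
    exact (Complex.reCLM.hasFDerivAt.comp_hasDerivAt x (hx hx')).deriv
  have dim : ∀ᵐ x, x ∈ uIoc a b → deriv (fun t => (f t).im) x = (f' x).im := by
    filter_upwards [h] with x hx hx'
    exact (Complex.imCLM.hasFDerivAt.comp_hasDerivAt x (hx hx')).deriv
  have ire : IntervalIntegrable (fun x => (f' x).re) volume a b :=
    hre.intervalIntegrable_deriv.congr_ae ((ae_restrict_iff' measurableSet_uIoc).2 dre)
  have iim : IntervalIntegrable (fun x => (f' x).im) volume a b :=
    him.intervalIntegrable_deriv.congr_ae ((ae_restrict_iff' measurableSet_uIoc).2 dim)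
  have hf' : f' = fun x => ((f' x).re : ℂ) + ((f' x).im : ℂ) * Complex.I :=
    funext fun x => (Complex.re_add_im _).symm
  have jre : IntervalIntegrable (fun x => ((f' x).re : ℂ)) volume a b :=
    ⟨ire.1.ofReal, ire.2.ofReal⟩
  have jim : IntervalIntegrable (fun x => ((f' x).im : ℂ) * Complex.I) volume a b :=
    IntervalIntegrable.mul_const ⟨iim.1.ofReal, iim.2.ofReal⟩ _
  have hint : IntervalIntegrable f' volume a b := by
    rw [hf']; exact jre.add jim
  refine ⟨hint, ?_⟩
  rw [hf', intervalIntegral.integral_add jre jim, intervalIntegral.integral_mul_const,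
    intervalIntegral.integral_ofReal, intervalIntegral.integral_ofReal,
    ← intervalIntegral.integral_congr_ae dre, ← intervalIntegral.integral_congr_ae dim,
    hre.integral_deriv_eq_sub, him.integral_deriv_eq_sub]
  apply Complex.ext <;> simp

theorem absolutelyContinuousOnInterval_of_hasDerivAt {f f' : ℝ → ℂ} (a b : ℝ)
    (h : ∀ t, HasDerivAt f (f' t) t) (hf' : Continuous f') :
    AbsolutelyContinuousOnInterval f a b := by
  obtain ⟨C, hC⟩ := (isCompact_uIcc (a := a) (b := b)).exists_bound_of_continuousOn
    hf'.continuousOn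
  refine LipschitzOnWith.absolutelyContinuousOnInterval (K := ⟨|C|, abs_nonneg C⟩) ?_
  refine (convex_uIcc a b).lipschitzOnWith_of_nnnorm_hasDerivWithin_le
    (fun t _ => (h t).hasDerivWithinAt) fun t ht => ?_
  exact (hC t ht).trans (le_abs_self C)

theorem hasDerivAt_sn_sub (ρ : ℂ) (x s : ℝ) :
    HasDerivAt (fun s => sn ρ (x - s)) (-Complex.cos (ρ * (x - s : ℝ))) s := by
  have h := (hasDerivAt_sn ρ (x - s)).scomp s ((hasDerivAt_id s).const_sub x)
  rw [neg_one_smul] at h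
  exact h

theorem hasDerivAt_affine (ρ : ℂ) (x m s : ℝ) :
    HasDerivAt (fun s : ℝ => ρ * (x - m * s : ℝ)) (-(ρ * m)) s := by
  have h : HasDerivAt (fun s : ℝ => x - m * s) (-m) s := by
    simpa using ((hasDerivAt_id s).const_mul m).const_sub x
  simpa using h.ofReal_comp.const_mul ρ

theorem hasDerivAt_cos_affine (ρ : ℂ) (x m s : ℝ) :
    HasDerivAt (fun s : ℝ => Complex.cos (ρ * (x - m * s : ℝ)))
      (ρ * m * Complex.sin (ρ * (x - m * s : ℝ))) s := by
  have h := (Complex.hasDerivAt_cos (ρ * (x - m * s : ℝ))).comp s (hasDerivAt_affine ρ x m s)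
  convert! h using 1
  ring

theorem hasDerivAt_sin_affine (ρ : ℂ) (x m s : ℝ) :
    HasDerivAt (fun s : ℝ => Complex.sin (ρ * (x - m * s : ℝ)))
      (-(ρ * m * Complex.cos (ρ * (x - m * s : ℝ)))) s := by
  have h := (Complex.hasDerivAt_sin (ρ * (x - m * s : ℝ))).comp s (hasDerivAt_affine ρ x m s)
  convert! h using 1
  ring

theorem hasDerivAt_cos_sub (ρ : ℂ) (x s : ℝ) :
    HasDerivAt (fun s : ℝ => Complex.cos (ρ * (x - s : ℝ)))
      (ρ * Complex.sin (ρ * (x - s : ℝ))) s := by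
  simpa using hasDerivAt_cos_affine ρ x 1 s

theorem hasDerivAt_sin_sub (ρ : ℂ) (x s : ℝ) :
    HasDerivAt (fun s : ℝ => Complex.sin (ρ * (x - s : ℝ)))
      (-(ρ * Complex.cos (ρ * (x - s : ℝ)))) s := by
  simpa using hasDerivAt_sin_affine ρ x 1 s

/-! ### Integral equations for the solutions, and parity in ρ. -/

section Solution

variable {q : ℝ → ℂ} {L : ℝ} {ρ a b : ℂ} {y : ℝ → ℂ}

theorem IsSolution.continuousOn (h : IsSolution q L ρ a b y) : ContinuousOn y (Icc 0 L) :=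
  h.differentiableOn.continuousOn

theorem IsSolution.continuousOn_dx (hL : 0 ≤ L) (h : IsSolution q L ρ a b y) :
    ContinuousOn (dx L y) (Icc 0 L) := by
  have := h.absolutelyContinuous.continuousOn
  rwa [uIcc_of_le hL] at this

theorem IsSolution.absolutelyContinuous_self (hL : 0 ≤ L) (h : IsSolution q L ρ a b y) :
    AbsolutelyContinuousOnInterval y 0 L := by
  obtain ⟨C, hC⟩ := (isCompact_Icc (a := 0) (b := L)).exists_bound_of_continuousOn
    (h.continuousOn_dx hL)
  refine LipschitzOnWith.absolutelyContinuousOnInterval (K := ⟨|C|, abs_nonneg C⟩) ?_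
  rw [uIcc_of_le hL]
  refine (convex_Icc 0 L).lipschitzOnWith_of_nnnorm_derivWithin_le h.differentiableOn
    fun t ht => ?_
  exact (hC t ht).trans (le_abs_self C)

theorem IsSolution.hasDerivAt (h : IsSolution q L ρ a b y) {s : ℝ} (hs : s ∈ Ioo 0 L) :
    HasDerivAt y (dx L y s) s :=
  (h.differentiableOn s (Ioo_subset_Icc_self hs)).hasDerivWithinAt.hasDerivAt
    (Icc_mem_nhds hs.1 hs.2)

theorem ae_uIoc_of_ae_Ioo {p : ℝ → Prop} (h : ∀ᵐ s ∂(volume.restrict (Ioo 0 L)), p s) {x : ℝ}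
    (hx : x ∈ Icc 0 L) : ∀ᵐ s, s ∈ uIoc 0 x → p s := by
  filter_upwards [(ae_restrict_iff' measurableSet_Ioo).1 h,
    (measure_eq_zero_iff_ae_notMem.1 (measure_singleton L : volume {L} = 0))] with s hs hsL hs'
  rw [uIoc_of_le hx.1] at hs'
  exact hs ⟨hs'.1, lt_of_le_of_ne (hs'.2.trans hx.2) hsL⟩

/-- Lagrange's identity: as A = -B' and B'' = -ρ²B, the derivative of A y + B y' is q B y almost
everywhere. The pair is left free so that one computation serves both y (where A x = 1, B x = 0) and
y' (where A x = 0, B x = 1). -/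
theorem IsSolution.variation_of_parameters (h : IsSolution q L ρ a b y) (hL : 0 ≤ L) {x : ℝ}
    (hx : x ∈ Icc 0 L) {A B A' B' : ℝ → ℂ} (hA : ∀ s, HasDerivAt A (A' s) s)
    (hB : ∀ s, HasDerivAt B (B' s) s) (hA' : Continuous A') (hB' : Continuous B')
    (hAB : ∀ s, A' s = B s * ρ ^ 2) (hBA : ∀ s, B' s = -A s) :
    ∫ s in (0 : ℝ)..x, q s * (B s * y s) =
      A x * y x + B x * dx L y x - (A 0 * a + B 0 * b) := by
  have hsub : uIcc 0 x ⊆ uIcc 0 L := by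
    rw [uIcc_of_le hx.1, uIcc_of_le hL]; exact Icc_subset_Icc_right hx.2
  have h1 := ((absolutelyContinuousOnInterval_of_hasDerivAt 0 x hA hA').smul
    ((h.absolutelyContinuous_self hL).mono hsub)).add
      ((absolutelyContinuousOnInterval_of_hasDerivAt 0 x hB hB').smul
    (h.absolutelyContinuous.mono hsub))
  have h2 := AbsolutelyContinuousOnInterval.ftc (f' := fun s => q s * (B s * y s)) h1 ?_
  · rw [h2.2]
    simp only [Pi.add_apply, Pi.mul_apply, smul_eq_mul, h.initial_value, h.initial_deriv]
  · refine ae_uIoc_of_ae_Ioo ?_ hx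
    filter_upwards [h.equation, ae_restrict_mem measurableSet_Ioo] with s hs hs'
    have h3 := ((hA s).smul (h.hasDerivAt hs')).add ((hB s).smul hs)
    convert! h3 using 1
    simp only [smul_eq_mul, hAB, hBA]
    ring

theorem IsSolution.eq_volterra (h : IsSolution q L ρ a b y) (hL : 0 ≤ L) {x : ℝ}
    (hx : x ∈ Icc 0 L) :
    y x = a * Complex.cos (ρ * x) + b * sn ρ x + volterra q ρ y x := by
  have := h.variation_of_parameters hL hx (hasDerivAt_cos_sub ρ x) (hasDerivAt_sn_sub ρ x)
    (by fun_prop) (by fun_prop) (fun s => by rw [← mul_sn]; ring) (fun s => rfl)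
  rw [volterra, this]
  simp
  ring

theorem IsSolution.dx_eq (h : IsSolution q L ρ a b y) (hL : 0 ≤ L) {x : ℝ}
    (hx : x ∈ Icc 0 L) :
    dx L y x = -(a * (ρ * Complex.sin (ρ * x))) + b * Complex.cos (ρ * x) +
      ∫ s in (0 : ℝ)..x, q s * (Complex.cos (ρ * (x - s : ℝ)) * y s) := by
  have := h.variation_of_parameters hL hx
    (fun s => ((hasDerivAt_sin_sub ρ x s).const_mul (-ρ))) (hasDerivAt_cos_sub ρ x)
    (by fun_prop) (by fun_prop) (fun s => by ring) (fun s => by ring)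
  rw [this]
  simp
  ring

/-- Solutions are even in `ρ`: the free terms and the kernel of the Volterra equation are even, so
the difference solves the homogeneous equation. This parity allows the two-sided cardinal series to
be folded. -/
theorem IsSolution.eqOn {ρ' : ℂ} {z : ℝ → ℂ} (hq : MemLp q 2 (volume.restrict (Ioc 0 L)))
    (hL : 0 ≤ L) (h : IsSolution q L ρ a b y) (h' : IsSolution q L ρ' a b z) (hρ : ρ' = -ρ) :
    EqOn y z (Icc 0 L) := by
  intro x hx
  have hd := eq_zero_of_eq_volterra hL hq ρ (v := fun s => y s - z s)
    (h.continuousOn.sub h'.continuousOn) (fun t ht => ?_) x hx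
  · exact sub_eq_zero.1 hd
  · have hsub : Icc 0 t ⊆ Icc 0 L := Icc_subset_Icc_right ht.2
    rw [volterra_sub ht.1 (IntervalIntegrable.mono_Icc (intervalIntegrable_of_memLp hL hq) ht) ρ
      (h.continuousOn.mono hsub) (h'.continuousOn.mono hsub), h.eq_volterra hL ht,
      h'.eq_volterra hL ht, hρ]
    simp only [volterra, sn_neg_left, neg_mul, Complex.cos_neg]
    ring

theorem IsSolution.dx_eqOn {ρ' : ℂ} {z : ℝ → ℂ} (hq : MemLp q 2 (volume.restrict (Ioc 0 L)))
    (hL : 0 ≤ L) (h : IsSolution q L ρ a b y) (h' : IsSolution q L ρ' a b z) (hρ : ρ' = -ρ) :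
    EqOn (dx L y) (dx L z) (Icc 0 L) := fun _ hx =>
  derivWithin_congr (h.eqOn hq hL h' hρ) (h.eqOn hq hL h' hρ hx)

end Solution

/-! ### Products of trigonometric functions under the integral. -/

section Trig

variable {x : ℝ} {w : ℝ → ℂ}

/-- Of the two frequencies, x does not depend on `s` and yields an explicit asymptotic term, while x
- 2s yields a transform of a density. The three companions below play the same role. -/
theorem integral_sin_mul_cos (hx : 0 ≤ x) (hw : IntervalIntegrable w volume 0 x) (ρ : ℂ) :
    ∫ s in (0 : ℝ)..x, w s * (Complex.sin (ρ * (x - s : ℝ)) * Complex.cos (ρ * s)) =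
      1 / 2 * Complex.sin (ρ * x) * (∫ s in (0 : ℝ)..x, w s) +
        1 / 2 * ∫ s in (0 : ℝ)..x, w s * Complex.sin (ρ * (x - 2 * s : ℝ)) := by
  rw [← intervalIntegral.integral_const_mul, ← intervalIntegral.integral_const_mul,
    ← intervalIntegral.integral_add (hw.const_mul _)
      ((IntervalIntegrable.mul_continuousOn_Icc hx hw (by fun_prop)).const_mul _)]
  refine intervalIntegral.integral_congr fun s _ => ?_
  rw [show ρ * x = ρ * (x - s : ℝ) + ρ * s by push_cast; ring,
    show ρ * (x - 2 * s : ℝ) = ρ * (x - s : ℝ) - ρ * s by push_cast; ring,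
    Complex.sin_add, Complex.sin_sub]
  ring

theorem integral_sin_mul_sin (hx : 0 ≤ x) (hw : IntervalIntegrable w volume 0 x) (ρ : ℂ) :
    ∫ s in (0 : ℝ)..x, w s * (Complex.sin (ρ * (x - s : ℝ)) * Complex.sin (ρ * s)) =
      -(1 / 2) * Complex.cos (ρ * x) * (∫ s in (0 : ℝ)..x, w s) +
        1 / 2 * ∫ s in (0 : ℝ)..x, w s * Complex.cos (ρ * (x - 2 * s : ℝ)) := by
  rw [← intervalIntegral.integral_const_mul, ← intervalIntegral.integral_const_mul,
    ← intervalIntegral.integral_add (hw.const_mul _)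
      ((IntervalIntegrable.mul_continuousOn_Icc hx hw (by fun_prop)).const_mul _)]
  refine intervalIntegral.integral_congr fun s _ => ?_
  rw [show ρ * x = ρ * (x - s : ℝ) + ρ * s by push_cast; ring,
    show ρ * (x - 2 * s : ℝ) = ρ * (x - s : ℝ) - ρ * s by push_cast; ring,
    Complex.cos_add, Complex.cos_sub]
  ring

theorem integral_cos_mul_sin (hx : 0 ≤ x) (hw : IntervalIntegrable w volume 0 x) (ρ : ℂ) :
    ∫ s in (0 : ℝ)..x, w s * (Complex.cos (ρ * (x - s : ℝ)) * Complex.sin (ρ * s)) =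
      1 / 2 * Complex.sin (ρ * x) * (∫ s in (0 : ℝ)..x, w s) +
        -(1 / 2) * ∫ s in (0 : ℝ)..x, w s * Complex.sin (ρ * (x - 2 * s : ℝ)) := by
  rw [← intervalIntegral.integral_const_mul, ← intervalIntegral.integral_const_mul,
    ← intervalIntegral.integral_add (hw.const_mul _)
      ((IntervalIntegrable.mul_continuousOn_Icc hx hw (by fun_prop)).const_mul _)]
  refine intervalIntegral.integral_congr fun s _ => ?_
  rw [show ρ * x = ρ * (x - s : ℝ) + ρ * s by push_cast; ring,
    show ρ * (x - 2 * s : ℝ) = ρ * (x - s : ℝ) - ρ * s by push_cast; ring,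
    Complex.sin_add, Complex.sin_sub]
  ring

theorem integral_cos_mul_cos (hx : 0 ≤ x) (hw : IntervalIntegrable w volume 0 x) (ρ : ℂ) :
    ∫ s in (0 : ℝ)..x, w s * (Complex.cos (ρ * (x - s : ℝ)) * Complex.cos (ρ * s)) =
      1 / 2 * Complex.cos (ρ * x) * (∫ s in (0 : ℝ)..x, w s) +
        1 / 2 * ∫ s in (0 : ℝ)..x, w s * Complex.cos (ρ * (x - 2 * s : ℝ)) := by
  rw [← intervalIntegral.integral_const_mul, ← intervalIntegral.integral_const_mul,
    ← intervalIntegral.integral_add (hw.const_mul _)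
      ((IntervalIntegrable.mul_continuousOn_Icc hx hw (by fun_prop)).const_mul _)]
  refine intervalIntegral.integral_congr fun s _ => ?_
  rw [show ρ * x = ρ * (x - s : ℝ) + ρ * s by push_cast; ring,
    show ρ * (x - 2 * s : ℝ) = ρ * (x - s : ℝ) - ρ * s by push_cast; ring,
    Complex.cos_add, Complex.cos_sub]
  ring

end Trig

/-! ### Algebra of the Volterra operator. -/

section Operator

variable {q : ℝ → ℂ} {x : ℝ}

theorem integral_eq_two_mul_omega (q : ℝ → ℂ) (x : ℝ) :
    ∫ s in (0 : ℝ)..x, q s = 2 * omega q x := by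
  rw [omega]; ring

theorem mul_volterra (q : ℝ → ℂ) (ρ : ℂ) (v : ℝ → ℂ) (x : ℝ) :
    ρ * volterra q ρ v x = ∫ s in (0 : ℝ)..x, q s * (Complex.sin (ρ * (x - s : ℝ)) * v s) := by
  rw [volterra, ← intervalIntegral.integral_const_mul]
  refine intervalIntegral.integral_congr fun s _ => ?_
  simp only [← mul_sn]
  ring

theorem volterra_const_mul (q : ℝ → ℂ) (ρ a : ℂ) (v : ℝ → ℂ) (x : ℝ) :
    volterra q ρ (fun s => a * v s) x = a * volterra q ρ v x := by
  rw [volterra, volterra, ← intervalIntegral.integral_const_mul]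
  exact intervalIntegral.integral_congr fun s _ => by ring

theorem volterra_weight (q : ℝ → ℂ) (ρ : ℂ) (w v : ℝ → ℂ) (x : ℝ) :
    volterra q ρ (fun s => w s * v s) x = volterra (fun s => q s * w s) ρ v x := by
  rw [volterra, volterra]
  exact intervalIntegral.integral_congr fun s _ => by ring

theorem continuousOn_omega {L : ℝ} (hL : 0 ≤ L) (hq : IntervalIntegrable q volume 0 L) :
    ContinuousOn (omega q) (Icc 0 L) := by
  have := intervalIntegral.continuousOn_primitive_interval' hq left_mem_uIcc
  rw [uIcc_of_le hL] at this
  exact continuousOn_const.mul this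

theorem PWF.volterra_cos {L : ℝ} (hL : 0 ≤ L) (hq : IntervalIntegrable q volume 0 L) {w : ℝ → ℂ}
    (hw : ContinuousOn w (Icc 0 L)) :
    PWF L (fun ρ x => volterra q ρ (fun s => w s * Complex.cos (ρ * s)) x) :=
  (PWF.integral_sn_mul_cos (IntervalIntegrable.mul_continuousOn_Icc hL hq hw)).congr
    fun ρ x _ => volterra_weight q ρ w _ x

theorem PWF.volterra_sin {L : ℝ} (hL : 0 ≤ L) (hq : IntervalIntegrable q volume 0 L) {w : ℝ → ℂ}
    (hw : ContinuousOn w (Icc 0 L)) :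
    PWF L (fun ρ x => volterra q ρ (fun s => w s * Complex.sin (ρ * s)) x) :=
  (PWF.integral_sn_mul_sin (IntervalIntegrable.mul_continuousOn_Icc hL hq hw)).congr
    fun ρ x _ => volterra_weight q ρ w _ x

end Operator

/-! ### Asymptotic expansions of the solutions modulo Paley–Wiener terms. -/

section Transmutation

variable {q : ℝ → ℂ} {L : ℝ} {h : ℂ} {S φ : ℂ → ℝ → ℂ}

/-- The difference u - u₀ solves the same equation with free term b + Vu₀, V being the Volterra
operator. The leading term `u₀` need not be Paley–Wiener, only Vu₀. The new equation is returned as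
well, because multiplying it by `ρ` starts the next order. -/
theorem PWF.sub_of_volterra (hL : 0 ≤ L) (hq : MemLp q 2 (volume.restrict (Ioc 0 L)))
    {b u u₀ : ℂ → ℝ → ℂ} (hb : PWF L b) (hu : ∀ ρ, ContinuousOn (u ρ) (Icc 0 L))
    (hu₀ : ∀ ρ, ContinuousOn (u₀ ρ) (Icc 0 L)) (hV : PWF L (fun ρ x => volterra q ρ (u₀ ρ) x))
    (h : ∀ ρ, ∀ x ∈ Icc 0 L, u ρ x = u₀ ρ x + b ρ x + volterra q ρ (u ρ) x) :
    PWF L (fun ρ x => u ρ x - u₀ ρ x) ∧ ∀ ρ, ∀ x ∈ Icc 0 L, u ρ x - u₀ ρ x =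
      b ρ x + volterra q ρ (u₀ ρ) x + volterra q ρ (fun s => u ρ s - u₀ ρ s) x := by
  have key : ∀ ρ, ∀ x ∈ Icc 0 L, u ρ x - u₀ ρ x =
      b ρ x + volterra q ρ (u₀ ρ) x + volterra q ρ (fun s => u ρ s - u₀ ρ s) x := by
    intro ρ x hx
    have hsub : Icc 0 x ⊆ Icc 0 L := Icc_subset_Icc_right hx.2
    rw [volterra_sub hx.1 (IntervalIntegrable.mono_Icc (intervalIntegrable_of_memLp hL hq) hx) ρ
      ((hu ρ).mono hsub) ((hu₀ ρ).mono hsub), h ρ x hx]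
    ring
  exact ⟨PWF.of_volterra hL hq (hb.add hV) (fun ρ => (hu ρ).sub (hu₀ ρ)) key, key⟩

theorem continuous_cos_mul (ρ : ℂ) : Continuous fun s : ℝ => Complex.cos (ρ * s) := by fun_prop

theorem continuous_sin_mul (ρ : ℂ) : Continuous fun s : ℝ => Complex.sin (ρ * s) := by fun_prop

theorem PWF.phi_sub_cos (hL : 0 ≤ L) (hq : MemLp q 2 (volume.restrict (Ioc 0 L)))
    (hφ : ∀ ρ : ℂ, IsSolution q L ρ 1 h (φ ρ)) :
    PWF L (fun ρ x => φ ρ x - Complex.cos (ρ * x)) ∧ ∀ ρ, ∀ x ∈ Icc 0 L,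
      φ ρ x - Complex.cos (ρ * x) = h * SincSL.sn ρ x + volterra q ρ (fun s => Complex.cos (ρ * s)) x +
        volterra q ρ (fun s => φ ρ s - Complex.cos (ρ * s)) x := by
  refine PWF.sub_of_volterra (u₀ := fun ρ s => Complex.cos (ρ * s)) (b := fun ρ x => h * SincSL.sn ρ x)
    hL hq ((PWF.sn L).const_mul h) (fun ρ => (hφ ρ).continuousOn)
    (fun ρ => (continuous_cos_mul ρ).continuousOn) ?_ fun ρ x hx => ?_
  · simpa using PWF.volterra_cos hL (intervalIntegrable_of_memLp hL hq) (w := fun _ => 1)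
      continuousOn_const
  · rw [(hφ ρ).eq_volterra hL hx]
    ring

theorem PWF.mul_S_sub_sin (hL : 0 ≤ L) (hq : MemLp q 2 (volume.restrict (Ioc 0 L)))
    (hS : ∀ ρ : ℂ, IsSolution q L ρ 0 1 (S ρ)) :
    PWF L (fun ρ x => ρ * S ρ x - Complex.sin (ρ * x)) ∧ ∀ ρ, ∀ x ∈ Icc 0 L,
      ρ * S ρ x - Complex.sin (ρ * x) = 0 + volterra q ρ (fun s => Complex.sin (ρ * s)) x +
        volterra q ρ (fun s => ρ * S ρ s - Complex.sin (ρ * s)) x := by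
  refine PWF.sub_of_volterra (u := fun ρ s => ρ * S ρ s) (u₀ := fun ρ s => Complex.sin (ρ * s))
    (b := fun _ _ => 0) hL hq ⟨0, le_rfl, fun x _ => PW.zero x⟩
    (fun ρ => continuousOn_const.mul (hS ρ).continuousOn)
    (fun ρ => (continuous_sin_mul ρ).continuousOn) ?_ fun ρ x hx => ?_
  · simpa using PWF.volterra_sin hL (intervalIntegrable_of_memLp hL hq) (w := fun _ => 1)
      continuousOn_const
  · rw [volterra_const_mul, (hS ρ).eq_volterra hL hx, ← mul_sn]
    ring

/-- Serves only to give continuity of S(·, x) at ρ = 0, where estimates containing 1/ρ are silent.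
-/
theorem PWF.solution (hL : 0 ≤ L) (hq : MemLp q 2 (volume.restrict (Ioc 0 L)))
    (hS : ∀ ρ : ℂ, IsSolution q L ρ 0 1 (S ρ)) : PWF L S :=
  PWF.of_volterra hL hq (PWF.sn L) (fun ρ => (hS ρ).continuousOn) fun ρ x hx => by
    rw [(hS ρ).eq_volterra hL hx]; ring

/-- In the integral formula for S' write ρS as sin plus a Paley–Wiener term: the sine gives ω sin ρx
and an integral with frequency x - 2s, the rest stays in the class. -/
theorem PWF.mul_dx_S (hL : 0 ≤ L) (hq : MemLp q 2 (volume.restrict (Ioc 0 L)))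
    (hS : ∀ ρ : ℂ, IsSolution q L ρ 0 1 (S ρ)) :
    PWF L (fun ρ x => ρ * dx L (S ρ) x - ρ * Complex.cos (ρ * x)
      - omega q x * Complex.sin (ρ * x)) := by
  have hqi := intervalIntegrable_of_memLp hL hq
  have hc : ∀ ρ, ContinuousOn (fun x : ℝ => ρ * S ρ x - Complex.sin (ρ * x)) (Icc 0 L) :=
    fun ρ => (continuousOn_const.mul (hS ρ).continuousOn).sub (continuous_sin_mul ρ).continuousOn
  refine (((PWF.integral_sin hq).const_mul (-(1 / 2))).add (PWF.integral_cos_mul hqi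
    (PWF.mul_S_sub_sin hL hq hS).1 hc)).congr fun ρ x hx => ?_
  have hqx := IntervalIntegrable.mono_Icc hqi hx
  have hsub : Icc 0 x ⊆ Icc 0 L := Icc_subset_Icc_right hx.2
  have h1 := integral_cos_mul_sin hx.1 hqx ρ
  rw [integral_eq_two_mul_omega q] at h1
  have h2 : ∫ s in (0 : ℝ)..x, q s * (Complex.cos (ρ * (x - s : ℝ)) *
      (ρ * S ρ s - Complex.sin (ρ * s))) =
      ρ * (∫ s in (0 : ℝ)..x, q s * (Complex.cos (ρ * (x - s : ℝ)) * S ρ s)) -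
      ∫ s in (0 : ℝ)..x, q s * (Complex.cos (ρ * (x - s : ℝ)) * Complex.sin (ρ * s)) := by
    rw [← intervalIntegral.integral_const_mul, ← intervalIntegral.integral_sub]
    · exact intervalIntegral.integral_congr fun s _ => by ring
    · exact (IntervalIntegrable.mul_continuousOn_Icc hx.1 hqx (ContinuousOn.mul (by fun_prop)
        ((hS ρ).continuousOn.mono hsub))).const_mul _
    · exact IntervalIntegrable.mul_continuousOn_Icc hx.1 hqx (by fun_prop)
  rw [h2, h1, (hS ρ).dx_eq hL hx]
  ring

theorem PWF.dx_phi (hL : 0 ≤ L) (hq : MemLp q 2 (volume.restrict (Ioc 0 L)))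
    (hφ : ∀ ρ : ℂ, IsSolution q L ρ 1 h (φ ρ)) :
    PWF L (fun ρ x => dx L (φ ρ) x + ρ * Complex.sin (ρ * x)
      - (h + omega q x) * Complex.cos (ρ * x)) := by
  have hqi := intervalIntegrable_of_memLp hL hq
  have hc : ∀ ρ, ContinuousOn (fun x : ℝ => φ ρ x - Complex.cos (ρ * x)) (Icc 0 L) :=
    fun ρ => (hφ ρ).continuousOn.sub (continuous_cos_mul ρ).continuousOn
  refine (((PWF.integral_cos hq).const_mul (1 / 2)).add (PWF.integral_cos_mul hqi
    (PWF.phi_sub_cos hL hq hφ).1 hc)).congr fun ρ x hx => ?_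
  have hqx := IntervalIntegrable.mono_Icc hqi hx
  have hsub : Icc 0 x ⊆ Icc 0 L := Icc_subset_Icc_right hx.2
  have h1 := integral_cos_mul_cos hx.1 hqx ρ
  rw [integral_eq_two_mul_omega q] at h1
  have h2 : ∫ s in (0 : ℝ)..x, q s * (Complex.cos (ρ * (x - s : ℝ)) *
      (φ ρ s - Complex.cos (ρ * s))) =
      (∫ s in (0 : ℝ)..x, q s * (Complex.cos (ρ * (x - s : ℝ)) * φ ρ s)) -
      ∫ s in (0 : ℝ)..x, q s * (Complex.cos (ρ * (x - s : ℝ)) * Complex.cos (ρ * s)) := by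
    rw [← intervalIntegral.integral_sub]
    · exact intervalIntegral.integral_congr fun s _ => by ring
    · exact IntervalIntegrable.mul_continuousOn_Icc hx.1 hqx (ContinuousOn.mul (by fun_prop)
        ((hφ ρ).continuousOn.mono hsub))
    · exact IntervalIntegrable.mul_continuousOn_Icc hx.1 hqx (by fun_prop)
  rw [h2, h1, (hφ ρ).dx_eq hL hx]
  ring

/-- Multiplying the equation of φ - cos by `ρ` turns its free terms into (h + ω) sin ρx plus a
transform of an L₂ density, so `PWF.sub_of_volterra` applies again. No smoothness of `q` is needed
yet. -/
theorem PWF.phi_second (hL : 0 ≤ L) (hq : MemLp q 2 (volume.restrict (Ioc 0 L)))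
    (hφ : ∀ ρ : ℂ, IsSolution q L ρ 1 h (φ ρ)) :
    PWF L (fun ρ x => ρ * (φ ρ x - Complex.cos (ρ * x))
        - (h + omega q x) * Complex.sin (ρ * x)) ∧ ∀ ρ, ∀ x ∈ Icc 0 L,
      ρ * (φ ρ x - Complex.cos (ρ * x)) - (h + omega q x) * Complex.sin (ρ * x) =
        1 / 2 * (∫ s in (0 : ℝ)..x, q s * Complex.sin (ρ * (x - 2 * s : ℝ))) +
        volterra q ρ (fun s => (h + omega q s) * Complex.sin (ρ * s)) x +
        volterra q ρ (fun s => ρ * (φ ρ s - Complex.cos (ρ * s))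
          - (h + omega q s) * Complex.sin (ρ * s)) x := by
  have hqi := intervalIntegrable_of_memLp hL hq
  have hω : ContinuousOn (fun s => h + omega q s) (Icc 0 L) :=
    continuousOn_const.add (continuousOn_omega hL hqi)
  refine PWF.sub_of_volterra (u := fun ρ s => ρ * (φ ρ s - Complex.cos (ρ * s)))
    (u₀ := fun ρ s => (h + omega q s) * Complex.sin (ρ * s))
    (b := fun ρ x => 1 / 2 * ∫ s in (0 : ℝ)..x, q s * Complex.sin (ρ * (x - 2 * s : ℝ)))
    hL hq ((PWF.integral_sin hq).const_mul _)
    (fun ρ => continuousOn_const.mul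
      ((hφ ρ).continuousOn.sub (continuous_cos_mul ρ).continuousOn))
    (fun ρ => hω.mul (continuous_sin_mul ρ).continuousOn) (PWF.volterra_sin hL hqi hω)
    fun ρ x hx => ?_
  have h1 := integral_sin_mul_cos hx.1 (IntervalIntegrable.mono_Icc hqi hx) ρ
  rw [integral_eq_two_mul_omega q, ← mul_volterra] at h1
  rw [volterra_const_mul, (PWF.phi_sub_cos hL hq hφ).2 ρ x hx, mul_add, mul_add, h1, ← mul_sn]
  ring

theorem PWF.S_second (hL : 0 ≤ L) (hq : MemLp q 2 (volume.restrict (Ioc 0 L)))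
    (hS : ∀ ρ : ℂ, IsSolution q L ρ 0 1 (S ρ)) :
    PWF L (fun ρ x => ρ * (ρ * S ρ x - Complex.sin (ρ * x))
        - (-omega q x) * Complex.cos (ρ * x)) ∧ ∀ ρ, ∀ x ∈ Icc 0 L,
      ρ * (ρ * S ρ x - Complex.sin (ρ * x)) - (-omega q x) * Complex.cos (ρ * x) =
        1 / 2 * (∫ s in (0 : ℝ)..x, q s * Complex.cos (ρ * (x - 2 * s : ℝ))) +
        volterra q ρ (fun s => (-omega q s) * Complex.cos (ρ * s)) x +
        volterra q ρ (fun s => ρ * (ρ * S ρ s - Complex.sin (ρ * s))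
          - (-omega q s) * Complex.cos (ρ * s)) x := by
  have hqi := intervalIntegrable_of_memLp hL hq
  have hω : ContinuousOn (fun s => -omega q s) (Icc 0 L) := (continuousOn_omega hL hqi).neg
  refine PWF.sub_of_volterra (u := fun ρ s => ρ * (ρ * S ρ s - Complex.sin (ρ * s)))
    (u₀ := fun ρ s => (-omega q s) * Complex.cos (ρ * s))
    (b := fun ρ x => 1 / 2 * ∫ s in (0 : ℝ)..x, q s * Complex.cos (ρ * (x - 2 * s : ℝ)))
    hL hq ((PWF.integral_cos hq).const_mul _)
    (fun ρ => continuousOn_const.mul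
      ((continuousOn_const.mul (hS ρ).continuousOn).sub (continuous_sin_mul ρ).continuousOn))
    (fun ρ => hω.mul (continuous_cos_mul ρ).continuousOn) (PWF.volterra_cos hL hqi hω)
    fun ρ x hx => ?_
  have h1 := integral_sin_mul_sin hx.1 (IntervalIntegrable.mono_Icc hqi hx) ρ
  rw [integral_eq_two_mul_omega q, ← mul_volterra] at h1
  rw [volterra_const_mul, (PWF.mul_S_sub_sin hL hq hS).2 ρ x hx, mul_add, mul_add, h1]
  ring

theorem IsW21.continuousOn (hL : 0 ≤ L) (hW : IsW21 q L) : ContinuousOn q (Icc 0 L) := by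
  have := hW.1.continuousOn
  rwa [uIcc_of_le hL] at this

theorem AbsolutelyContinuousOnInterval.ae_hasDerivAt {f : ℝ → ℂ} {a b : ℝ} (hf : AbsolutelyContinuousOnInterval f a b) :
    ∀ᵐ x, x ∈ uIoc a b → HasDerivAt f (deriv f x) x := by
  have hre : AbsolutelyContinuousOnInterval (fun t => (f t).re) a b :=
    AbsolutelyContinuousOnInterval.lipschitz_comp hf fun u v => by
      rw [Real.dist_eq, Complex.dist_eq, ← Complex.sub_re]
      exact Complex.abs_re_le_norm _
  have him : AbsolutelyContinuousOnInterval (fun t => (f t).im) a b :=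
    AbsolutelyContinuousOnInterval.lipschitz_comp hf fun u v => by
      rw [Real.dist_eq, Complex.dist_eq, ← Complex.sub_im]
      exact Complex.abs_im_le_norm _
  filter_upwards [hre.ae_differentiableAt, him.ae_differentiableAt] with x h1 h2 hx
  have hx' := uIoc_subset_uIcc hx
  have h3 := (h1 hx').hasDerivAt.ofReal_comp.add ((h2 hx').hasDerivAt.ofReal_comp.mul_const
    Complex.I)
  have h4 : (fun t => ((f t).re : ℂ)) + (fun t => ((f t).im : ℂ) * Complex.I) = f :=
    funext fun t => Complex.re_add_im (f t)
  rw [h4] at h3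
  exact h3.differentiableAt.hasDerivAt

/-- Since ω' = q/2 almost everywhere, qω is the derivative of ω². -/
theorem integral_mul_omega (hL : 0 ≤ L) (hc : ContinuousOn q (Icc 0 L)) {x : ℝ}
    (hx : x ∈ Icc 0 L) : ∫ s in (0 : ℝ)..x, q s * omega q s = omega q x ^ 2 := by
  have hqi : IntervalIntegrable q volume 0 L :=
    ContinuousOn.intervalIntegrable (by rwa [uIcc_of_le hL])
  have hqx := IntervalIntegrable.mono_Icc hqi hx
  obtain ⟨C, hC⟩ := isCompact_Icc.exists_bound_of_continuousOn hc
  have hω : AbsolutelyContinuousOnInterval (omega q) 0 x := by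
    refine LipschitzOnWith.absolutelyContinuousOnInterval (K := ⟨|C|, abs_nonneg C⟩) ?_
    rw [uIcc_of_le hx.1]
    refine LipschitzOnWith.of_dist_le_mul fun s hs t ht => ?_
    have hs' : IntervalIntegrable q volume 0 s := IntervalIntegrable.mono_Icc hqx hs
    have ht' : IntervalIntegrable q volume 0 t := IntervalIntegrable.mono_Icc hqx ht
    rw [Complex.dist_eq, omega, omega, ← mul_sub, intervalIntegral.integral_interval_sub_left
      hs' ht', norm_mul]
    have h1 : ‖∫ u in t..s, q u‖ ≤ |C| * |s - t| := by
      refine intervalIntegral.norm_integral_le_of_norm_le_const fun u hu => ?_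
      refine (hC u ?_).trans (le_abs_self C)
      have h2 : uIcc t s ⊆ Icc 0 L := by
        refine uIcc_subset_Icc ⟨ht.1, ht.2.trans hx.2⟩ ⟨hs.1, hs.2.trans hx.2⟩
      exact h2 (uIoc_subset_uIcc hu)
    rw [Real.dist_eq]
    have h3 : ‖(1 / 2 : ℂ)‖ ≤ 1 := by norm_num
    calc ‖(1 / 2 : ℂ)‖ * ‖∫ u in t..s, q u‖ ≤ 1 * (|C| * |s - t|) := by gcongr
      _ = _ := one_mul _
  have h1 := AbsolutelyContinuousOnInterval.ftc (f' := fun s => q s * omega q s) (hω.smul hω) ?_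
  · rw [h1.2]
    simp [omega, sq]
  · filter_upwards [hqx.ae_hasDerivAt_integral] with s hs hs'
    have h2 := (hs (uIoc_subset_uIcc hs') 0 left_mem_uIcc).const_mul (1 / 2 : ℂ)
    have h3 : HasDerivAt (omega q) (1 / 2 * q s) s := h2
    convert! h3.smul h3 using 1
    simp only [smul_eq_mul]
    ring

/-- Integration by parts against a continuously differentiable function. -/
theorem IsW21.integral_by_parts (hL : 0 ≤ L) (hW : IsW21 q L) {x : ℝ} (hx : x ∈ Icc 0 L)
    {A A' : ℝ → ℂ} (hA : ∀ s, HasDerivAt A (A' s) s) (hA' : Continuous A') :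
    (∫ s in (0 : ℝ)..x, q s * A' s) + (∫ s in (0 : ℝ)..x, deriv q s * A s) =
      q x * A x - q 0 * A 0 := by
  have hsub : uIcc 0 x ⊆ uIcc 0 L := by
    rw [uIcc_of_le hx.1, uIcc_of_le hL]; exact Icc_subset_Icc_right hx.2
  have hqac := hW.1.mono hsub
  have hAc : Continuous A := continuous_iff_continuousAt.2 fun s => (hA s).continuousAt
  have hd := AbsolutelyContinuousOnInterval.ae_hasDerivAt hqac
  have h1 := AbsolutelyContinuousOnInterval.ftc (f' := fun s => q s * A' s + deriv q s * A s)
    (hqac.smul (absolutelyContinuousOnInterval_of_hasDerivAt 0 x hA hA')) ?_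
  · rw [← intervalIntegral.integral_add, h1.2]
    · simp
    · exact (hqac.continuousOn.intervalIntegrable).mul_continuousOn hA'.continuousOn
    · exact (AbsolutelyContinuousOnInterval.ftc hqac hd).1.mul_continuousOn hAc.continuousOn
  · filter_upwards [hd] with s hs hs'
    exact (hs hs').smul (hA s)

theorem IsW21.memLp_deriv (hW : IsW21 q L) : MemLp (deriv q) 2 (volume.restrict (Ioc 0 L)) :=
  hW.2.mono_measure (Measure.restrict_mono Ioc_subset_Icc_self le_rfl)

theorem memLp_of_continuousOn {w : ℝ → ℂ} (hw : ContinuousOn w (Icc 0 L)) :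
    MemLp w 2 (volume.restrict (Ioc 0 L)) := by
  obtain ⟨C, hC⟩ := isCompact_Icc.exists_bound_of_continuousOn hw
  refine MemLp.of_bound ((hw.mono Ioc_subset_Icc_self).aestronglyMeasurable measurableSet_Ioc)
    C ?_
  filter_upwards [ae_restrict_mem measurableSet_Ioc] with t ht
  exact hC t (Ioc_subset_Icc_self ht)

/-- Multiply the second order equation by `ρ` once more. Integrating ρ∫ q sin ρ(x-2s) by parts gives
the boundary part (q(x) - q(0))/4 of qʰ and leaves the density q'; the Volterra term of (h + ω) sin
gives -hω - ω²/2. The last term inherits the class from the second order remainder. -/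
theorem PWF.phi_third (hL : 0 ≤ L) (hq : MemLp q 2 (volume.restrict (Ioc 0 L)))
    (hW : IsW21 q L) (hφ : ∀ ρ : ℂ, IsSolution q L ρ 1 h (φ ρ)) :
    PWF L (fun ρ x => ρ * (ρ * (φ ρ x - Complex.cos (ρ * x))
        - (h + omega q x) * Complex.sin (ρ * x)) - qh q h x * Complex.cos (ρ * x)) := by
  have hqi := intervalIntegrable_of_memLp hL hq
  have hqc := hW.continuousOn hL
  have hω : ContinuousOn (fun s => h + omega q s) (Icc 0 L) :=
    continuousOn_const.add (continuousOn_omega hL hqi)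
  obtain ⟨hu, hue⟩ := PWF.phi_second hL hq hφ
  have hc : ∀ ρ, ContinuousOn (fun s : ℝ => ρ * (φ ρ s - Complex.cos (ρ * s))
      - (h + omega q s) * Complex.sin (ρ * s)) (Icc 0 L) := fun ρ =>
    (continuousOn_const.mul ((hφ ρ).continuousOn.sub (continuous_cos_mul ρ).continuousOn)).sub
      (hω.mul (continuous_sin_mul ρ).continuousOn)
  refine ((((PWF.integral_cos hW.memLp_deriv).const_mul (-(1 / 4))).add
    ((PWF.integral_cos (memLp_of_continuousOn (hqc.mul hω))).const_mul (1 / 2))).add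
    (PWF.integral_sin_mul hqi hu hc)).congr fun ρ x hx => ?_
  have hqx := IntervalIntegrable.mono_Icc hqi hx
  have hsub : Icc 0 x ⊆ Icc 0 L := Icc_subset_Icc_right hx.2
  have h1 := hW.integral_by_parts hL hx (hasDerivAt_cos_affine ρ x 2) (by fun_prop)
  have h2 : ∫ s in (0 : ℝ)..x, q s * (ρ * (2 : ℝ) * Complex.sin (ρ * (x - 2 * s : ℝ))) =
      2 * ρ * ∫ s in (0 : ℝ)..x, q s * Complex.sin (ρ * (x - 2 * s : ℝ)) := by
    rw [← intervalIntegral.integral_const_mul]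
    exact intervalIntegral.integral_congr fun s _ => by push_cast; ring
  have h3 := integral_sin_mul_sin hx.1
    (IntervalIntegrable.mul_continuousOn_Icc hx.1 hqx (hω.mono hsub)) ρ
  have h4 : ∫ s in (0 : ℝ)..x, q s * (h + omega q s) = 2 * h * omega q x + omega q x ^ 2 := by
    rw [← integral_mul_omega hL hqc hx]
    have : ∀ s, q s * (h + omega q s) = h * q s + q s * omega q s := fun s => by ring
    simp only [this]
    rw [intervalIntegral.integral_add (hqx.const_mul _) (IntervalIntegrable.mul_continuousOn_Icc
      hx.1 hqx ((continuousOn_omega hL hqi).mono hsub)), intervalIntegral.integral_const_mul,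
      integral_eq_two_mul_omega]
    ring
  have e1 : Complex.cos (ρ * (x - 2 * x : ℝ)) = Complex.cos (ρ * x) := by
    rw [← Complex.cos_neg]; congr 1; push_cast; ring
  rw [h2, e1, mul_zero, sub_zero] at h1
  rw [h4] at h3
  rw [hue ρ x hx, volterra_weight, mul_add, mul_add, mul_volterra, mul_volterra, h3, qh]
  linear_combination (1 / 4) * h1

/-- As for φ, but sin ρ(x-2s) takes opposite values at the two ends, whence q(x) + q(0) in place of
the difference. -/
theorem PWF.S_third (hL : 0 ≤ L) (hq : MemLp q 2 (volume.restrict (Ioc 0 L)))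
    (hW : IsW21 q L) (hS : ∀ ρ : ℂ, IsSolution q L ρ 0 1 (S ρ)) :
    PWF L (fun ρ x => ρ * (ρ * (ρ * S ρ x - Complex.sin (ρ * x))
        - (-omega q x) * Complex.cos (ρ * x)) - qPlus q x * Complex.sin (ρ * x)) := by
  have hqi := intervalIntegrable_of_memLp hL hq
  have hqc := hW.continuousOn hL
  have hω : ContinuousOn (fun s => -omega q s) (Icc 0 L) := (continuousOn_omega hL hqi).neg
  obtain ⟨hu, hue⟩ := PWF.S_second hL hq hS
  have hc : ∀ ρ, ContinuousOn (fun s : ℝ => ρ * (ρ * S ρ s - Complex.sin (ρ * s))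
      - (-omega q s) * Complex.cos (ρ * s)) (Icc 0 L) := fun ρ =>
    (continuousOn_const.mul ((continuousOn_const.mul (hS ρ).continuousOn).sub
      (continuous_sin_mul ρ).continuousOn)).sub (hω.mul (continuous_cos_mul ρ).continuousOn)
  refine ((((PWF.integral_sin hW.memLp_deriv).const_mul (1 / 4)).add
    ((PWF.integral_sin (memLp_of_continuousOn (hqc.mul hω))).const_mul (1 / 2))).add
    (PWF.integral_sin_mul hqi hu hc)).congr fun ρ x hx => ?_
  have hqx := IntervalIntegrable.mono_Icc hqi hx
  have hsub : Icc 0 x ⊆ Icc 0 L := Icc_subset_Icc_right hx.2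
  have h1 := hW.integral_by_parts hL hx (hasDerivAt_sin_affine ρ x 2) (by fun_prop)
  have h2 : ∫ s in (0 : ℝ)..x, q s * (-(ρ * (2 : ℝ) * Complex.cos (ρ * (x - 2 * s : ℝ)))) =
      -(2 * ρ) * ∫ s in (0 : ℝ)..x, q s * Complex.cos (ρ * (x - 2 * s : ℝ)) := by
    rw [← intervalIntegral.integral_const_mul]
    exact intervalIntegral.integral_congr fun s _ => by push_cast; ring
  have h3 := integral_sin_mul_cos hx.1
    (IntervalIntegrable.mul_continuousOn_Icc hx.1 hqx (hω.mono hsub)) ρ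
  have h4 : ∫ s in (0 : ℝ)..x, q s * (-omega q s) = -omega q x ^ 2 := by
    rw [← integral_mul_omega hL hqc hx, ← intervalIntegral.integral_neg]
    exact intervalIntegral.integral_congr fun s _ => by ring
  have e1 : Complex.sin (ρ * (x - 2 * x : ℝ)) = -Complex.sin (ρ * x) := by
    rw [← Complex.sin_neg]; congr 1; push_cast; ring
  rw [h2, e1, mul_zero, sub_zero] at h1
  rw [h4] at h3
  rw [hue ρ x hx, volterra_weight, mul_add, mul_add, mul_volterra, mul_volterra, h3, qPlus]
  linear_combination (-(1 / 4)) * h1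

end Transmutation

/-! ### The sinc function, Parseval's identity and cardinal series. -/

theorem pi_ne_zero' : (Real.pi : ℂ) ≠ 0 := Complex.ofReal_ne_zero.2 Real.pi_ne_zero

theorem csinc_eq_sn (σ : ℂ) {x : ℝ} (hx : x ≠ 0) : csinc (σ * x / Real.pi) = sn σ x / x := by
  have hx' : (x : ℂ) ≠ 0 := Complex.ofReal_ne_zero.2 hx
  have hπ := pi_ne_zero'
  by_cases h : σ = 0
  · simp [csinc, sn, h, hx']
  · have h1 : σ * x / Real.pi ≠ 0 := div_ne_zero (mul_ne_zero h hx') hπ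
    have h2 : Real.pi * (σ * x / Real.pi) = σ * x := by field_simp
    simp only [csinc, sn, h, h1, if_false, h2]
    field_simp

theorem csinc_intCast (m : ℤ) : csinc m = if m = 0 then 1 else 0 := by
  by_cases h : m = 0
  · simp [csinc, h]
  · have h1 : (m : ℂ) ≠ 0 := Int.cast_ne_zero.2 h
    simp only [csinc, h, h1, if_false]
    rw [mul_comm, Complex.sin_int_mul_pi, zero_div]

theorem csinc_neg (z : ℂ) : csinc (-z) = csinc z := by
  by_cases h : z = 0
  · simp [h]
  · simp [csinc, h]

theorem differentiable_csinc : Differentiable ℂ csinc := by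
  have h : csinc = dslope (fun z => Complex.sin (Real.pi * z) / Real.pi) 0 := by
    funext z
    by_cases hz : z = 0
    · subst hz
      rw [dslope_same]
      have h1 : HasDerivAt (fun z : ℂ => (Real.pi : ℂ) * z) Real.pi 0 := by
        simpa using (hasDerivAt_id (0 : ℂ)).const_mul (Real.pi : ℂ)
      have h2 := (h1.csin.div_const (Real.pi : ℂ)).deriv
      rw [h2]
      simp [csinc]
    · rw [dslope_of_ne _ hz, slope_def_field]
      simp only [csinc, hz, if_false, mul_zero, Complex.sin_zero, zero_div, sub_zero]
      rw [div_div]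
  rw [h, ← differentiableOn_univ, Complex.differentiableOn_dslope univ_mem]
  exact Differentiable.differentiableOn (by fun_prop)

/-- The m-th character on (-x, x) lowers each frequency by mπ/x, and the mean of the resulting
exponential is a sinc. -/
theorem fourierCoeffOn_expSum {x : ℝ} (hx : 0 < x) (s : Finset ℂ) (c : ℂ → ℂ) (m : ℤ) :
    fourierCoeffOn (neg_lt_self hx) (expSum s c) m =
      ∑ ρ ∈ s, c ρ * csinc (ρ * x / Real.pi - m) := by
  have hx' : (x : ℂ) ≠ 0 := Complex.ofReal_ne_zero.2 hx.ne'
  have hπ := pi_ne_zero'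
  rw [fourierCoeffOn_eq_integral]
  have h1 : ∀ t : ℝ, (fourier (-m) : C(AddCircle (x - -x), ℂ)) t • expSum s c t =
      ∑ ρ ∈ s, c ρ * Complex.exp (Complex.I * (ρ - m * Real.pi / x) * t) := by
    intro t
    rw [fourier_coe_apply, smul_eq_mul, expSum, Finset.mul_sum]
    refine Finset.sum_congr rfl fun ρ _ => ?_
    rw [mul_left_comm, ← Complex.exp_add]
    congr 2
    push_cast
    field_simp
    ring
  simp only [h1]
  rw [intervalIntegral.integral_finsetSum fun ρ _ =>
    (by fun_prop : Continuous fun t : ℝ => c ρ * Complex.exp (Complex.I *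
      (ρ - m * Real.pi / x) * t)).intervalIntegrable _ _, Finset.smul_sum]
  refine Finset.sum_congr rfl fun ρ _ => ?_
  have h2 : ρ * x / Real.pi - m = (ρ - m * Real.pi / x) * x / Real.pi := by field_simp
  rw [intervalIntegral.integral_const_mul, h2, csinc_eq_sn _ hx.ne', sn_eq_integral_exp,
    Complex.real_smul]
  push_cast
  field_simp
  ring

theorem hasSum_sq_expSum {x : ℝ} (hx : 0 < x) (s : Finset ℂ) (c : ℂ → ℂ) :
    HasSum (fun m : ℤ => ‖∑ ρ ∈ s, c ρ * csinc (ρ * x / Real.pi - m)‖ ^ 2)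
      ((2 * x)⁻¹ * ∫ t in (-x)..x, ‖expSum s c t‖ ^ 2) := by
  have := hasSum_sq_fourierCoeffOn (neg_lt_self hx)
    (Continuous.memLp_two_Ioc (continuous_expSum s c) _ _)
  simp only [fourierCoeffOn_expSum hx, smul_eq_mul] at this
  rwa [show x - -x = 2 * x by ring] at this

/-- The sequence of the Fourier coefficients of `t ↦ exp (i ρ t)` on `(-x, x)`. -/
noncomputable def sincSeq {x : ℝ} (hx : 0 < x) (ρ : ℂ) : lp (fun _ : ℤ => ℂ) 2 :=
  ⟨fun m => csinc (ρ * x / Real.pi - m), memℓp_gen <| by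
    simpa using (hasSum_sq_expSum hx {ρ} fun _ => 1).summable⟩

theorem sincSeq_apply {x : ℝ} (hx : 0 < x) (ρ : ℂ) (m : ℤ) :
    sincSeq hx ρ m = csinc (ρ * x / Real.pi - m) := rfl

/-- Parseval: up to √(2x), passing from exponential sums to their coefficients is an isometry, so a
`PW` bound becomes a bound in ℓ². -/
theorem norm_sum_sincSeq {x : ℝ} (hx : 0 < x) (s : Finset ℂ) (c : ℂ → ℂ) :
    ‖∑ ρ ∈ s, c ρ • sincSeq hx ρ‖ = (√(2 * x))⁻¹ * l2norm x (expSum s c) := by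
  have h1 : ‖∑ ρ ∈ s, c ρ • sincSeq hx ρ‖ ^ 2 =
      (2 * x)⁻¹ * ∫ t in (-x)..x, ‖expSum s c t‖ ^ 2 := by
    have h2 := lp.norm_rpow_eq_tsum (p := 2) (by norm_num) (∑ ρ ∈ s, c ρ • sincSeq hx ρ)
    simp only [ENNReal.toReal_ofNat, Real.rpow_ofNat] at h2
    rw [h2, ← (hasSum_sq_expSum hx s c).tsum_eq]
    refine tsum_congr fun m => ?_
    rw [lp.coeFn_sum, Finset.sum_apply]
    rfl
  rw [l2norm, ← Real.sqrt_inv, ← Real.sqrt_mul (by positivity), ← h1,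
    Real.sqrt_sq (norm_nonneg _)]

/-- A linear functional dominated by `‖A v‖` is represented by an inner product with `A v`. -/
theorem exists_inner_of_bound {V E : Type*} [AddCommGroup V] [Module ℂ V] [NormedAddCommGroup E]
    [InnerProductSpace ℂ E] [CompleteSpace E] (A : V →ₗ[ℂ] E) (l : V →ₗ[ℂ] ℂ) (K : ℝ)
    (h : ∀ v, ‖l v‖ ≤ K * ‖A v‖) : ∃ g : E, ∀ v, l v = inner ℂ g (A v) := by
  -- Domination makes the functional factor through the range of `A`. The range need not be closed,
  -- so Hahn–Banach extends it to all of `E` before Riesz is applied.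
  have hker : LinearMap.ker A ≤ LinearMap.ker l := fun v hv => by
    have := h v
    rw [LinearMap.mem_ker.1 hv, norm_zero, mul_zero] at this
    exact LinearMap.mem_ker.2 (norm_le_zero_iff.1 this)
  let l₀ : LinearMap.range A →ₗ[ℂ] ℂ :=
    ((LinearMap.ker A).liftQ l hker).comp A.quotKerEquivRange.symm.toLinearMap
  have hl₀ : ∀ v, l₀ ⟨A v, v, rfl⟩ = l v := fun v => by
    have h1 : A.quotKerEquivRange.symm ⟨A v, v, rfl⟩ = (LinearMap.ker A).mkQ v := by
      rw [LinearEquiv.symm_apply_eq]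
      exact Subtype.ext (LinearMap.quotKerEquivRange_apply_mk A v).symm
    simp only [l₀, LinearMap.comp_apply, LinearEquiv.coe_coe, h1]
    exact Submodule.liftQ_apply _ _ _
  have hb : ∀ w, ‖l₀ w‖ ≤ K * ‖w‖ := by
    rintro ⟨_, v, rfl⟩
    rw [hl₀]
    exact h v
  obtain ⟨F, hF, -⟩ := exists_extension_norm_eq _ (l₀.mkContinuous K hb)
  refine ⟨(InnerProductSpace.toDual ℂ E).symm F, fun v => ?_⟩
  rw [InnerProductSpace.toDual_symm_apply, ← hl₀ v]
  exact (hF ⟨A v, v, rfl⟩).symm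

/-- Recovers the density, in the form of its Fourier coefficients: the dual inequality says that the
functional sending a finite combination of frequencies to the same combination of values of `f` is
dominated by an ℓ² norm. -/
theorem PW.exists_inner {x M : ℝ} (hx : 0 < x) {f : ℂ → ℂ} (hf : PW x M f) :
    ∃ g : lp (fun _ : ℤ => ℂ) 2, ∀ ρ, f ρ = inner ℂ g (sincSeq hx ρ) := by
  obtain ⟨g, hg⟩ := exists_inner_of_bound (Finsupp.linearCombination ℂ (sincSeq hx))
    (Finsupp.linearCombination ℂ f) (M * √(2 * x)) fun v => by
      have h1 := norm_sum_sincSeq hx v.support v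
      have h2 := hf v.support v
      have h3 : 0 < √(2 * x) := by positivity
      rw [Finsupp.linearCombination_apply, Finsupp.linearCombination_apply, Finsupp.sum,
        Finsupp.sum, h1]
      simp only [smul_eq_mul]
      refine h2.trans_eq ?_
      field_simp
  refine ⟨g, fun ρ => ?_⟩
  simpa using hg (Finsupp.single ρ 1)

/-- The remainders of the cardinal series of a Paley–Wiener function tend to zero in the
Paley–Wiener norm. -/
theorem PW.sampling {x M : ℝ} (hx : 0 < x) {f : ℂ → ℂ} (hf : PW x M f) {s : ℕ → Finset ℤ}
    (hs : Tendsto s atTop atTop) :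
    ∃ η : ℕ → ℝ, (∀ N, 0 ≤ η N) ∧ Tendsto η atTop (𝓝 0) ∧ ∀ N, PW x (η N) (fun ρ =>
      f ρ - ∑ m ∈ s N, f (m * Real.pi / x) * csinc (ρ * x / Real.pi - m)) := by
  have hx' : (x : ℂ) ≠ 0 := Complex.ofReal_ne_zero.2 hx.ne'
  have hπ := pi_ne_zero'
  obtain ⟨g, hg⟩ := hf.exists_inner hx
  -- At the m-th node all sincs but one vanish, so the coefficient sequence is the m-th unit vector
  -- and the sample is the conjugate of `g m`.
  have hnode : ∀ m : ℤ, f (m * Real.pi / x) = inner ℂ (g m) (1 : ℂ) := fun m => by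
    have h1 : sincSeq hx (m * Real.pi / x) = lp.single 2 m (1 : ℂ) := by
      ext k
      rw [sincSeq_apply, lp.single_apply,
        show (m * Real.pi / x * x / Real.pi - k : ℂ) = ((m - k : ℤ) : ℂ) by
          push_cast; field_simp, csinc_intCast]
      by_cases h : k = m
      · subst h; simp
      · rw [if_neg (fun h' => h (by omega)), Pi.single_eq_of_ne h]
    rw [hg, h1, lp.inner_single_right]
  set P : ℕ → lp (fun _ : ℤ => ℂ) 2 := fun N => ∑ m ∈ s N, lp.single 2 m (g m) with hP
  have hlim : Tendsto (fun N => ‖g - P N‖) atTop (𝓝 0) := by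
    have h1 := (lp.hasSum_single (p := 2) (by norm_num) g).comp hs
    simpa using ((tendsto_const_nhds (x := g)).sub h1).norm
  refine ⟨fun N => ‖g - P N‖ * (√(2 * x))⁻¹, fun N => by positivity, by
    simpa using hlim.mul_const (√(2 * x))⁻¹, fun N S c => ?_⟩
  -- Truncating the cardinal series truncates `g`; the remainder is represented by the tail of an ℓ²
  -- vector.
  have h1 : ∀ ρ, f ρ - ∑ m ∈ s N, f (m * Real.pi / x) * csinc (ρ * x / Real.pi - m) =
      inner ℂ (g - P N) (sincSeq hx ρ) := fun ρ => by
    rw [inner_sub_left, hP, sum_inner, hg ρ]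
    congr 1
    refine Finset.sum_congr rfl fun m _ => ?_
    rw [lp.inner_single_left, hnode, sincSeq_apply]
    simp [mul_comm]
  have h2 : ∑ ρ ∈ S, c ρ * (f ρ - ∑ m ∈ s N, f (m * Real.pi / x) *
      csinc (ρ * x / Real.pi - m)) = inner ℂ (g - P N) (∑ ρ ∈ S, c ρ • sincSeq hx ρ) := by
    rw [inner_sum]
    exact Finset.sum_congr rfl fun ρ _ => by rw [h1, inner_smul_right]
  rw [h2, mul_assoc, ← norm_sum_sincSeq hx]
  exact norm_inner_le_norm _ _

/-- A real shift multiplies the test sum by exp(iat), of modulus one. -/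
theorem PW.comp_add_real {x M : ℝ} {f : ℂ → ℂ} (hf : PW x M f) (a : ℝ) :
    PW x M (fun ρ => f (ρ + a)) := fun s c => by
  have h := hf (s.map (addRightEmbedding (a : ℂ))) (fun ρ => c (ρ - a))
  simp only [Finset.sum_map, addRightEmbedding_apply, add_sub_cancel_right] at h
  refine h.trans_eq ?_
  have h1 : ∀ t, expSum (s.map (addRightEmbedding (a : ℂ))) (fun ρ => c (ρ - a)) t =
      Complex.exp ((a * t : ℝ) * Complex.I) * expSum s c t := fun t => by
    simp only [expSum, Finset.sum_map, addRightEmbedding_apply, add_sub_cancel_right,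
      Finset.mul_sum]
    refine Finset.sum_congr rfl fun ρ _ => ?_
    rw [mul_left_comm, ← Complex.exp_add]
    congr 2
    push_cast
    ring
  simp only [l2norm, h1, norm_mul, Complex.norm_exp_ofReal_mul_I, one_mul]

theorem tendsto_atTop_finset_int {s : ℕ → Finset ℤ} (hs : Monotone s)
    (h : ∀ m : ℤ, m ∈ s (m.natAbs + 1)) : Tendsto s atTop atTop :=
  hs.tendsto_atTop_finset fun m => ⟨_, h m⟩

/-- The reflection m ↦ -(m+1) is the one under which the half-integers m + 1/2 change sign. -/
theorem sum_Ico_neg (F : ℤ → ℂ) (N : ℕ) :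
    ∑ m ∈ Finset.Ico (-(N : ℤ)) N, F m =
      ∑ n ∈ Finset.range N, (F n + F (-(n + 1 : ℤ))) := by
  induction N with
  | zero => simp
  | succ N ih =>
    have h1 : Finset.Ico (-((N + 1 : ℕ) : ℤ)) ((N + 1 : ℕ) : ℤ) =
        insert (N : ℤ) (insert (-(N + 1 : ℤ)) (Finset.Ico (-(N : ℤ)) N)) := by
      ext m
      simp only [Finset.mem_insert, Finset.mem_Ico]
      omega
    rw [h1, Finset.sum_insert (by simp only [Finset.mem_insert, Finset.mem_Ico]; omega),
      Finset.sum_insert (by simp only [Finset.mem_Ico]; omega), ih, Finset.sum_range_succ]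
    ring

theorem sum_Ioo_neg (F : ℤ → ℂ) (N : ℕ) :
    ∑ m ∈ Finset.Ioo (-(N : ℤ)) N, F m =
      ∑ n ∈ Finset.range N, if n = 0 then F 0 else F n + F (-(n : ℤ)) := by
  induction N with
  | zero => simp
  | succ N ih =>
    rw [Finset.sum_range_succ, ← ih]
    by_cases hN : N = 0
    · subst hN
      have h1 : Finset.Ioo (-((0 + 1 : ℕ) : ℤ)) ((0 + 1 : ℕ) : ℤ) = {0} := by decide
      rw [h1]
      simp
    have h1 : Finset.Ioo (-((N + 1 : ℕ) : ℤ)) ((N + 1 : ℕ) : ℤ) =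
        insert (N : ℤ) (insert (-(N : ℤ)) (Finset.Ioo (-(N : ℤ)) N)) := by
      ext m
      simp only [Finset.mem_insert, Finset.mem_Ioo]
      omega
    rw [h1, Finset.sum_insert (by simp only [Finset.mem_insert, Finset.mem_Ioo]; omega),
      Finset.sum_insert (by simp only [Finset.mem_Ioo]; omega), if_neg hN]
    ring

/-- The nodes ±nπ/x are folded together. At n = 0 the sum of two sincs counts the same node twice,
whence the coefficient f(0)/2. -/
theorem PW.even_sampling {x M : ℝ} (hx : 0 < x) {f : ℂ → ℂ} (hf : PW x M f)
    (heven : ∀ ρ, f (-ρ) = f ρ) :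
    ∃ η : ℕ → ℝ, (∀ N, 0 ≤ η N) ∧ Tendsto η atTop (𝓝 0) ∧ ∀ N, PW x (η N) (fun ρ =>
      f ρ - ∑ n ∈ Finset.range N,
        (if n = 0 then f 0 / 2 else f (intNode n x)) * intSincSum n ρ x) := by
  obtain ⟨η, h0, h1, h2⟩ := hf.sampling hx (s := fun N => Finset.Ioo (-(N : ℤ)) N)
    (tendsto_atTop_finset_int (fun a b hab => Finset.Ioo_subset_Ioo (by simpa using hab)
      (by simpa using hab)) fun m => by simp only [Finset.mem_Ioo]; omega)
  refine ⟨η, h0, h1, fun N => (h2 N).congr fun ρ => ?_⟩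
  rw [sum_Ioo_neg]
  congr 1
  refine Finset.sum_congr rfl fun n _ => ?_
  by_cases hn : n = 0
  · subst hn
    simp only [if_true, intSincSum, Nat.cast_zero, sub_zero, add_zero, Int.cast_zero, zero_mul,
      zero_div]
    ring
  · have h3 : ((-(n : ℤ) : ℤ) : ℂ) * Real.pi / x = -(n * Real.pi / x) := by push_cast; ring
    simp only [hn, if_false, h3, heven, intSincSum, intNode]
    push_cast
    rw [sub_neg_eq_add]
    ring

/-- The function of the cardinal series with half-integer nodes for an odd function. -/
noncomputable def halfSincDiff (n : ℕ) (ρ : ℂ) (x : ℝ) : ℂ :=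
  csinc (ρ * x / Real.pi - n - 1 / 2) - csinc (ρ * x / Real.pi + n + 1 / 2)

/-- Shifting by π/(2x), sampling at the integer nodes and shifting back gives the half-integer
nodes; oddness turns each symmetric pair into a difference of sincs. -/
theorem PW.odd_sampling {x M : ℝ} (hx : 0 < x) {f : ℂ → ℂ} (hf : PW x M f)
    (hodd : ∀ ρ, f (-ρ) = -f ρ) :
    ∃ η : ℕ → ℝ, (∀ N, 0 ≤ η N) ∧ Tendsto η atTop (𝓝 0) ∧ ∀ N, PW x (η N) (fun ρ =>
      f ρ - ∑ n ∈ Finset.range N, f (oddNode n x) * halfSincDiff n ρ x) := by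
  have hx' : (x : ℂ) ≠ 0 := Complex.ofReal_ne_zero.2 hx.ne'
  have hπ := pi_ne_zero'
  obtain ⟨η, h0, h1, h2⟩ := (hf.comp_add_real (Real.pi / (2 * x))).sampling hx
    (s := fun N => Finset.Ico (-(N : ℤ)) N)
    (tendsto_atTop_finset_int (fun a b hab => Finset.Ico_subset_Ico (by simpa using hab)
      (by simpa using hab)) fun m => by simp only [Finset.mem_Ico]; omega)
  refine ⟨η, h0, h1, fun N => ((h2 N).comp_add_real (-(Real.pi / (2 * x)))).congr fun ρ => ?_⟩
  rw [sum_Ico_neg]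
  have e1 : (ρ + ((-(Real.pi / (2 * x)) : ℝ) : ℂ)) + ((Real.pi / (2 * x) : ℝ) : ℂ) = ρ := by
    push_cast; ring
  rw [e1]
  congr 1
  refine Finset.sum_congr rfl fun n _ => ?_
  have e2 : ((n : ℤ) : ℂ) * Real.pi / x + ((Real.pi / (2 * x) : ℝ) : ℂ) = oddNode n x := by
    rw [oddNode]; push_cast; field_simp
  have e3 : ((-(n + 1 : ℤ) : ℤ) : ℂ) * Real.pi / x + ((Real.pi / (2 * x) : ℝ) : ℂ) =
      -oddNode n x := by
    rw [oddNode]; push_cast; field_simp; ring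
  have e4 : (ρ + ((-(Real.pi / (2 * x)) : ℝ) : ℂ)) * x / Real.pi - ((n : ℤ) : ℂ) =
      ρ * x / Real.pi - n - 1 / 2 := by
    push_cast; field_simp; ring
  have e5 : (ρ + ((-(Real.pi / (2 * x)) : ℝ) : ℂ)) * x / Real.pi - ((-(n + 1 : ℤ) : ℤ) : ℂ) =
      ρ * x / Real.pi + n + 1 / 2 := by
    push_cast; field_simp; ring
  rw [e2, e3, e4, e5, hodd, halfSincDiff]
  ring

/-! ### Pointwise estimates in strips and near the origin. -/

theorem expSum_singleton (ρ a : ℂ) (t : ℝ) :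
    expSum {ρ} (fun _ => a) t = a * Complex.exp (Complex.I * ρ * t) := by
  simp [expSum]

theorem norm_exp_I_mul (ρ : ℂ) (t : ℝ) :
    ‖Complex.exp (Complex.I * ρ * t)‖ = Real.exp (-ρ.im * t) := by
  rw [Complex.norm_exp]
  simp

/-- On a symmetric interval the exponential may be replaced by cosh, which increases with |β|. -/
theorem integral_exp_le {x C β : ℝ} (hx : 0 < x) (hβ : |β| ≤ C) :
    ∫ t in (-x)..x, Real.exp (2 * β * t) ≤ ∫ t in (-x)..x, Real.cosh (2 * C * t) := by
  have h1 : ∀ b : ℝ, Continuous fun t => Real.exp (2 * b * t) := fun b => by fun_prop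
  have h2 := intervalIntegral.integral_comp_neg (a := -x) (b := x)
    (fun t => Real.exp (2 * β * t))
  rw [neg_neg] at h2
  have h3 : ∫ t in (-x)..x, Real.cosh (2 * β * t) = ∫ t in (-x)..x, Real.exp (2 * β * t) := by
    have h4 : ∀ t, Real.cosh (2 * β * t) =
        1 / 2 * (Real.exp (2 * β * t) + Real.exp (2 * β * -t)) := fun t => by
      rw [Real.cosh_eq, mul_neg]; ring
    simp only [h4]
    rw [intervalIntegral.integral_const_mul, intervalIntegral.integral_add
      ((h1 β).intervalIntegrable _ _)
      (Continuous.intervalIntegrable (by fun_prop) _ _), h2]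
    ring
  rw [← h3]
  refine intervalIntegral.integral_mono_on (by linarith)
    (Continuous.intervalIntegrable (Real.continuous_cosh.comp (by fun_prop)) _ _)
    (Continuous.intervalIntegrable (Real.continuous_cosh.comp (by fun_prop)) _ _) fun t _ => ?_
  rw [Real.cosh_le_cosh, abs_mul, abs_mul, abs_mul, abs_mul]
  have : |β| ≤ |C| := hβ.trans (le_abs_self C)
  gcongr

theorem integral_cosh_eq {x C : ℝ} (hx : 0 < x) (hC : 0 ≤ C) :
    √(∫ t in (-x)..x, Real.cosh (2 * C * t)) = stripFactor C x := by
  rcases hC.eq_or_lt with rfl | hC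
  · simp only [stripFactor, if_true, mul_zero, zero_mul, Real.cosh_zero,
      intervalIntegral.integral_const, smul_eq_mul, mul_one]
    congr 1
    ring
  · rw [stripFactor, if_neg hC.ne']
    congr 1
    have h : ∀ t ∈ uIcc (-x) x, HasDerivAt (fun t => Real.sinh (2 * C * t) / (2 * C))
        (Real.cosh (2 * C * t)) t := fun t _ => by
      have h1 : HasDerivAt (fun t => 2 * C * t) (2 * C) t := by
        simpa using (hasDerivAt_id t).const_mul (2 * C)
      have h2 := h1.sinh.div_const (2 * C)
      rwa [mul_div_assoc, div_self (by positivity), mul_one] at h2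
    rw [intervalIntegral.integral_eq_sub_of_hasDerivAt h
      (Continuous.intervalIntegrable (Real.continuous_cosh.comp (by fun_prop)) _ _),
      mul_neg, Real.sinh_neg]
    field_simp
    ring

/-- The dual inequality is tested on the single frequency `ρ`. -/
theorem PW.norm_le_stripFactor {x η C : ℝ} (hx : 0 < x) (hη : 0 ≤ η) {f : ℂ → ℂ} (hf : PW x η f)
    (hC : 0 ≤ C) {ρ : ℂ} (hρ : |ρ.im| ≤ C) : ‖f ρ‖ ≤ η * stripFactor C x := by
  have h := hf {ρ} (fun _ => 1)
  rw [Finset.sum_singleton, one_mul] at h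
  refine h.trans (mul_le_mul_of_nonneg_left ?_ hη)
  rw [← integral_cosh_eq hx hC, l2norm]
  refine Real.sqrt_le_sqrt ?_
  have h1 : ∀ t : ℝ, ‖expSum {ρ} (fun _ => 1) t‖ ^ 2 = Real.exp (2 * (-ρ.im) * t) := fun t => by
    rw [expSum_singleton, one_mul, norm_exp_I_mul, ← Real.exp_nat_mul]
    congr 1
    push_cast
    ring
  simp only [h1]
  exact integral_exp_le hx (by rwa [abs_neg])

theorem norm_cos_le (ρ : ℂ) (t : ℝ) : ‖Complex.cos (ρ * t)‖ ≤ Real.exp (|ρ.im| * |t|) := by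
  rw [cos_eq_exp]
  have h1 : ‖Complex.exp (Complex.I * ρ * t)‖ ≤ Real.exp (|ρ.im| * |t|) := by
    rw [norm_exp_I_mul, Real.exp_le_exp, ← abs_mul, neg_mul]
    exact neg_le_abs _
  have h2 : ‖Complex.exp (Complex.I * ρ * (-t : ℝ))‖ ≤ Real.exp (|ρ.im| * |t|) := by
    rw [norm_exp_I_mul, Real.exp_le_exp, ← abs_mul, neg_mul_neg]
    exact le_abs_self _
  refine (norm_add_le _ _).trans ?_
  have h3 : ‖(1 / 2 : ℂ)‖ = 1 / 2 := by norm_num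
  rw [norm_mul, norm_mul, h3]
  linarith

theorem norm_sn_le {C x : ℝ} {ρ : ℂ} (hρ : |ρ.im| ≤ C) {t : ℝ} (ht : |t| ≤ x) :
    ‖sn ρ t‖ ≤ Real.exp (C * x) * x := by
  rw [← integral_cos_eq_sn]
  have h := intervalIntegral.norm_integral_le_of_norm_le_const (a := 0) (b := t)
    (f := fun τ : ℝ => Complex.cos (ρ * τ)) (C := Real.exp (C * x)) fun τ hτ => ?_
  · refine h.trans (mul_le_mul_of_nonneg_left (by simpa using ht) (Real.exp_pos _).le)
  · refine (norm_cos_le ρ τ).trans (Real.exp_le_exp.2 ?_)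
    have h1 : |τ| ≤ |t| := by
      rcases le_total 0 t with h0 | h0
      · rw [uIoc_of_le h0] at hτ
        rw [abs_of_pos hτ.1, abs_of_nonneg h0]; exact hτ.2
      · rw [uIoc_of_ge h0] at hτ
        rw [abs_of_nonpos hτ.2, abs_of_nonpos h0]; linarith [hτ.1]
    exact mul_le_mul hρ (h1.trans ht) (abs_nonneg _) ((abs_nonneg _).trans hρ)

/-- An odd Paley–Wiener function divided by `ρ` is bounded in a strip, up to the origin. -/
theorem PW.norm_div_le {x η C : ℝ} (hx : 0 < x) (hη : 0 ≤ η) {f : ℂ → ℂ} (hf : PW x η f)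
    (hodd : ∀ ρ, f (-ρ) = -f ρ) {ρ : ℂ} (h0 : ρ ≠ 0) (hρ : |ρ.im| ≤ C) :
    ‖f ρ / ρ‖ ≤ η * (√(2 * x) * (Real.exp (C * x) * x)) := by
  have hne : ρ ≠ -ρ := fun h => h0 (self_eq_neg.1 h)
  -- These weights give f(ρ)/ρ on the left by oddness, while the test sum becomes i sin(ρt)/ρ, which
  -- stays bounded as ρ → 0.
  have h := hf {ρ, -ρ} (fun τ => 1 / (2 * τ))
  rw [Finset.sum_pair hne, hodd] at h
  have h1 : 1 / (2 * ρ) * f ρ + 1 / (2 * -ρ) * -f ρ = f ρ / ρ := by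
    field_simp; ring
  rw [h1] at h
  refine h.trans (mul_le_mul_of_nonneg_left ?_ hη)
  have h2 : ∀ t, expSum {ρ, -ρ} (fun τ => 1 / (2 * τ)) t = Complex.I * sn ρ t := fun t => by
    have h3 := sin_eq_exp ρ t
    rw [expSum, Finset.sum_pair hne, sn, if_neg h0, h3,
      show Complex.I * -ρ * (t : ℂ) = Complex.I * ρ * ((-t : ℝ) : ℂ) by push_cast; ring]
    generalize Complex.exp (Complex.I * ρ * ((-t : ℝ) : ℂ)) = E₂
    generalize Complex.exp (Complex.I * ρ * t) = E₁
    field_simp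
    linear_combination (E₁ - E₂) * Complex.I_sq
  simp only [l2norm, h2, norm_mul, Complex.norm_I, one_mul]
  have h4 : ∫ t in (-x)..x, ‖sn ρ t‖ ^ 2 ≤ ∫ _ in (-x)..x, (Real.exp (C * x) * x) ^ 2 := by
    refine intervalIntegral.integral_mono_on (by linarith)
      (Continuous.intervalIntegrable ((continuous_sn ρ).norm.pow 2) _ _)
      (by simp) fun t ht => ?_
    have := norm_sn_le hρ (abs_le.2 ht)
    gcongr
  refine (Real.sqrt_le_sqrt h4).trans_eq ?_
  rw [intervalIntegral.integral_const, smul_eq_mul, show x - -x = 2 * x by ring,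
    Real.sqrt_mul (by positivity), Real.sqrt_sq (by positivity)]

/-- Tested on the pair ρ, 0 with weights 1 and -1, the inequality bounds f(ρ) - f(0) by the norm of
exp(iρt) - 1. -/
theorem PW.continuousAt_zero {x M : ℝ} (hM : 0 ≤ M) {f : ℂ → ℂ} (hf : PW x M f) :
    ContinuousAt f 0 := by
  have h1 : Tendsto (fun ρ : ℂ => M * l2norm x (fun t => Complex.exp (Complex.I * ρ * t) - 1))
      (𝓝 0) (𝓝 0) := by
    have h2 : Continuous fun ρ : ℂ =>
        M * l2norm x (fun t => Complex.exp (Complex.I * ρ * t) - 1) := by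
      refine continuous_const.mul (Real.continuous_sqrt.comp ?_)
      exact intervalIntegral.continuous_parametric_intervalIntegral_of_continuous'
        (by fun_prop) _ _
    have h3 := h2.tendsto 0
    simpa [l2norm] using h3
  refine tendsto_iff_norm_sub_tendsto_zero.2 (squeeze_zero (fun _ => norm_nonneg _) (fun ρ => ?_)
    h1)
  by_cases h0 : ρ = 0
  · simp only [h0, sub_self, norm_zero]
    exact mul_nonneg hM (l2norm_nonneg _ _)
  · have h := hf {ρ, 0} (fun τ => if τ = 0 then -1 else 1)
    rw [Finset.sum_pair h0] at h
    simp only [h0, if_false, if_true, one_mul, neg_one_mul, ← sub_eq_add_neg] at h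
    have h2 : expSum {ρ, 0} (fun τ => if τ = 0 then -1 else 1) =
        fun t : ℝ => Complex.exp (Complex.I * ρ * t) - 1 := funext fun t => by
      rw [expSum, Finset.sum_pair h0]
      simp [h0, sub_eq_add_neg]
    rwa [h2] at h

/-! ### Cancellation of 1/sin ρx, values at the nodes, and the Bessel term. -/

theorem eventually_sin_ne_zero {x : ℝ} (hx : x ≠ 0) (ρ₀ : ℂ) :
    ∀ᶠ ρ in 𝓝[≠] ρ₀, Complex.sin (ρ * x) ≠ 0 := by
  have h1 : HasDerivAt (fun ρ : ℂ => Complex.sin (ρ * x)) (Complex.cos (ρ₀ * x) * x) ρ₀ := by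
    have : HasDerivAt (fun ρ : ℂ => ρ * x) (x : ℂ) ρ₀ := by
      simpa using (hasDerivAt_id ρ₀).mul_const (x : ℂ)
    exact this.csin
  by_cases h : Complex.sin (ρ₀ * x) = 0
  · refine h1.eventually_ne (mul_ne_zero (fun hc => ?_) (Complex.ofReal_ne_zero.2 hx))
    have := Complex.sin_sq_add_cos_sq (ρ₀ * x)
    simp [h, hc] at this
  · exact (h1.continuousAt.eventually_ne h).filter_mono nhdsWithin_le_nhds

theorem csinc_two_mul (z : ℂ) : csinc (2 * z) = Complex.cos (Real.pi * z) * csinc z := by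
  by_cases h : z = 0
  · simp [csinc, h]
  · have hπ := pi_ne_zero'
    simp only [csinc, h, mul_eq_zero, two_ne_zero, or_self, if_false]
    rw [show (Real.pi : ℂ) * (2 * z) = 2 * (Real.pi * z) by ring, Complex.sin_two_mul]
    field_simp

theorem cos_nat_mul_pi (n : ℕ) : Complex.cos (n * Real.pi) = (-1) ^ n := by
  exact_mod_cast congrArg Complex.ofReal (Real.cos_nat_mul_pi n)

/-- By sinc 2z = cos πz · sinc z with z = ρx/π ∓ (n + 1/2), where the cosine equals ±(-1)ⁿ sin ρx.
This is the factor that cancels the denominator. -/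
theorem oddSincSum_eq {x : ℝ} (n : ℕ) (ρ : ℂ) :
    oddSincSum n ρ x = (-1) ^ n * Complex.sin (ρ * x) * halfSincDiff n ρ x := by
  have hπ := pi_ne_zero'
  have h1 : 2 * ρ * x / Real.pi - 2 * n - 1 = 2 * (ρ * x / Real.pi - n - 1 / 2) := by ring
  have h2 : 2 * ρ * x / Real.pi + 2 * n + 1 = 2 * (ρ * x / Real.pi + n + 1 / 2) := by ring
  have h3 : Complex.cos (Real.pi * (ρ * x / Real.pi - n - 1 / 2)) =
      (-1) ^ n * Complex.sin (ρ * x) := by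
    rw [show (Real.pi : ℂ) * (ρ * x / Real.pi - n - 1 / 2) =
      (ρ * x - n * Real.pi) - Real.pi / 2 by field_simp, Complex.cos_sub_pi_div_two,
      Complex.sin_sub, cos_nat_mul_pi, Complex.sin_nat_mul_pi]
    ring
  have h4 : Complex.cos (Real.pi * (ρ * x / Real.pi + n + 1 / 2)) =
      -((-1) ^ n * Complex.sin (ρ * x)) := by
    rw [show (Real.pi : ℂ) * (ρ * x / Real.pi + n + 1 / 2) =
      (ρ * x + n * Real.pi) + Real.pi / 2 by field_simp, Complex.cos_add_pi_div_two,
      Complex.sin_add, cos_nat_mul_pi, Complex.sin_nat_mul_pi]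
    ring
  rw [oddSincSum, h1, h2, csinc_two_mul, csinc_two_mul, h3, h4, halfSincDiff]
  ring

theorem differentiable_halfSincDiff (n : ℕ) (x : ℝ) :
    Differentiable ℂ (fun ρ => halfSincDiff n ρ x) := by
  unfold halfSincDiff
  exact (differentiable_csinc.comp (by fun_prop)).sub (differentiable_csinc.comp (by fun_prop))

theorem eventuallyEq_oddSinc {x : ℝ} (hx : x ≠ 0) (ρ₀ : ℂ) (B a : ℂ → ℂ) (k : ℕ → ℂ) (N : ℕ) :
    (fun ρ => B ρ + a ρ / Complex.sin (ρ * x) * ∑ n ∈ Finset.range N, k n * oddSincSum n ρ x)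
      =ᶠ[𝓝[≠] ρ₀]
    fun ρ => B ρ + a ρ * ∑ n ∈ Finset.range N, (-1) ^ n * k n * halfSincDiff n ρ x := by
  filter_upwards [eventually_sin_ne_zero hx ρ₀] with ρ hρ
  have h1 : ∑ n ∈ Finset.range N, k n * oddSincSum n ρ x = Complex.sin (ρ * x) *
      ∑ n ∈ Finset.range N, (-1) ^ n * k n * halfSincDiff n ρ x := by
    rw [Finset.mul_sum]
    exact Finset.sum_congr rfl fun n _ => by rw [oddSincSum_eq]; ring
  rw [h1]
  field_simp

theorem byLimit_eq_of_eventuallyEq {f g : ℂ → ℂ} {ρ l : ℂ} (h : f =ᶠ[𝓝[≠] ρ] g)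
    (hg : Tendsto g (𝓝[≠] ρ) (𝓝 l)) : byLimit f ρ = l :=
  (hg.congr' h.symm).limUnder_eq

theorem byLimit_oddSinc {x : ℝ} (hx : x ≠ 0) {ρ₀ : ℂ} {B a : ℂ → ℂ} (hB : ContinuousAt B ρ₀)
    (ha : ContinuousAt a ρ₀) (k : ℕ → ℂ) (N : ℕ) :
    byLimit (fun ρ => B ρ + a ρ / Complex.sin (ρ * x) *
      ∑ n ∈ Finset.range N, k n * oddSincSum n ρ x) ρ₀ =
    B ρ₀ + a ρ₀ * ∑ n ∈ Finset.range N, (-1) ^ n * k n * halfSincDiff n ρ₀ x := by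
  refine byLimit_eq_of_eventuallyEq (eventuallyEq_oddSinc hx ρ₀ B a k N) ?_
  refine (hB.add (ha.mul ?_)).mono_left nhdsWithin_le_nhds
  refine tendsto_finsetSum _ fun n _ => ?_
  exact tendsto_const_nhds.mul (differentiable_halfSincDiff n x).continuous.continuousAt

theorem oddNode_mul {x : ℝ} (hx : x ≠ 0) (n : ℕ) :
    oddNode n x * x = n * Real.pi + Real.pi / 2 := by
  have : (x : ℂ) ≠ 0 := Complex.ofReal_ne_zero.2 hx
  rw [oddNode]
  field_simp

theorem sin_oddNode {x : ℝ} (hx : x ≠ 0) (n : ℕ) :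
    Complex.sin (oddNode n x * x) = (-1) ^ n := by
  rw [oddNode_mul hx, Complex.sin_add_pi_div_two, cos_nat_mul_pi]

theorem cos_oddNode {x : ℝ} (hx : x ≠ 0) (n : ℕ) : Complex.cos (oddNode n x * x) = 0 := by
  rw [oddNode_mul hx, Complex.cos_add_pi_div_two, Complex.sin_nat_mul_pi, neg_zero]

theorem intNode_mul {x : ℝ} (hx : x ≠ 0) (n : ℕ) : intNode n x * x = n * Real.pi := by
  have : (x : ℂ) ≠ 0 := Complex.ofReal_ne_zero.2 hx
  rw [intNode]
  field_simp

theorem sin_intNode {x : ℝ} (hx : x ≠ 0) (n : ℕ) : Complex.sin (intNode n x * x) = 0 := by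
  rw [intNode_mul hx, Complex.sin_nat_mul_pi]

theorem cos_intNode {x : ℝ} (hx : x ≠ 0) (n : ℕ) : Complex.cos (intNode n x * x) = (-1) ^ n := by
  rw [intNode_mul hx, cos_nat_mul_pi]

theorem csinc_intNode {x : ℝ} (hx : x ≠ 0) {n : ℕ} (hn : n ≠ 0) :
    csinc (intNode n x * x / Real.pi) = 0 := by
  rw [intNode_mul hx, mul_div_cancel_right₀ _ pi_ne_zero']
  simpa [hn] using csinc_intCast n

/-- Explains the Bessel term: it replaces cos ρx, which is not Paley–Wiener, by a sinc that differs
from zero at the node 0 only. -/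
theorem mul_sphJ1 {x : ℝ} (hx : x ≠ 0) (ρ : ℂ) :
    ρ * x * sphJ1 (ρ * x) = csinc (ρ * x / Real.pi) - Complex.cos (ρ * x) := by
  have hx' : (x : ℂ) ≠ 0 := Complex.ofReal_ne_zero.2 hx
  by_cases h : ρ = 0
  · simp [h, csinc]
  · have h1 : ρ * x ≠ 0 := mul_ne_zero h hx'
    rw [csinc_eq_sn _ hx, sn, if_neg h, sphJ1, if_neg h1]
    field_simp

theorem PW.csinc {x : ℝ} (hx : 0 < x) : PW x (x⁻¹ * √(2 * x))
    (fun ρ => csinc (ρ * x / Real.pi)) := by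
  refine (((PW.sn_mul_exp (a := x) (b := 0) hx.le hx.le (by simp)).const_mul (x : ℂ)⁻¹).congr
    fun ρ => ?_).mono ?_
  · rw [csinc_eq_sn _ hx.ne']
    simp [div_eq_inv_mul]
  · simp [abs_of_pos hx]

theorem halfSincDiff_neg (n : ℕ) (ρ : ℂ) (x : ℝ) : halfSincDiff n (-ρ) x = -halfSincDiff n ρ x := by
  rw [halfSincDiff, halfSincDiff, ← csinc_neg, ← csinc_neg (-ρ * x / Real.pi + n + 1 / 2)]
  rw [show -(-ρ * x / Real.pi - n - 1 / 2) = ρ * x / Real.pi + n + 1 / 2 by ring,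
    show -(-ρ * x / Real.pi + n + 1 / 2) = ρ * x / Real.pi - n - 1 / 2 by ring]
  ring

@[simp] theorem csinc_zero : csinc 0 = 1 := by simp [csinc]

theorem neg_one_pow_mul_self (n : ℕ) : ((-1 : ℂ) ^ n) * (-1) ^ n = 1 := by
  rw [← mul_pow]; simp

/-! ### Remainders of the six partial sums. -/

/-- Up to the factor `ρ⁻ᵏ` the differences `X - X_N` are Paley–Wiener functions with norms tending
to zero. -/
def HasRemainder (x : ℝ) (k : ℕ) (X : ℂ → ℂ) (XN : ℕ → ℂ → ℂ) : Prop :=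
  ∃ η : ℕ → ℝ, (∀ N, 0 ≤ η N) ∧ Tendsto η atTop (𝓝 0) ∧ ∃ r : ℕ → ℂ → ℂ,
    (∀ N, PW x (η N) (r N)) ∧ ∀ N, ∀ ρ : ℂ, ρ ≠ 0 → X ρ - XN N ρ = r N ρ / ρ ^ k

theorem HasRemainder.exists_bound {x : ℝ} (hx : 0 < x) {k : ℕ} {X : ℂ → ℂ} {XN : ℕ → ℂ → ℂ}
    (h : HasRemainder x k X XN) : ∃ η : ℕ → ℝ, (∀ N, 0 ≤ η N) ∧ Tendsto η atTop (𝓝 0) ∧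
      ∀ N, ∀ C : ℝ, 0 ≤ C → ∀ ρ : ℂ, ρ ≠ 0 → |ρ.im| ≤ C →
        ‖X ρ - XN N ρ‖ ≤ η N / ‖ρ‖ ^ k * stripFactor C x := by
  obtain ⟨η, h0, h1, r, hr, he⟩ := h
  refine ⟨η, h0, h1, fun N C hC ρ hρ hρC => ?_⟩
  rw [he N ρ hρ, norm_div, norm_pow, div_mul_eq_mul_div]
  exact div_le_div_of_nonneg_right ((hr N).norm_le_stripFactor hx (h0 N) hC hρC) (by positivity)

section Remainders

variable {q : ℝ → ℂ} {L x : ℝ} {h : ℂ} {S φ : ℂ → ℝ → ℂ}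

theorem two_mul_oddNode (n : ℕ) (x : ℝ) : (2 * n + 1) * Real.pi / x = 2 * oddNode n x := by
  rw [oddNode]
  by_cases hx : (x : ℂ) = 0
  · simp [hx]
  · field_simp

/-- At the odd nodes the sine is (-1)ⁿ, so the signed coefficient is twice a sample of the odd
function ρS - sin ρx; the 2 cancels the one in 1/(2ρ). -/
theorem coeffS_eq (hx : x ≠ 0) (S : ℂ → ℝ → ℂ) (n : ℕ) : (-1) ^ n * coeffS S n x =
    2 * (oddNode n x * S (oddNode n x) x - Complex.sin (oddNode n x * x)) := by
  rw [coeffS, sin_oddNode hx, mul_assoc ((-1) ^ n), mul_div_assoc, two_mul_oddNode]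
  linear_combination 2 * oddNode n x * S (oddNode n x) x * neg_one_pow_mul_self n

theorem coeffDS_eq (hx : x ≠ 0) (S : ℂ → ℝ → ℂ) (n : ℕ) : (-1) ^ n * coeffDS L q S n x =
    2 * (oddNode n x * dx L (S (oddNode n x)) x - oddNode n x * Complex.cos (oddNode n x * x)
      - omega q x * Complex.sin (oddNode n x * x)) := by
  rw [coeffDS, sin_oddNode hx, cos_oddNode hx, mul_assoc ((-1) ^ n), mul_div_assoc,
    two_mul_oddNode]
  linear_combination 2 * oddNode n x * dx L (S (oddNode n x)) x * neg_one_pow_mul_self n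

theorem coeffSNew_eq (hx : x ≠ 0) (S : ℂ → ℝ → ℂ) (n : ℕ) : (-1) ^ n * coeffSNew q S n x =
    -2 * (oddNode n x * (oddNode n x * (oddNode n x * S (oddNode n x) x
        - Complex.sin (oddNode n x * x)) - (-omega q x) * Complex.cos (oddNode n x * x))
      - qPlus q x * Complex.sin (oddNode n x * x)) := by
  have h1 : ((2 * n + 1) * Real.pi) ^ 3 / (4 * (x : ℂ) ^ 3) = 2 * oddNode n x ^ 3 := by
    rw [show ((2 * n + 1) * Real.pi) ^ 3 / (4 * (x : ℂ) ^ 3) =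
      ((2 * n + 1) * Real.pi / x) ^ 3 / 4 by rw [div_pow, div_div, mul_comm 4], two_mul_oddNode]
    ring
  rw [coeffSNew, sin_oddNode hx, cos_oddNode hx, h1, pow_succ]
  linear_combination -2 * oddNode n x ^ 3 * S (oddNode n x) x * neg_one_pow_mul_self n

theorem continuousAt_sin_div (x : ℝ) {ρ : ℂ} (hρ : ρ ≠ 0) :
    ContinuousAt (fun ρ : ℂ => Complex.sin (ρ * x) / ρ) ρ :=
  ContinuousAt.div (by fun_prop) continuousAt_id hρ

theorem partialS_eq (hx : x ≠ 0) (S : ℂ → ℝ → ℂ) (N : ℕ) {ρ : ℂ} (hρ : ρ ≠ 0) :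
    partialS S N ρ x = Complex.sin (ρ * x) / ρ + 1 / (2 * ρ) *
      ∑ n ∈ Finset.range N, (-1) ^ n * coeffS S n x * halfSincDiff n ρ x := by
  rw [← byLimit_oddSinc (B := fun ρ => Complex.sin (ρ * x) / ρ) (a := fun ρ => 1 / (2 * ρ)) hx
    (continuousAt_sin_div x hρ) (ContinuousAt.div (by fun_prop) (by fun_prop) (by simpa using hρ))]
  simp only [partialS, div_div]

theorem partialDS_eq (hx : x ≠ 0) (S : ℂ → ℝ → ℂ) (N : ℕ) {ρ : ℂ} (hρ : ρ ≠ 0) :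
    partialDS L q S N ρ x = Complex.cos (ρ * x) + omega q x / ρ * Complex.sin (ρ * x) +
      1 / (2 * ρ) *
      ∑ n ∈ Finset.range N, (-1) ^ n * coeffDS L q S n x * halfSincDiff n ρ x := by
  rw [← byLimit_oddSinc (B := fun ρ => Complex.cos (ρ * x) + omega q x / ρ * Complex.sin (ρ * x))
    (a := fun ρ => 1 / (2 * ρ)) hx ?_
    (ContinuousAt.div (by fun_prop) (by fun_prop) (by simpa using hρ))]
  · simp only [partialDS, div_div]
  · exact ContinuousAt.add (by fun_prop)
      ((continuousAt_const.div continuousAt_id hρ).mul (by fun_prop))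

theorem partialSNew_eq (hx : x ≠ 0) (S : ℂ → ℝ → ℂ) (N : ℕ) {ρ : ℂ} (hρ : ρ ≠ 0) :
    partialSNew q S N ρ x = Complex.sin (ρ * x) / ρ - Complex.cos (ρ * x) / ρ ^ 2 * omega q x +
      Complex.sin (ρ * x) / ρ ^ 3 * qPlus q x + -(1 / (2 * ρ ^ 3)) *
      ∑ n ∈ Finset.range N, (-1) ^ n * coeffSNew q S n x * halfSincDiff n ρ x := by
  rw [← byLimit_oddSinc (B := fun ρ => Complex.sin (ρ * x) / ρ
      - Complex.cos (ρ * x) / ρ ^ 2 * omega q x + Complex.sin (ρ * x) / ρ ^ 3 * qPlus q x)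
    (a := fun ρ => -(1 / (2 * ρ ^ 3))) hx ?_
    (ContinuousAt.neg (ContinuousAt.div (by fun_prop) (by fun_prop) (by simpa using hρ)))]
  · simp only [partialSNew, neg_div, div_div, neg_mul, sub_eq_add_neg]
  · refine ContinuousAt.add (ContinuousAt.sub (continuousAt_sin_div x hρ) ?_) ?_
    · exact (ContinuousAt.div (by fun_prop) (by fun_prop) (by simpa using hρ)).mul
        continuousAt_const
    · exact (ContinuousAt.div (by fun_prop) (by fun_prop) (by simpa using hρ)).mul
        continuousAt_const

theorem solution_neg {a b : ℂ} {y : ℂ → ℝ → ℂ} (hL : 0 ≤ L)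
    (hq : MemLp q 2 (volume.restrict (Ioc 0 L))) (hy : ∀ ρ : ℂ, IsSolution q L ρ a b (y ρ))
    (hx : x ∈ Icc 0 L) (ρ : ℂ) : y (-ρ) x = y ρ x :=
  ((hy ρ).eqOn hq hL (hy (-ρ)) rfl hx).symm

theorem solution_dx_neg {a b : ℂ} {y : ℂ → ℝ → ℂ} (hL : 0 ≤ L)
    (hq : MemLp q 2 (volume.restrict (Ioc 0 L))) (hy : ∀ ρ : ℂ, IsSolution q L ρ a b (y ρ))
    (hx : x ∈ Icc 0 L) (ρ : ℂ) : dx L (y (-ρ)) x = dx L (y ρ) x :=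
  ((hy ρ).dx_eqOn hq hL (hy (-ρ)) rfl hx).symm

/-- Unlike in `HasRemainder`, the oddness of `r` is recorded, because it controls r(ρ)/ρ near the
origin. -/
theorem S_remainder (hx : x ∈ Ioc 0 L) (hq : MemLp q 2 (volume.restrict (Ioc 0 L)))
    (hS : ∀ ρ : ℂ, IsSolution q L ρ 0 1 (S ρ)) :
    ∃ η : ℕ → ℝ, (∀ N, 0 ≤ η N) ∧ Tendsto η atTop (𝓝 0) ∧ ∃ r : ℕ → ℂ → ℂ,
      (∀ N, PW x (η N) (r N)) ∧ (∀ N ρ, r N (-ρ) = -r N ρ) ∧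
      ∀ N, ∀ ρ : ℂ, ρ ≠ 0 → S ρ x - partialS S N ρ x = r N ρ / ρ := by
  have hL : 0 ≤ L := hx.1.le.trans hx.2
  have hx' : x ∈ Icc 0 L := Ioc_subset_Icc_self hx
  obtain ⟨M, -, hM⟩ := (PWF.mul_S_sub_sin hL hq hS).1
  have hodd : ∀ ρ : ℂ, -ρ * S (-ρ) x - Complex.sin (-ρ * x) =
      -(ρ * S ρ x - Complex.sin (ρ * x)) := fun ρ => by
    rw [solution_neg hL hq hS hx', neg_mul, neg_mul, Complex.sin_neg]; ring
  obtain ⟨η, h0, h1, h2⟩ := (hM x hx').odd_sampling hx.1 hodd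
  refine ⟨η, h0, h1, _, h2, fun N ρ => ?_, fun N ρ hρ => ?_⟩
  · simp only [hodd, halfSincDiff_neg, mul_neg, Finset.sum_neg_distrib]
    ring
  · rw [partialS_eq hx.1.ne' S N hρ]
    simp only [coeffS_eq hx.1.ne', mul_assoc (2 : ℂ), ← Finset.mul_sum]
    field_simp
    ring

theorem dS_remainder (hx : x ∈ Ioc 0 L) (hq : MemLp q 2 (volume.restrict (Ioc 0 L)))
    (hS : ∀ ρ : ℂ, IsSolution q L ρ 0 1 (S ρ)) :
    HasRemainder x 1 (fun ρ => dx L (S ρ) x) (fun N ρ => partialDS L q S N ρ x) := by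
  have hL : 0 ≤ L := hx.1.le.trans hx.2
  have hx' : x ∈ Icc 0 L := Ioc_subset_Icc_self hx
  obtain ⟨M, -, hM⟩ := PWF.mul_dx_S hL hq hS
  obtain ⟨η, h0, h1, h2⟩ := (hM x hx').odd_sampling hx.1 fun ρ => by
    beta_reduce
    rw [solution_dx_neg hL hq hS hx', neg_mul, neg_mul, neg_mul, Complex.sin_neg,
      Complex.cos_neg]
    ring
  refine ⟨η, h0, h1, _, h2, fun N ρ hρ => ?_⟩
  beta_reduce
  rw [partialDS_eq hx.1.ne' S N hρ]
  simp only [coeffDS_eq hx.1.ne', mul_assoc (2 : ℂ), ← Finset.mul_sum]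
  field_simp
  ring

theorem sNew_remainder (hx : x ∈ Ioc 0 L) (hq : MemLp q 2 (volume.restrict (Ioc 0 L)))
    (hW : IsW21 q L) (hS : ∀ ρ : ℂ, IsSolution q L ρ 0 1 (S ρ)) :
    HasRemainder x 3 (fun ρ => S ρ x) (fun N ρ => partialSNew q S N ρ x) := by
  have hL : 0 ≤ L := hx.1.le.trans hx.2
  have hx' : x ∈ Icc 0 L := Ioc_subset_Icc_self hx
  obtain ⟨M, -, hM⟩ := PWF.S_third hL hq hW hS
  obtain ⟨η, h0, h1, h2⟩ := (hM x hx').odd_sampling hx.1 fun ρ => by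
    beta_reduce
    rw [solution_neg hL hq hS hx', neg_mul _ (x : ℂ), Complex.sin_neg, Complex.cos_neg]
    ring
  refine ⟨η, h0, h1, _, h2, fun N ρ hρ => ?_⟩
  beta_reduce
  rw [partialSNew_eq hx.1.ne' S N hρ]
  simp only [coeffSNew_eq hx.1.ne', mul_assoc (-2 : ℂ), ← Finset.mul_sum]
  field_simp
  ring

/-- The function sampled is φ - cos ρx + sinc(ρx/π): the sinc changes only the sample at 0, from
φ(0, x) - 1 to φ(0, x), and together with the cosine it is the Bessel term. -/
theorem phi_remainder (hx : x ∈ Ioc 0 L) (hq : MemLp q 2 (volume.restrict (Ioc 0 L)))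
    (hφ : ∀ ρ : ℂ, IsSolution q L ρ 1 h (φ ρ)) :
    ∃ η : ℕ → ℝ, (∀ N, 0 ≤ η N) ∧ Tendsto η atTop (𝓝 0) ∧
      ∀ N, PW x (η N) (fun ρ => φ ρ x - partialPhi φ N ρ x) := by
  have hL : 0 ≤ L := hx.1.le.trans hx.2
  have hx' : x ∈ Icc 0 L := Ioc_subset_Icc_self hx
  obtain ⟨M, -, hM⟩ := (PWF.phi_sub_cos hL hq hφ).1
  obtain ⟨η, h0, h1, h2⟩ := ((hM x hx').add (PW.csinc hx.1)).even_sampling hx.1 fun ρ => by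
    beta_reduce
    rw [solution_neg hL hq hφ hx', neg_mul, Complex.cos_neg, neg_div, csinc_neg]
  refine ⟨η, h0, h1, fun N => (h2 N).congr fun ρ => ?_⟩
  beta_reduce
  rw [partialPhi, mul_sphJ1 hx.1.ne']
  have h3 : ∀ n, coeffPhi φ n x = if n = 0 then
      (φ 0 x - Complex.cos (0 * x) + csinc (0 * x / Real.pi)) / 2 else
      φ (intNode n x) x - Complex.cos (intNode n x * x) + csinc (intNode n x * x / Real.pi) :=
    fun n => by
      by_cases hn : n = 0
      · simp [hn, coeffPhi, csinc]
      · simp only [hn, coeffPhi, if_false, cos_intNode hx.1.ne', csinc_intNode hx.1.ne' hn,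
          add_zero]
  simp only [h3]
  ring

theorem dPhi_remainder (hx : x ∈ Ioc 0 L) (hq : MemLp q 2 (volume.restrict (Ioc 0 L)))
    (hφ : ∀ ρ : ℂ, IsSolution q L ρ 1 h (φ ρ)) :
    HasRemainder x 0 (fun ρ => dx L (φ ρ) x) (fun N ρ => partialDPhi L q h φ N ρ x) := by
  have hL : 0 ≤ L := hx.1.le.trans hx.2
  have hx' : x ∈ Icc 0 L := Ioc_subset_Icc_self hx
  obtain ⟨M, -, hM⟩ := PWF.dx_phi hL hq hφ
  obtain ⟨η, h0, h1, h2⟩ := ((hM x hx').add ((PW.csinc hx.1).const_mul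
      (h + omega q x))).even_sampling hx.1 fun ρ => by
    beta_reduce
    rw [solution_dx_neg hL hq hφ hx', neg_mul _ (x : ℂ), Complex.cos_neg, Complex.sin_neg,
      neg_div, csinc_neg]
    ring
  refine ⟨η, h0, h1, _, h2, fun N ρ hρ => ?_⟩
  beta_reduce
  rw [partialDPhi, mul_sphJ1 hx.1.ne']
  have h3 : ∀ n, coeffDPhi L q h φ n x = if n = 0 then
      (dx L (φ 0) x + 0 * Complex.sin (0 * x) - (h + omega q x) * Complex.cos (0 * x)
        + (h + omega q x) * csinc (0 * x / Real.pi)) / 2 else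
      dx L (φ (intNode n x)) x + intNode n x * Complex.sin (intNode n x * x)
        - (h + omega q x) * Complex.cos (intNode n x * x)
        + (h + omega q x) * csinc (intNode n x * x / Real.pi) :=
    fun n => by
      by_cases hn : n = 0
      · simp [hn, coeffDPhi, csinc]
      · simp only [hn, coeffDPhi, if_false, cos_intNode hx.1.ne', sin_intNode hx.1.ne',
          csinc_intNode hx.1.ne' hn]
        ring
  simp only [h3]
  ring

theorem phiNew_remainder (hx : x ∈ Ioc 0 L) (hq : MemLp q 2 (volume.restrict (Ioc 0 L)))
    (hW : IsW21 q L) (hφ : ∀ ρ : ℂ, IsSolution q L ρ 1 h (φ ρ)) :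
    HasRemainder x 2 (fun ρ => φ ρ x) (fun N ρ => partialPhiNew q h φ N ρ x) := by
  have hL : 0 ≤ L := hx.1.le.trans hx.2
  have hx' : x ∈ Icc 0 L := Ioc_subset_Icc_self hx
  have hxc : (x : ℂ) ≠ 0 := Complex.ofReal_ne_zero.2 hx.1.ne'
  obtain ⟨M, -, hM⟩ := PWF.phi_third hL hq hW hφ
  obtain ⟨η, h0, h1, h2⟩ := ((hM x hx').add ((PW.csinc hx.1).const_mul
      (qh q h x))).even_sampling hx.1 fun ρ => by
    beta_reduce
    rw [solution_neg hL hq hφ hx', neg_mul _ (x : ℂ), Complex.cos_neg, Complex.sin_neg,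
      neg_div, csinc_neg]
    ring
  -- The sum over 1, …, N is the one over 0, …, N: the added sinc makes the sample at 0 equal to -qʰ
  -- + qʰ = 0. Hence the index N + 1.
  refine ⟨fun N => η (N + 1), fun N => h0 _, h1.comp (tendsto_add_atTop_nat 1), _,
    fun N => h2 (N + 1), fun N ρ hρ => ?_⟩
  beta_reduce
  have h3 : ∀ n ∈ Finset.Icc 1 N, (if n = 0 then
      (0 * (0 * (φ 0 x - Complex.cos (0 * x)) - (h + omega q x) * Complex.sin (0 * x))
        - qh q h x * Complex.cos (0 * x) + qh q h x * csinc (0 * x / Real.pi)) / 2 else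
      intNode n x * (intNode n x * (φ (intNode n x) x - Complex.cos (intNode n x * x))
        - (h + omega q x) * Complex.sin (intNode n x * x))
        - qh q h x * Complex.cos (intNode n x * x)
        + qh q h x * csinc (intNode n x * x / Real.pi)) * intSincSum n ρ x =
      -(coeffPhiNew q h φ n x * intSincSum n ρ x) := fun n hn => by
    have hn' : n ≠ 0 := by
      have := (Finset.mem_Icc.1 hn).1
      omega
    simp only [hn', coeffPhiNew, if_false, cos_intNode hx.1.ne', sin_intNode hx.1.ne',
      csinc_intNode hx.1.ne' hn']
    ring
  have h4 : Finset.range (N + 1) = insert 0 (Finset.Icc 1 N) := by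
    ext n
    simp only [Finset.mem_range, Finset.mem_insert, Finset.mem_Icc]
    omega
  have h5 : (x : ℂ) / ρ * sphJ1 (ρ * x) = (csinc (ρ * x / Real.pi) - Complex.cos (ρ * x)) /
      ρ ^ 2 := by
    rw [← mul_sphJ1 hx.1.ne']
    field_simp
  rw [h4, Finset.sum_insert (by simp), Finset.sum_congr rfl h3, Finset.sum_neg_distrib,
    partialPhiNew, h5]
  simp only [if_true, zero_mul, zero_div, csinc_zero, Complex.cos_zero, mul_one,
    zero_sub, neg_add_cancel, zero_add]
  field_simp
  ring

end Remainders

/-! ### Explicit bounds and behaviour at ρ = 0. -/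

/-- The estimate of `X - X_N` by `E N / |ρ|ᵏ` on the real line, and in strips. -/
def HasBound (x : ℝ) (k : ℕ) (X : ℂ → ℂ) (XN : ℕ → ℂ → ℂ) (E : ℕ → ℝ) : Prop :=
  ∀ N, (∀ ρ : ℝ, ρ ≠ 0 → ‖X ρ - XN N ρ‖ ≤ E N / |ρ| ^ k) ∧
    ∀ C : ℝ, 0 ≤ C → ∀ ρ : ℂ, ρ ≠ 0 → |ρ.im| ≤ C →
      ‖X ρ - XN N ρ‖ ≤ E N / ‖ρ‖ ^ k * stripFactor C x

theorem stripFactor_nonneg (C x : ℝ) : 0 ≤ stripFactor C x := by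
  unfold stripFactor
  split_ifs <;> positivity

theorem HasBound.mono {x : ℝ} {k : ℕ} {X : ℂ → ℂ} {XN : ℕ → ℂ → ℂ} {E E' : ℕ → ℝ}
    (h : HasBound x k X XN E) (hE : ∀ N, E N ≤ E' N) : HasBound x k X XN E' := fun N =>
  ⟨fun ρ hρ => ((h N).1 ρ hρ).trans (div_le_div_of_nonneg_right (hE N) (by positivity)),
    fun C hC ρ hρ hρC => ((h N).2 C hC ρ hρ hρC).trans (mul_le_mul_of_nonneg_right
      (div_le_div_of_nonneg_right (hE N) (by positivity)) (stripFactor_nonneg C x))⟩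

theorem HasRemainder.hasBound {x : ℝ} (hx : 0 < x) {k : ℕ} {X : ℂ → ℂ} {XN : ℕ → ℂ → ℂ}
    (h : HasRemainder x k X XN) :
    ∃ E : ℕ → ℝ, (∀ N, 0 < E N) ∧ Tendsto E atTop (𝓝 0) ∧ HasBound x k X XN E := by
  obtain ⟨η, h0, h1, hb⟩ := h.exists_bound hx
  have hs : 0 ≤ √(2 * x) := Real.sqrt_nonneg _
  have hpos : ∀ N : ℕ, (0 : ℝ) < 1 / ((N : ℝ) + 1) := fun N => by positivity
  -- The factor 1 + √(2x) absorbs the strip factor at C = 0, as needed on the real line, and 1/(N+1)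
  -- makes the bound strictly positive.
  refine ⟨fun N => η N * (1 + √(2 * x)) + 1 / ((N : ℝ) + 1), fun N => ?_, ?_, fun N =>
    ⟨fun ρ hρ => ?_, fun C hC ρ hρ hρC => ?_⟩⟩
  · have := hpos N
    have := h0 N
    positivity
  · simpa using (h1.mul_const (1 + √(2 * x))).add tendsto_one_div_add_atTop_nhds_zero_nat
  · have h2 := hb N 0 le_rfl ρ (Complex.ofReal_ne_zero.2 hρ) (by simp)
    refine h2.trans ?_
    rw [stripFactor, if_pos rfl, Complex.norm_real, Real.norm_eq_abs, div_mul_eq_mul_div]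
    refine div_le_div_of_nonneg_right ?_ (by positivity)
    nlinarith [h0 N, hpos N]
  · refine (hb N C hC ρ hρ hρC).trans (mul_le_mul_of_nonneg_right
      (div_le_div_of_nonneg_right ?_ (by positivity)) (stripFactor_nonneg C x))
    nlinarith [h0 N, hpos N, mul_nonneg (h0 N) hs]

/-- Away from 0 the partial sum is F(ρ)/ρ with F differentiable at 0 and, by oddness of its terms,
F(0) = 0. So it is a difference quotient and tends to F'(0). -/
theorem tendsto_partialS_zero {x : ℝ} (hx : x ≠ 0) (S : ℂ → ℝ → ℂ) (N : ℕ) :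
    Tendsto (fun ρ => partialS S N ρ x) (𝓝[≠] 0) (𝓝 (partialS S N 0 x)) := by
  set F : ℂ → ℂ := fun ρ => Complex.sin (ρ * x) + 1 / 2 *
    ∑ n ∈ Finset.range N, (-1) ^ n * coeffS S n x * halfSincDiff n ρ x with hF
  have hd : DifferentiableAt ℂ F 0 := by
    refine DifferentiableAt.add (by fun_prop) (DifferentiableAt.const_mul ?_ _)
    exact DifferentiableAt.fun_sum fun n _ => (differentiable_halfSincDiff n x 0).const_mul _
  have hF0 : F 0 = 0 := by
    have h0 : ∀ n, halfSincDiff n 0 x = 0 := fun n => by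
      have := halfSincDiff_neg n 0 x
      rw [neg_zero] at this
      exact self_eq_neg.1 this
    simp [hF, h0]
  have h1 : Tendsto (fun ρ => F ρ / ρ) (𝓝[≠] 0) (𝓝 (deriv F 0)) := by
    refine hd.hasDerivAt.tendsto_slope.congr fun ρ => ?_
    rw [slope_def_field, hF0, sub_zero, sub_zero]
  have h2 : (fun ρ => F ρ / ρ) = fun ρ => Complex.sin (ρ * x) / ρ + 1 / (2 * ρ) *
      ∑ n ∈ Finset.range N, (-1) ^ n * coeffS S n x * halfSincDiff n ρ x := by
    funext ρ
    rw [hF, add_div, mul_div_right_comm, div_div]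
  have h3 : partialS S N 0 x = deriv F 0 := by
    have h4 := eventuallyEq_oddSinc hx 0 (fun ρ => Complex.sin (ρ * x) / ρ)
      (fun ρ => 1 / (2 * ρ)) (fun n => coeffS S n x) N
    simp only [div_div _ _ (Complex.sin _)] at h4
    refine byLimit_eq_of_eventuallyEq h4 ?_
    rwa [← h2]
  rw [h3]
  refine h1.congr' ?_
  filter_upwards [self_mem_nhdsWithin] with ρ hρ
  rw [partialS_eq hx S N hρ, ← congrFun h2 ρ]

/-! ### Uniform convergence and the common ε. -/

section Main

variable {q : ℝ → ℂ} {L x : ℝ} {h : ℂ} {S φ : ℂ → ℝ → ℂ}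

theorem tendstoUniformlyOn_of_bound {X : ℂ → ℂ} {XN : ℕ → ℂ → ℂ} {η : ℕ → ℝ} {K : ℝ} {s : Set ℂ}
    (hη : Tendsto η atTop (𝓝 0)) (hb : ∀ N, ∀ ρ ∈ s, ‖X ρ - XN N ρ‖ ≤ η N * K) :
    TendstoUniformlyOn XN X atTop s := by
  rw [Metric.tendstoUniformlyOn_iff]
  intro ε hε
  have h1 : Tendsto (fun N => η N * K) atTop (𝓝 0) := by simpa using hη.mul_const K
  filter_upwards [h1.eventually_lt_const hε] with N hN ρ hρ
  rw [dist_eq_norm]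
  exact (hb N ρ hρ).trans_lt hN

theorem tendstoUniformlyOn_partialS (hx : x ∈ Ioc 0 L)
    (hq : MemLp q 2 (volume.restrict (Ioc 0 L))) (hS : ∀ ρ : ℂ, IsSolution q L ρ 0 1 (S ρ))
    (C : ℝ) : TendstoUniformlyOn (fun (N : ℕ) (ρ : ℂ) => partialS S N ρ x) (fun ρ => S ρ x)
      atTop {ρ : ℂ | |ρ.im| ≤ C} := by
  have hL : 0 ≤ L := hx.1.le.trans hx.2
  obtain ⟨η, h0, h1, r, hr, hodd, he⟩ := S_remainder hx hq hS
  -- The strip is widened by 1 so that it contains the punctured unit disc; the bound at ρ = 0 is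
  -- then obtained as a limit, even when C = 0.
  have hb : ∀ N, ∀ ρ : ℂ, ρ ≠ 0 → |ρ.im| ≤ C + 1 → ‖S ρ x - partialS S N ρ x‖ ≤
      η N * (√(2 * x) * (Real.exp ((C + 1) * x) * x)) := fun N ρ hρ hρC => by
    rw [he N ρ hρ]
    exact (hr N).norm_div_le hx.1 (h0 N) (hodd N) hρ hρC
  refine tendstoUniformlyOn_of_bound h1
    (K := √(2 * x) * (Real.exp ((C + 1) * x) * x)) fun N ρ hρ => ?_
  rw [mem_ofPred_eq] at hρ
  by_cases hρ0 : ρ = 0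
  · subst hρ0
    have hC : 0 ≤ C := by simpa using hρ
    obtain ⟨M, hM0, hM⟩ := PWF.solution hL hq hS
    have hc := ((hM x (Ioc_subset_Icc_self hx)).continuousAt_zero hM0).tendsto.mono_left
      (nhdsWithin_le_nhds (s := {0}ᶜ))
    refine le_of_tendsto (hc.sub (tendsto_partialS_zero hx.1.ne' S N)).norm ?_
    have h2 : ∀ᶠ ρ : ℂ in 𝓝[≠] 0, ‖ρ‖ < 1 :=
      (continuous_norm.continuousAt.eventually_lt_const (by simp)).filter_mono nhdsWithin_le_nhds
    filter_upwards [self_mem_nhdsWithin, h2] with ρ hρ0 hρ1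
    exact hb N ρ hρ0 ((Complex.abs_im_le_norm ρ).trans (by linarith))
  · exact hb N ρ hρ0 (by linarith)

theorem tendstoUniformlyOn_partialPhi (hx : x ∈ Ioc 0 L)
    (hq : MemLp q 2 (volume.restrict (Ioc 0 L))) (hφ : ∀ ρ : ℂ, IsSolution q L ρ 1 h (φ ρ))
    {C : ℝ} (hC : 0 ≤ C) :
    TendstoUniformlyOn (fun (N : ℕ) (ρ : ℂ) => partialPhi φ N ρ x) (fun ρ => φ ρ x)
      atTop {ρ : ℂ | |ρ.im| ≤ C} := by
  obtain ⟨η, h0, h1, hr⟩ := phi_remainder hx hq hφ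
  exact tendstoUniformlyOn_of_bound h1 fun N ρ hρ =>
    (hr N).norm_le_stripFactor hx.1 (h0 N) hC hρ

theorem exists_remainderBound (hq : MemLp q 2 (volume.restrict (Ioc 0 L)))
    (hS : ∀ ρ : ℂ, IsSolution q L ρ 0 1 (S ρ)) (hφ : ∀ ρ : ℂ, IsSolution q L ρ 1 h (φ ρ))
    (hx : x ∈ Ioc 0 L) : ∃ E : ℕ → ℝ, (∀ N, 0 < E N) ∧ Tendsto E atTop (𝓝 0) ∧
      HasBound x 1 (fun ρ => S ρ x) (fun N ρ => partialS S N ρ x) E ∧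
      HasBound x 0 (fun ρ => φ ρ x) (fun N ρ => partialPhi φ N ρ x) E ∧
      HasBound x 1 (fun ρ => dx L (S ρ) x) (fun N ρ => partialDS L q S N ρ x) E ∧
      HasBound x 0 (fun ρ => dx L (φ ρ) x) (fun N ρ => partialDPhi L q h φ N ρ x) E := by
  have r1 : HasRemainder x 1 (fun ρ => S ρ x) (fun N ρ => partialS S N ρ x) := by
    obtain ⟨η, h0, h1, r, hr, -, he⟩ := S_remainder hx hq hS
    exact ⟨η, h0, h1, r, hr, fun N ρ hρ => by rw [pow_one]; exact he N ρ hρ⟩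
  have r2 : HasRemainder x 0 (fun ρ => φ ρ x) (fun N ρ => partialPhi φ N ρ x) := by
    obtain ⟨η, h0, h1, hr⟩ := phi_remainder hx hq hφ
    exact ⟨η, h0, h1, _, hr, fun N ρ _ => by rw [pow_zero, div_one]⟩
  obtain ⟨E₁, p1, t1, b1⟩ := r1.hasBound hx.1
  obtain ⟨E₂, p2, t2, b2⟩ := r2.hasBound hx.1
  obtain ⟨E₃, p3, t3, b3⟩ := (dS_remainder hx hq hS).hasBound hx.1
  obtain ⟨E₄, p4, t4, b4⟩ := (dPhi_remainder hx hq hφ).hasBound hx.1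
  refine ⟨fun N => E₁ N + E₂ N + E₃ N + E₄ N, fun N => ?_, ?_, b1.mono fun N => ?_,
    b2.mono fun N => ?_, b3.mono fun N => ?_, b4.mono fun N => ?_⟩
  · linarith [p1 N, p2 N, p3 N, p4 N]
  · simpa using ((t1.add t2).add t3).add t4
  all_goals linarith [p1 N, p2 N, p3 N, p4 N]

theorem exists_remainderBound_of_isW21 (hq : MemLp q 2 (volume.restrict (Ioc 0 L)))
    (hW : IsW21 q L) (hS : ∀ ρ : ℂ, IsSolution q L ρ 0 1 (S ρ))
    (hφ : ∀ ρ : ℂ, IsSolution q L ρ 1 h (φ ρ)) (hx : x ∈ Ioc 0 L) :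
    ∃ E : ℕ → ℝ, (∀ N, 0 < E N) ∧ Tendsto E atTop (𝓝 0) ∧
      HasBound x 3 (fun ρ => S ρ x) (fun N ρ => partialSNew q S N ρ x) E ∧
      HasBound x 2 (fun ρ => φ ρ x) (fun N ρ => partialPhiNew q h φ N ρ x) E := by
  obtain ⟨E₁, p1, t1, b1⟩ := (sNew_remainder hx hq hW hS).hasBound hx.1
  obtain ⟨E₂, p2, t2, b2⟩ := (phiNew_remainder hx hq hW hφ).hasBound hx.1
  refine ⟨fun N => E₁ N + E₂ N, fun N => ?_, ?_, b1.mono fun N => ?_, b2.mono fun N => ?_⟩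
  · linarith [p1 N, p2 N]
  · simpa using t1.add t2
  all_goals linarith [p1 N, p2 N]

end Main

end SincSL

theorem mainTheorem9 (L : ℝ) (hL : 0 < L) (q : ℝ → ℂ) (hq : SincSL.IsL2 q L) (h : ℂ)
    (S φ : ℂ → ℝ → ℂ)
    (hS : ∀ ρ : ℂ, SincSL.IsSolution q L ρ 0 1 (S ρ))
    (hφ : ∀ ρ : ℂ, SincSL.IsSolution q L ρ 1 h (φ ρ)) :
    (∃ ε : ℕ → ℝ → ℝ, SincSL.IsRemainderBound L ε ∧ ∀ x ∈ Ioc 0 L, ∀ N : ℕ,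
      (∀ ρ : ℝ, ρ ≠ 0 →
        ‖S ρ x - SincSL.partialS S N ρ x‖ ≤ ε N x / |ρ| ∧
        ‖φ ρ x - SincSL.partialPhi φ N ρ x‖ ≤ ε N x ∧
        ‖SincSL.dx L (S ρ) x - SincSL.partialDS L q S N ρ x‖ ≤ ε N x / |ρ| ∧
        ‖SincSL.dx L (φ ρ) x - SincSL.partialDPhi L q h φ N ρ x‖ ≤ ε N x) ∧
      (∀ C : ℝ, 0 ≤ C → ∀ ρ : ℂ, ρ ≠ 0 → |ρ.im| ≤ C →
        ‖S ρ x - SincSL.partialS S N ρ x‖ ≤ ε N x / ‖ρ‖ * SincSL.stripFactor C x ∧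
        ‖φ ρ x - SincSL.partialPhi φ N ρ x‖ ≤ ε N x * SincSL.stripFactor C x ∧
        ‖SincSL.dx L (S ρ) x - SincSL.partialDS L q S N ρ x‖
          ≤ ε N x / ‖ρ‖ * SincSL.stripFactor C x ∧
        ‖SincSL.dx L (φ ρ) x - SincSL.partialDPhi L q h φ N ρ x‖
          ≤ ε N x * SincSL.stripFactor C x)) ∧
    (∀ x ∈ Ioc 0 L, ∀ C : ℝ, 0 ≤ C →
      TendstoUniformlyOn (fun (N : ℕ) (ρ : ℂ) => SincSL.partialS S N ρ x)
        (fun ρ => S ρ x) atTop {ρ : ℂ | |ρ.im| ≤ C} ∧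
      TendstoUniformlyOn (fun (N : ℕ) (ρ : ℂ) => SincSL.partialPhi φ N ρ x)
        (fun ρ => φ ρ x) atTop {ρ : ℂ | |ρ.im| ≤ C}) ∧
    (SincSL.IsW21 q L →
      ∃ ε : ℕ → ℝ → ℝ, SincSL.IsRemainderBound L ε ∧ ∀ x ∈ Ioc 0 L, ∀ N : ℕ,
        (∀ ρ : ℝ, ρ ≠ 0 →
          ‖S ρ x - SincSL.partialSNew q S N ρ x‖ ≤ ε N x / |ρ| ^ 3 ∧
          ‖φ ρ x - SincSL.partialPhiNew q h φ N ρ x‖ ≤ ε N x / |ρ| ^ 2) ∧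
        (∀ C : ℝ, 0 ≤ C → ∀ ρ : ℂ, ρ ≠ 0 → |ρ.im| ≤ C →
          ‖S ρ x - SincSL.partialSNew q S N ρ x‖
            ≤ ε N x / ‖ρ‖ ^ 3 * SincSL.stripFactor C x ∧
          ‖φ ρ x - SincSL.partialPhiNew q h φ N ρ x‖
            ≤ ε N x / ‖ρ‖ ^ 2 * SincSL.stripFactor C x)) := by
  have hq' : MemLp q 2 (volume.restrict (Ioc 0 L)) :=
    hq.mono_measure (Measure.restrict_mono Ioc_subset_Icc_self le_rfl)
  refine ⟨?_, fun x hx C hC => ⟨SincSL.tendstoUniformlyOn_partialS hx hq' hS C,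
    SincSL.tendstoUniformlyOn_partialPhi hx hq' hφ hC⟩, fun hW => ?_⟩
  · have key := fun x (hx : x ∈ Ioc 0 L) => SincSL.exists_remainderBound hq' hS hφ hx
    choose! E hpos hlim h1 h2 h3 h4 using key
    refine ⟨fun N x => E x N, fun x hx => ⟨hpos x hx, hlim x hx⟩, fun x hx N =>
      ⟨fun ρ hρ => ⟨?_, ?_, ?_, ?_⟩, fun C hC ρ hρ hρC => ⟨?_, ?_, ?_, ?_⟩⟩⟩
    · simpa using (h1 x hx N).1 ρ hρ
    · simpa using (h2 x hx N).1 ρ hρ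
    · simpa using (h3 x hx N).1 ρ hρ
    · simpa using (h4 x hx N).1 ρ hρ
    · simpa using (h1 x hx N).2 C hC ρ hρ hρC
    · simpa using (h2 x hx N).2 C hC ρ hρ hρC
    · simpa using (h3 x hx N).2 C hC ρ hρ hρC
    · simpa using (h4 x hx N).2 C hC ρ hρ hρC
  · have key := fun x (hx : x ∈ Ioc 0 L) =>
      SincSL.exists_remainderBound_of_isW21 hq' hW hS hφ hx
    choose! E hpos hlim h1 h2 using key
    exact ⟨fun N x => E x N, fun x hx => ⟨hpos x hx, hlim x hx⟩, fun x hx N =>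
      ⟨fun ρ hρ => ⟨(h1 x hx N).1 ρ hρ, (h2 x hx N).1 ρ hρ⟩, fun C hC ρ hρ hρC =>
        ⟨(h1 x hx N).2 C hC ρ hρ hρC, (h2 x hx N).2 C hC ρ hρ hρC⟩⟩⟩
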